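/- **Setting.** Let $T>0$, let $Q$ be a smooth $N$-dimensional manifold and let $K\subset\mathbb R^M$ be the closure of a bounded open set with smooth boundary (more generally, any set on which derivatives within $K$ are unique). $J^n(Q|\mathbb R)$ denotes the space of $n$-jets $j^n_t(\gamma)$ of curves $\gamma(t)=(t,q(t))$, with canonical coordinates $(t,q^i_{(0)},\dots,q^i_{(n)})$ in each chart $(q^i)$ of $Q$. Fix * a smooth function $L$ on $J^n(Q|\mathbb R)\times K$ of order $r\ge 1$ (i.e. independent of $q^i_{(\beta)}$ for $\beta>r$), with $2r+1\le n$; * a smooth function $C$ on $J^n(Q|\mathbb R)$ of order $\tilde r\le n-1$, vanishing on all jets at $t=0$; * a set $\mathscr K$ of pairs $U=(u,\sigma)$, with $u:[0,T]\to K$ a control curve and $\sigma$ a $(2r-1)$-jet at $t=0$. A smooth curve $q:[0,T]\to Q$ is *$\mathscr K$-controlled, with smooth control curve* $u:[0,T]\to K$, if $(u,\sigma)\in\mathscr K$ with $\sigma=j^{2r-1}_0(\gamma)$ and $q$ satisfies the Euler–Lagrange equations of the time-dependent Lagrangian $L^{u(\cdot)}(t,q_{(\beta)})=L(t,q_{(\beta)},u(t))$,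 $$\sum_{\delta=0}^r(-1)^\delta\frac{d^\delta}{dt^\delta}\Big(\frac{\partial L}{\partial q^i_{(\delta)}}\Big|_{(j^n_t(\gamma),u(t))}\Big)=0\qquad(1\le i\le N,\ t\in[0,T]).$$ It is *optimal* if $C(j^n_T(\gamma))$ is minimal among all $\mathscr K$-controlled curves. A *$\mathscr K$-controlled variation* $F$ of $\gamma_o=(t,q_o(t))$, with control $u_o$, is a pair of maps $q(t,s)$, $u(t,s)$, smooth on $[0,T]\times[0,1]$, such that $q(\cdot,s)$ is $\mathscr K$-controlled with control $u(\cdot,s)$ for each $s\in[0,1]$, $q(\cdot,0)=q_o$ and $u(\cdot,0)=u_o$. Its Jacobi field $V$ along $j^n_t(\gamma_o)$ has the components $Y^i_{(\beta)}=\partial_s q^i_{(\beta)}|_{s=0}$ (and $0$ along $t$); put $Y^a=\partial_s u^a|_{s=0}$ and $\mathscr P_{j}(w)=-L(j,w)$ for $j\in J^n(Q|\mathbb R)$, $w\in K$. **The function $\mu'$.** Choose coordinates of $Q$ around $q_o(0)$, used for data at $t=0$, and around $q_o(T)$, used for data at $t=T$ (if one chart contains both points, the same coordinates may be taken). Let $m=\max\{r,\tilde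 r+1\}$ (so $m=r$ if $\tilde r\le r-1$) and, for $0\le\beta\le m-1$ and a Lagrangian $f$ of order at most $m$, $$p^i_\beta[f](t)=\sum_{\delta=\beta+1}^{m}(-1)^{\delta-\beta-1}\frac{d^{\,\delta-\beta-1}}{dt^{\,\delta-\beta-1}}\Big(\frac{\partial f}{\partial q^i_{(\delta)}}\Big),$$ the time derivatives being taken along the controlled curve $(q(t),u(t))$. With each controlled curve (with end points in the chosen charts) associate the functions $$\mathbf h^i_\beta=A^i_\beta e^t+B^i_\beta e^{-t},\qquad A^i_\beta+B^i_\beta=q^i_{(\beta)}(0),\quad A^i_\beta-B^i_\beta=-p^i_\beta[L](0),$$ and $\mathbf h'^i_\beta,\mathbf h''^i_\beta$, the linear combinations of $e^{\pm\pi t/2T},\cos\frac{\pi t}{2T},\sin\frac{\pi t}{2T}$ that vanish at $t=0$ together with their first derivatives and satisfy $$\dot{\mathbf h}'^i_\beta(T)=q^i_{(\beta)}(T),\quad \ddot{\mathbf h}'^i_\beta(T)=p^i_\beta\big[L+\tfrac{dC}{dt}\big](T),\qquad \dot{\mathbf h}''^i_\beta(T)=\mathbf h^i_\beta(T),\quad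 \ddot{\mathbf h}''^i_\beta(T)=\dot{\mathbf h}^i_\beta(T),$$ where $dC/dt$ is the total derivative of $C$. For a variation, let $\mathbf h,\mathbf h',\mathbf h''$ depend on $s$ through $(q(\cdot,s),u(\cdot,s))$ and, for $s\ge0$ small enough that the end points stay in the charts, let $$\mu(t,s)=-\int_0^t\Big(L+\tfrac12\sum_{i,\beta}\big((\dot{\mathbf h}^i_\beta)^2-(\ddot{\mathbf h}'^i_\beta)^2-(\ddot{\mathbf h}''^i_\beta)^2\big)+\sum_{i,\beta}\big(\tfrac12(\mathbf h^i_\beta)^2+\tfrac{\pi^4}{32T^4}(\mathbf h'^i_\beta)^2+\tfrac{\pi^4}{32T^4}(\mathbf h''^i_\beta)^2\big)\Big)\Big|_{(\tau,s)}d\tau,$$ $$\mu'(t,s)=\mu(t,s)+\sum_{\beta=0}^{m-1}\sum_{i=1}^N\int_0^s\Big(\dddot{\mathbf h}'^i_\beta\,\partial_v\mathbf h'^i_\beta+\dddot{\mathbf h}''^i_\beta\,\partial_v\mathbf h''^i_\beta\Big)\Big|_{(t,v)}dv .$$ **Theorem.** If $\gamma_o$, with control $u_o$, is optimal, then for every $\mathscr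 K$-controlled variation $F$ of $\gamma_o$, with Jacobi field $V$, and every choice of the coordinates around $q_o(0)$ and $q_o(T)$: 1. $dC\big(V|_{j^n_T(\gamma_o)}\big)\ge0$; 2. the following integrand is integrable on $[0,T]$ and $$\int_0^T\Big(Y^a\frac{\partial\mathscr P_{j^n_t(\gamma_o)}}{\partial u^a}\Big|_{u_o(t)}-\frac{\partial^2\mu'}{\partial t\,\partial s}\Big|_{(t,0)}\Big)dt\le0 .$$ -/

import Mathlib

open scoped Manifold ContDiff RealInnerProductSpace

noncomputable section

/-- The model space `ℝ^N`. -/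
abbrev Euc (N : ℕ) : Type := EuclideanSpace ℝ (Fin N)

/-! ### Jets of curves in a manifold -/

/-- The jet space `J^n(Q|ℝ)`.  A jet at `time` is given by its base `point` together with the
derivatives of orders `1, …, n`, expressed in the preferred chart `chartAt point`
(in the same way as Mathlib represents tangent vectors). -/
structure CurveJet (n N : ℕ) (Q : Type*) where
  time : ℝ
  point : Q
  deriv : Fin n → Euc N

section Jets

variable {N : ℕ} {Q : Type*} [TopologicalSpace Q] [ChartedSpace (Euc N) Q]

/-- The `n`-jet at the time `t` of the graph of a curve `q : I → Q`
(derivatives are taken along `I`, so they are one-sided at end points of `I`). -/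
def curveJet (n : ℕ) (I : Set ℝ) (q : ℝ → Q) (t : ℝ) : CurveJet n N Q where
  time := t
  point := q t
  deriv := fun β => iteratedDerivWithin (β + 1) (fun τ => chartAt (Euc N) (q t) (q τ)) I t

/-- The jet with canonical coordinates `(t, x_(0), …, x_(n))` with respect to the chart `φ`:
the jet at `t` of the curve whose coordinate expression is `τ ↦ ∑ (τ - t)^β / β! x_(β)`. -/
def jetOfCoords {n : ℕ} (φ : OpenPartialHomeomorph Q (Euc N)) (t : ℝ)
    (x : Fin (n + 1) → Euc N) : CurveJet n N Q :=
  curveJet n Set.univ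
    (fun τ => φ.symm (∑ β : Fin (n + 1), ((τ - t) ^ (β : ℕ) / (Nat.factorial β : ℝ)) • x β)) t

/-- The canonical jet coordinates `(q_(0)(t), …, q_(n)(t))` of a curve in the chart `φ`. -/
def jetCoords (n : ℕ) (I : Set ℝ) (φ : OpenPartialHomeomorph Q (Euc N)) (q : ℝ → Q) (t : ℝ) :
    Fin (n + 1) → Euc N :=
  fun β => iteratedDerivWithin β (fun τ => φ (q τ)) I t

end Jets

/-- The vector `(∂f/∂x^i_(δ))_i`, for a function `f` of the variables
`x = (x^i_(δ))`, `0 ≤ δ ≤ n`, `1 ≤ i ≤ N`. -/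
def partialGrad {n N : ℕ} (f : (Fin (n + 1) → Euc N) → ℝ) (δ : Fin (n + 1))
    (x : Fin (n + 1) → Euc N) : Euc N :=
  gradient (fun y => f (Function.update x δ y)) (x δ)

/-- `(x_(0), …, x_(n)) ↦ (x_(1), …, x_(n), 0)`. -/
def shiftJet {n N : ℕ} (x : Fin (n + 1) → Euc N) : Fin (n + 1) → Euc N :=
  fun β => if h : (β : ℕ) + 1 < n + 1 then x ⟨β + 1, h⟩ else 0

/-- The total derivative `df/dt = ∂f/∂t + ∑ ∂f/∂x_(δ) · x_(δ+1)`, for a function `f` of the jet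
coordinates of order at most `n - 1`. -/
def totalDeriv {n N : ℕ} (f : ℝ → (Fin (n + 1) → Euc N) → ℝ) (t : ℝ)
    (x : Fin (n + 1) → Euc N) : ℝ :=
  fderiv ℝ (fun p : ℝ × (Fin (n + 1) → Euc N) => f p.1 p.2) (t, x) (1, shiftJet x)

/-! ### Euler-Lagrange expressions and momenta along a curve

In this section `f = f(t, x_(0), …, x_(n), u)` is the expression of a controlled Lagrangian in a
chart `φ`.  The time derivatives are derivatives along the curve `t ↦ (q(t), u(t))`, that is,
total derivatives for the time-dependent Lagrangian `f(t, x, u(t))`.  As functions of time, the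
quantities are only relevant in a neighbourhood of times `t` with `q(t)` in the domain of `φ`. -/

section Momenta

variable {n N M : ℕ} {Q : Type*} [TopologicalSpace Q] [ChartedSpace (Euc N) Q]

/-- `t ↦ ∂f/∂q_(δ)` along the controlled curve `(q, u)`. -/
def gradAlong (I : Set ℝ) (φ : OpenPartialHomeomorph Q (Euc N))
    (f : ℝ → (Fin (n + 1) → Euc N) → Euc M → ℝ) (u : ℝ → Euc M) (q : ℝ → Q)
    (δ : Fin (n + 1)) (t : ℝ) : Euc N :=
  partialGrad (fun x => f t x (u t)) δ (jetCoords n I φ q t)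

/-- The Euler-Lagrange expression `∑_δ (-1)^δ (d/dt)^δ (∂f/∂q_(δ))`. -/
def eulerLagrange (I : Set ℝ) (φ : OpenPartialHomeomorph Q (Euc N))
    (f : ℝ → (Fin (n + 1) → Euc N) → Euc M → ℝ) (u : ℝ → Euc M) (q : ℝ → Q)
    (t : ℝ) : Euc N :=
  ∑ δ : Fin (n + 1),
    (-1 : ℝ) ^ (δ : ℕ) • iteratedDerivWithin δ (gradAlong I φ f u q δ) I t

/-- The momentum `∑ (-1)^ε (d/dt)^ε (∂f/∂q_(δ))`, the sum being over `δ, ε` with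
`δ - ε - 1 = β`.  (Terms with `δ` larger than the order of `f` vanish.) -/
def momentum (I : Set ℝ) (φ : OpenPartialHomeomorph Q (Euc N))
    (f : ℝ → (Fin (n + 1) → Euc N) → Euc M → ℝ) (u : ℝ → Euc M) (q : ℝ → Q)
    (β : ℕ) (t : ℝ) : Euc N :=
  ∑ δ ∈ Finset.univ.filter (fun δ : Fin (n + 1) => β < (δ : ℕ)),
    (-1 : ℝ) ^ ((δ : ℕ) - β - 1) •
      iteratedDerivWithin ((δ : ℕ) - β - 1) (gradAlong I φ f u q δ) I t

end Momenta

/-! ### Defining triples and the generalised Mayer problem -/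

/-- The data `(𝒦, L, C)` of a generalised Mayer problem on the time interval `[0, T]` and on the
`N`-dimensional manifold `Q`, with `M` real control parameters. -/
structure DefiningTriple (N M : ℕ) (Q : Type*) [TopologicalSpace Q] [ChartedSpace (Euc N) Q]
    (T : ℝ) where
  /-- order of the jet space -/
  n : ℕ
  /-- actual order of the Lagrangian -/
  r : ℕ
  /-- actual order of the cost function -/
  rC : ℕ
  one_le_r : 1 ≤ r
  r_le : 2 * r + 1 ≤ n
  rC_le : rC + 1 ≤ n
  /-- The set of the control values.  The following condition makes derivatives within `K`
  meaningful; it holds for the closure of an open set with smooth boundary. -/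
  K : Set (Euc M)
  uniqueDiffOn_K : UniqueDiffOn ℝ K
  /-- the set `𝒦` of pairs `(u(t), σ)` of a control curve on `[0,T]` and an initial jet -/
  controls : Set ((Set.Icc (0 : ℝ) T → Euc M) × CurveJet (2 * r - 1) N Q)
  /-- the controlled Lagrangian, a smooth function on `J^n(Q|ℝ) × K` (its values for controls
  outside `K` play no role) -/
  L : CurveJet n N Q → Euc M → ℝ
  smooth_L : ∀ φ ∈ IsManifold.maximalAtlas (𝓡 N) ∞ Q,
    ContDiffOn ℝ ∞
      (fun p : (ℝ × (Fin (n + 1) → Euc N)) × Euc M => L (jetOfCoords φ p.1.1 p.1.2) p.2)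
      {p | p.1.2 0 ∈ φ.target ∧ p.2 ∈ K}
  order_L : ∀ φ ∈ IsManifold.maximalAtlas (𝓡 N) ∞ Q, ∀ t : ℝ,
    ∀ x y : Fin (n + 1) → Euc N, x 0 ∈ φ.target →
      (∀ β : Fin (n + 1), (β : ℕ) ≤ r → x β = y β) →
        ∀ w ∈ K, L (jetOfCoords φ t x) w = L (jetOfCoords φ t y) w
  /-- the (extended) cost function, a smooth function on `J^n(Q|ℝ)` -/
  C : CurveJet n N Q → ℝ
  smooth_C : ∀ φ ∈ IsManifold.maximalAtlas (𝓡 N) ∞ Q,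
    ContDiffOn ℝ ∞
      (fun p : ℝ × (Fin (n + 1) → Euc N) => C (jetOfCoords φ p.1 p.2)) {p | p.2 0 ∈ φ.target}
  order_C : ∀ φ ∈ IsManifold.maximalAtlas (𝓡 N) ∞ Q, ∀ t : ℝ,
    ∀ x y : Fin (n + 1) → Euc N, x 0 ∈ φ.target →
      (∀ β : Fin (n + 1), (β : ℕ) ≤ rC → x β = y β) →
        C (jetOfCoords φ t x) = C (jetOfCoords φ t y)
  C_zero : ∀ j : CurveJet n N Q, j.time = 0 → C j = 0

/-- The matrix of the boundary value problem for the functions `h'` and `h''`. -/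
def boundaryMatrix (T : ℝ) : Matrix (Fin 4) (Fin 4) ℝ :=
  let a := Real.pi / (2 * T)
  !![1, 1, 1, 0;
     a, -a, 0, a;
     a * Real.exp (Real.pi / 2), -a * Real.exp (-(Real.pi / 2)), -a, 0;
     a ^ 2 * Real.exp (Real.pi / 2), a ^ 2 * Real.exp (-(Real.pi / 2)), 0, -a ^ 2]

/-- The (vector valued) function `A e^{at} + B e^{-at} + C cos(at) + D sin(at)`, `a = π/(2T)`,
with `(A, B, C, D)` the image of `(0, 0, c, d)` under the inverse of `boundaryMatrix T`. It vanishes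
at `0` with its first derivative, and has first and second derivatives `c` and `d` at `T`. -/
def boundarySolution {N : ℕ} (T : ℝ) (c d : Euc N) (t : ℝ) : Euc N :=
  let a := Real.pi / (2 * T)
  let coeff : Fin 4 → Euc N := fun k =>
    (boundaryMatrix T)⁻¹ k 2 • c + (boundaryMatrix T)⁻¹ k 3 • d
  Real.exp (a * t) • coeff 0 + Real.exp (-(a * t)) • coeff 1
    + Real.cos (a * t) • coeff 2 + Real.sin (a * t) • coeff 3

namespace DefiningTriple

variable {N M : ℕ} {Q : Type*} [TopologicalSpace Q] [ChartedSpace (Euc N) Q] {T : ℝ}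

/-- The expression of the Lagrangian in the jet coordinates of the chart `φ`. -/
def lagrangianIn (D : DefiningTriple N M Q T) (φ : OpenPartialHomeomorph Q (Euc N)) (t : ℝ)
    (x : Fin (D.n + 1) → Euc N) (w : Euc M) : ℝ :=
  D.L (jetOfCoords φ t x) w

/-- The expression of the cost function in the jet coordinates of the chart `φ`. -/
def costIn (D : DefiningTriple N M Q T) (φ : OpenPartialHomeomorph Q (Euc N)) (t : ℝ)
    (x : Fin (D.n + 1) → Euc N) : ℝ :=
  D.C (jetOfCoords φ t x)

/-- `L + dC/dt` in the jet coordinates of the chart `φ`. -/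
def modifiedLagrangianIn (D : DefiningTriple N M Q T) (φ : OpenPartialHomeomorph Q (Euc N))
    (t : ℝ) (x : Fin (D.n + 1) → Euc N) (w : Euc M) : ℝ :=
  D.lagrangianIn φ t x w + totalDeriv (D.costIn φ) t x

/-- The order of `L + dC/dt`: it is `r` when the cost function has order at most `r - 1`. -/
def order (D : DefiningTriple N M Q T) : ℕ := max D.r (D.rC + 1)

/-- `q : [0,T] → Q` is a `𝒦`-controlled curve, with control curve `u`: for some pair
`(u, σ) ∈ 𝒦`, it is a solution of the controlled Euler-Lagrange equations determined by `u`,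
whose initial jet of order `2r-1` is `σ`. -/
structure IsControlled (D : DefiningTriple N M Q T) (u : ℝ → Euc M) (q : ℝ → Q) : Prop where
  smooth_u : ContDiffOn ℝ ∞ u (Set.Icc 0 T)
  mem_K : ∀ t ∈ Set.Icc (0 : ℝ) T, u t ∈ D.K
  smooth_q : ContMDiffOn 𝓘(ℝ, ℝ) (𝓡 N) ∞ q (Set.Icc 0 T)
  mem_controls :
    ((Set.Icc (0 : ℝ) T).domRestrict u, curveJet (2 * D.r - 1) (Set.Icc 0 T) q 0) ∈ D.controls
  eulerLagrange_eq : ∀ t ∈ Set.Icc (0 : ℝ) T, ∀ φ ∈ IsManifold.maximalAtlas (𝓡 N) ∞ Q,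
    q t ∈ φ.source → eulerLagrange (Set.Icc 0 T) φ (D.lagrangianIn φ) u q t = 0

/-- The terminal cost of a curve. -/
def terminalCost (D : DefiningTriple N M Q T) (q : ℝ → Q) : ℝ :=
  D.C (curveJet D.n (Set.Icc 0 T) q T)

/-- `q`, with control curve `u`, is a solution of the generalised Mayer problem. -/
def IsOptimal (D : DefiningTriple N M Q T) (u : ℝ → Euc M) (q : ℝ → Q) : Prop :=
  D.IsControlled u q ∧
    ∀ (u' : ℝ → Euc M) (q' : ℝ → Q), D.IsControlled u' q' → D.terminalCost q ≤ D.terminalCost q'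

/-- `(t, s) ↦ (q t s, u t s)` on `[0,T] × [0,1]` is a `𝒦`-controlled variation of `(q₀, u₀)`. -/
structure IsControlledVariation (D : DefiningTriple N M Q T) (u₀ : ℝ → Euc M) (q₀ : ℝ → Q)
    (u : ℝ → ℝ → Euc M) (q : ℝ → ℝ → Q) : Prop where
  smooth_u : ContDiffOn ℝ ∞ (fun p : ℝ × ℝ => u p.1 p.2) (Set.Icc 0 T ×ˢ Set.Icc 0 1)
  smooth_q : ContMDiffOn 𝓘(ℝ, ℝ × ℝ) (𝓡 N) ∞ (fun p : ℝ × ℝ => q p.1 p.2)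
    (Set.Icc 0 T ×ˢ Set.Icc 0 1)
  controlled : ∀ s ∈ Set.Icc (0 : ℝ) 1, D.IsControlled (fun t => u t s) (fun t => q t s)
  initial_u : ∀ t ∈ Set.Icc (0 : ℝ) T, u t 0 = u₀ t
  initial_q : ∀ t ∈ Set.Icc (0 : ℝ) T, q t 0 = q₀ t

/-- The jet components `Y_(β) = ∂q_(β)/∂s` at `(t, 0)`, in the chart `φ`, of the Jacobi vector
field determined by a variation. -/
def jacobiField (D : DefiningTriple N M Q T) (φ : OpenPartialHomeomorph Q (Euc N))
    (q : ℝ → ℝ → Q) (t : ℝ) : Fin (D.n + 1) → Euc N :=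
  derivWithin (fun s => jetCoords D.n (Set.Icc 0 T) φ (fun τ => q τ s) t) (Set.Icc 0 1) 0

/-- `dC(V)` at the jet at time `t` of the initial curve `q(·, 0)` of a variation, for the Jacobi
vector field `V` determined by the variation, computed in the chart `φ`. -/
def costDifferential (D : DefiningTriple N M Q T) (φ : OpenPartialHomeomorph Q (Euc N))
    (q : ℝ → ℝ → Q) (t : ℝ) : ℝ :=
  fderiv ℝ (D.costIn φ t) (jetCoords D.n (Set.Icc 0 T) φ (fun τ => q τ 0) t)
    (D.jacobiField φ q t)

/-! ### The auxiliary functions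

`φ₀` and `φ₁` are coordinate systems around the initial and the terminal point of the curves. -/

/-- `h_β(t) = A e^t + B e^{-t}`, with `A + B` equal to the `β`-th derivative of `q` at `0` and
`A - B` equal to minus the `β`-th momentum of `L` at `0`. -/
def auxH (D : DefiningTriple N M Q T) (φ₀ : OpenPartialHomeomorph Q (Euc N))
    (u : ℝ → Euc M) (q : ℝ → Q) (β : ℕ) (t : ℝ) : Euc N :=
  let a := iteratedDerivWithin β (fun τ => φ₀ (q τ)) (Set.Icc 0 T) 0
  let b := -momentum (Set.Icc 0 T) φ₀ (D.lagrangianIn φ₀) u q β 0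
  Real.exp t • ((1 / 2 : ℝ) • (a + b)) + Real.exp (-t) • ((1 / 2 : ℝ) • (a - b))

/-- `h'_β(t)`, determined by the `β`-th derivative of `q` and by the `β`-th momentum of
`L + dC/dt` at the time `T`. -/
def auxH' (D : DefiningTriple N M Q T) (φ₁ : OpenPartialHomeomorph Q (Euc N))
    (u : ℝ → Euc M) (q : ℝ → Q) (β : ℕ) (t : ℝ) : Euc N :=
  boundarySolution T
    (iteratedDerivWithin β (fun τ => φ₁ (q τ)) (Set.Icc 0 T) T)
    (momentum (Set.Icc 0 T) φ₁ (D.modifiedLagrangianIn φ₁) u q β T) t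

/-- `h''_β(t)`, determined by the values of `h_β` and of its derivative at the time `T`. -/
def auxH'' (D : DefiningTriple N M Q T) (φ₀ : OpenPartialHomeomorph Q (Euc N))
    (u : ℝ → Euc M) (q : ℝ → Q) (β : ℕ) (t : ℝ) : Euc N :=
  boundarySolution T (D.auxH φ₀ u q β T) (deriv (D.auxH φ₀ u q β) T) t

/-- The integrand of `-μ`, along one curve. -/
def muDensity (D : DefiningTriple N M Q T) (φ₀ φ₁ : OpenPartialHomeomorph Q (Euc N))
    (u : ℝ → Euc M) (q : ℝ → Q) (t : ℝ) : ℝ :=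
  D.L (curveJet D.n (Set.Icc 0 T) q t) (u t)
    + (1 / 2) * ∑ β ∈ Finset.range D.order,
        (‖deriv (D.auxH φ₀ u q β) t‖ ^ 2 - ‖iteratedDeriv 2 (D.auxH' φ₁ u q β) t‖ ^ 2
          - ‖iteratedDeriv 2 (D.auxH'' φ₀ u q β) t‖ ^ 2)
    + ∑ β ∈ Finset.range D.order,
        ((1 / 2) * ‖D.auxH φ₀ u q β t‖ ^ 2
          + Real.pi ^ 4 / (32 * T ^ 4) * ‖D.auxH' φ₁ u q β t‖ ^ 2
          + Real.pi ^ 4 / (32 * T ^ 4) * ‖D.auxH'' φ₀ u q β t‖ ^ 2)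

/-- The function `μ(t, s)` of a variation. -/
def mu (D : DefiningTriple N M Q T) (φ₀ φ₁ : OpenPartialHomeomorph Q (Euc N))
    (u : ℝ → ℝ → Euc M) (q : ℝ → ℝ → Q) (t s : ℝ) : ℝ :=
  -∫ τ in (0 : ℝ)..t, D.muDensity φ₀ φ₁ (fun x => u x s) (fun x => q x s) τ

/-- The function `μ'(t, s)` of a variation. -/
def mu' (D : DefiningTriple N M Q T) (φ₀ φ₁ : OpenPartialHomeomorph Q (Euc N))
    (u : ℝ → ℝ → Euc M) (q : ℝ → ℝ → Q) (t s : ℝ) : ℝ :=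
  D.mu φ₀ φ₁ u q t s
    + ∑ β ∈ Finset.range D.order, ∫ v in (0 : ℝ)..s,
        (⟪iteratedDeriv 3 (D.auxH' φ₁ (fun x => u x v) (fun x => q x v) β) t,
            derivWithin (fun v' => D.auxH' φ₁ (fun x => u x v') (fun x => q x v') β t)
              (Set.Icc 0 1) v⟫
          + ⟪iteratedDeriv 3 (D.auxH'' φ₀ (fun x => u x v) (fun x => q x v) β) t,
            derivWithin (fun v' => D.auxH'' φ₀ (fun x => u x v') (fun x => q x v') β t)
              (Set.Icc 0 1) v⟫)

/-- The function `𝒫_j(w) = -L(j, w)` of the control values. -/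
def pontryagin (D : DefiningTriple N M Q T) (j : CurveJet D.n N Q) (w : Euc M) : ℝ :=
  -D.L j w

/-- `Y^a ∂𝒫/∂u^a - ∂²μ'/∂t∂s` at `(t, 0)`. -/
def labourDensity (D : DefiningTriple N M Q T) (φ₀ φ₁ : OpenPartialHomeomorph Q (Euc N))
    (u : ℝ → ℝ → Euc M) (q : ℝ → ℝ → Q) (t : ℝ) : ℝ :=
  fderivWithin ℝ (D.pontryagin (curveJet D.n (Set.Icc 0 T) (fun τ => q τ 0) t)) D.K (u t 0)
      (derivWithin (fun s => u t s) (Set.Icc 0 1) 0)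
    - derivWithin
        (fun τ => derivWithin (fun s => D.mu' φ₀ φ₁ u q τ s) (Set.Icc 0 1) 0) (Set.Icc 0 T) t

end DefiningTriple

end

/-! The whole theorem rests on one identity: the integral over `[0,T]` in part 2 equals `-dC(V)` at
time `T`. It holds for every variation whose curve at `s = 0` solves the Euler–Lagrange equations
(`SmoothFamily.integral_labourDensity`). Optimality enters only afterwards: `s ↦ C(j_T)` is minimal
at `s = 0`, so its right derivative `dC(V)` is nonnegative.

For the identity, the `t`-derivative of `μ` is minus the density of `μ`, so `-∂²μ/∂t∂s` is the
`s`-derivative of `L` plus that of the quadratic terms. The part of `∂L/∂s` due to the control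
cancels `Y^a ∂𝒫/∂u^a`. What remains is the work: the derivative of `L` along the Jacobi field with
the control frozen at `u(t,0)`. By integration by parts and the Euler–Lagrange equations, the work
integrates to the pairing `∑ ⟪p_β[L], Y_(β)⟫` at `T` minus the same pairing at `0`
(`SmoothFamily.integral_work`). The curve need not lie in one chart, so the field is cut by a
partition of unity in time whose pieces near `0` and `T` use the two prescribed charts.

The quadratic terms are Lagrangians of which `h`, `h'`, `h''` are extremals. With `a = π/(2T)`, `h`
satisfies `ḧ = h`, while `h'` and `h''` have fourth derivative `a^4` times themselves, and `a^4 / 2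
= π^4/(32T^4)`. Hence their variations are also total derivatives. The extra sum in `μ'` removes the
boundary terms with third derivatives, leaving `⟪ḣ, δh⟫ - ⟪ḧ', δḣ'⟫ - ⟪ḧ'', δḣ''⟫`. The boundary
data make this `-⟪p_β[L], Y_(β)⟫` at `0` and `-⟪p_β[L + dC/dt], Y_(β)⟫` at `T`, where the
contributions of `h` and `h''` cancel.

Finally, the momenta of `dC/dt` are `∂C/∂q_(β)` (`SmoothFamily.momentum_totalDeriv`), so the pairing
with the momenta of `L + dC/dt` exceeds the one for `L` by exactly `dC(V)`. All the other boundary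
terms cancel. -/

noncomputable section

open Set Filter Topology

/-! ### Partial derivatives along a product of two subsets of the line -/

section ProductDerivatives

variable {E F : Type*} [NormedAddCommGroup E] [NormedSpace ℝ E]
  [NormedAddCommGroup F] [NormedSpace ℝ F] {I J : Set ℝ}

/-- Smoothness of order `∞` at a point does not spread to a neighbourhood, since the neighbourhood
may shrink as the order grows. Each finite order does spread, which is what the pointwise arguments
below use. -/
theorem ContDiffWithinAt.eventually_nat {X : Type*} [NormedAddCommGroup X] [NormedSpace ℝ X]
    {f : X → E} {S : Set X} {x : X} (hf : ContDiffWithinAt ℝ ∞ f S x) (m : ℕ) (hx : x ∈ S) :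
    ∀ᶠ y in 𝓝[S] x, ContDiffWithinAt ℝ m f S y := by
  have := (hf.of_le (m := (m : ℕ)) (by exact_mod_cast le_top)).eventually (by simp)
  rwa [insert_eq_of_mem hx] at this

theorem ContDiffWithinAt.derivWithin_infty {f : ℝ → E} {t : ℝ} (hI : UniqueDiffOn ℝ I)
    (ht : t ∈ I) (hf : ContDiffWithinAt ℝ ∞ f I t) :
    ContDiffWithinAt ℝ ∞ (derivWithin f I) I t := by
  have h := hf.fderivWithin_right (m := ∞) hI (by simp) ht
  exact h.clm_apply contDiffWithinAt_const

theorem ContDiffWithinAt.iteratedDerivWithin_infty {f : ℝ → E} {t : ℝ} (hI : UniqueDiffOn ℝ I)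
    (ht : t ∈ I) (hf : ContDiffWithinAt ℝ ∞ f I t) (k : ℕ) :
    ContDiffWithinAt ℝ ∞ (iteratedDerivWithin k f I) I t := by
  induction k with
  | zero => simpa using hf
  | succ k ih =>
    have : iteratedDerivWithin (k + 1) f I = derivWithin (iteratedDerivWithin k f I) I := by
      ext x; rw [iteratedDerivWithin_succ]
    rw [this]
    exact ih.derivWithin_infty hI ht

theorem DifferentiableWithinAt.hasDerivWithinAt_fst {f : ℝ × ℝ → E} {t s : ℝ}
    (hf : DifferentiableWithinAt ℝ f (I ×ˢ J) (t, s)) (hs : s ∈ J) :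
    HasDerivWithinAt (fun τ => f (τ, s)) (fderivWithin ℝ f (I ×ˢ J) (t, s) (1, 0)) I t := by
  have h1 : HasDerivWithinAt (fun τ : ℝ => (τ, s)) ((1 : ℝ), (0 : ℝ)) I t :=
    (hasDerivWithinAt_id t I).prodMk (hasDerivWithinAt_const t I s)
  exact hf.hasFDerivWithinAt.comp_hasDerivWithinAt t h1 (fun _ hτ => mk_mem_prod hτ hs)

theorem DifferentiableWithinAt.hasDerivWithinAt_snd {f : ℝ × ℝ → E} {t s : ℝ}
    (hf : DifferentiableWithinAt ℝ f (I ×ˢ J) (t, s)) (ht : t ∈ I) :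
    HasDerivWithinAt (fun v => f (t, v)) (fderivWithin ℝ f (I ×ˢ J) (t, s) (0, 1)) J s := by
  have h1 : HasDerivWithinAt (fun v : ℝ => (t, v)) ((0 : ℝ), (1 : ℝ)) J s :=
    (hasDerivWithinAt_const s J t).prodMk (hasDerivWithinAt_id s J)
  exact hf.hasFDerivWithinAt.comp_hasDerivWithinAt s h1 (fun _ hv => mk_mem_prod ht hv)

theorem eventually_derivWithin_fst_eq (hI : UniqueDiffOn ℝ I) {f : ℝ × ℝ → E} {p : ℝ × ℝ}
    (hp : p ∈ I ×ˢ J) (hf : ContDiffWithinAt ℝ 1 f (I ×ˢ J) p) :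
    ∀ᶠ z in 𝓝[I ×ˢ J] p, derivWithin (fun τ => f (τ, z.2)) I z.1
      = fderivWithin ℝ f (I ×ˢ J) z (1, 0) := by
  filter_upwards [insert_eq_of_mem hp ▸ hf.eventually (by simp), self_mem_nhdsWithin] with z hz hzR
  exact ((hz.differentiableWithinAt (by simp)).hasDerivWithinAt_fst hzR.2).derivWithin
    (hI _ hzR.1)

theorem eventually_derivWithin_snd_eq (hJ : UniqueDiffOn ℝ J) {f : ℝ × ℝ → E} {p : ℝ × ℝ}
    (hp : p ∈ I ×ˢ J) (hf : ContDiffWithinAt ℝ 1 f (I ×ˢ J) p) :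
    ∀ᶠ z in 𝓝[I ×ˢ J] p, derivWithin (fun v => f (z.1, v)) J z.2
      = fderivWithin ℝ f (I ×ˢ J) z (0, 1) := by
  filter_upwards [insert_eq_of_mem hp ▸ hf.eventually (by simp), self_mem_nhdsWithin] with z hz hzR
  exact ((hz.differentiableWithinAt (by simp)).hasDerivWithinAt_snd hzR.1).derivWithin
    (hJ _ hzR.2)

/-- Smoothness at a single point is all that is available, because the curves stay in a chart only
locally. The partial derivative agrees near `p` with the full derivative applied to `(1, 0)`, so it
is again smooth at `p` and the statement can be iterated. -/
theorem ContDiffWithinAt.derivWithin_fst (hI : UniqueDiffOn ℝ I) (hJ : UniqueDiffOn ℝ J)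
    {f : ℝ × ℝ → E} {p : ℝ × ℝ} (hp : p ∈ I ×ˢ J) (hf : ContDiffWithinAt ℝ ∞ f (I ×ˢ J) p) :
    ContDiffWithinAt ℝ ∞ (fun z : ℝ × ℝ => derivWithin (fun τ => f (τ, z.2)) I z.1)
      (I ×ˢ J) p := by
  have h := (hf.fderivWithin_right (m := ∞) (hI.prod hJ) (by simp) hp).clm_apply
    (contDiffWithinAt_const (c := ((1 : ℝ), (0 : ℝ))))
  have he := eventually_derivWithin_fst_eq hI hp (hf.of_le (by simp))
  exact h.congr_of_eventuallyEq he (he.self_of_nhdsWithin hp)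

theorem ContDiffWithinAt.derivWithin_snd (hI : UniqueDiffOn ℝ I) (hJ : UniqueDiffOn ℝ J)
    {f : ℝ × ℝ → E} {p : ℝ × ℝ} (hp : p ∈ I ×ˢ J) (hf : ContDiffWithinAt ℝ ∞ f (I ×ˢ J) p) :
    ContDiffWithinAt ℝ ∞ (fun z : ℝ × ℝ => derivWithin (fun v => f (z.1, v)) J z.2)
      (I ×ˢ J) p := by
  have h := (hf.fderivWithin_right (m := ∞) (hI.prod hJ) (by simp) hp).clm_apply
    (contDiffWithinAt_const (c := ((0 : ℝ), (1 : ℝ))))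
  have he := eventually_derivWithin_snd_eq hJ hp (hf.of_le (by simp))
  exact h.congr_of_eventuallyEq he (he.self_of_nhdsWithin hp)

theorem ContDiffWithinAt.iteratedDerivWithin_fst (hI : UniqueDiffOn ℝ I)
    (hJ : UniqueDiffOn ℝ J) {f : ℝ × ℝ → E} {p : ℝ × ℝ} (hp : p ∈ I ×ˢ J)
    (hf : ContDiffWithinAt ℝ ∞ f (I ×ˢ J) p) (k : ℕ) :
    ContDiffWithinAt ℝ ∞
      (fun z : ℝ × ℝ => iteratedDerivWithin k (fun τ => f (τ, z.2)) I z.1) (I ×ˢ J) p := by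
  induction k with
  | zero => simpa using hf
  | succ k ih =>
    simp only [iteratedDerivWithin_succ]
    exact ih.derivWithin_fst hI hJ hp

theorem ContDiffWithinAt.section_fst {f : ℝ × ℝ → E} {t s : ℝ}
    (hf : ContDiffWithinAt ℝ ∞ f (I ×ˢ J) (t, s)) (hs : s ∈ J) :
    ContDiffWithinAt ℝ ∞ (fun τ => f (τ, s)) I t :=
  ContDiffWithinAt.comp (g := f) (f := fun τ => (τ, s)) t hf
    (contDiffWithinAt_id.prodMk contDiffWithinAt_const) (fun _ hτ => ⟨hτ, hs⟩)

theorem ContDiffWithinAt.section_snd {f : ℝ × ℝ → E} {t s : ℝ}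
    (hf : ContDiffWithinAt ℝ ∞ f (I ×ˢ J) (t, s)) (ht : t ∈ I) :
    ContDiffWithinAt ℝ ∞ (fun v => f (t, v)) J s :=
  ContDiffWithinAt.comp (g := f) (f := fun v => (t, v)) s hf
    (contDiffWithinAt_const.prodMk contDiffWithinAt_id) (fun _ hτ => ⟨ht, hτ⟩)

theorem tendsto_mk_left_nhdsWithin {t s : ℝ} (hs : s ∈ J) :
    Tendsto (fun τ => (τ, s)) (𝓝[I] t) (𝓝[I ×ˢ J] (t, s)) := by
  refine tendsto_nhdsWithin_iff.2 ⟨?_, ?_⟩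
  · exact ((by fun_prop : Continuous fun τ : ℝ => (τ, s)).tendsto t).mono_left nhdsWithin_le_nhds
  · filter_upwards [self_mem_nhdsWithin] with τ hτ using ⟨hτ, hs⟩

theorem tendsto_mk_right_nhdsWithin {t s : ℝ} (ht : t ∈ I) :
    Tendsto (fun v => (t, v)) (𝓝[J] s) (𝓝[I ×ˢ J] (t, s)) := by
  refine tendsto_nhdsWithin_iff.2 ⟨?_, ?_⟩
  · exact ((by fun_prop : Continuous fun v : ℝ => (t, v)).tendsto s).mono_left nhdsWithin_le_nhds
  · filter_upwards [self_mem_nhdsWithin] with τ hτ using ⟨ht, hτ⟩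

/-- Schwarz's theorem along a product set. Symmetry of the second derivative within a set is
obtained by approximation from interior points, hence the hypothesis `hR`; it covers boundary points
such as `s = 0` and `t = 0, T`. -/
theorem derivWithin_comm (hI : UniqueDiffOn ℝ I) (hJ : UniqueDiffOn ℝ J)
    (hR : I ×ˢ J ⊆ closure (interior (I ×ˢ J))) {f : ℝ × ℝ → E} {t s : ℝ}
    (ht : t ∈ I) (hs : s ∈ J) (hf : ContDiffWithinAt ℝ 2 f (I ×ˢ J) (t, s)) :
    derivWithin (fun v => derivWithin (fun τ => f (τ, v)) I t) J s
      = derivWithin (fun τ => derivWithin (fun v => f (τ, v)) J s) I t := by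
  have hp : (t, s) ∈ I ×ˢ J := ⟨ht, hs⟩
  have hsymm : IsSymmSndFDerivWithinAt ℝ f (I ×ˢ J) (t, s) :=
    hf.isSymmSndFDerivWithinAt (by simp) (hI.prod hJ) (hR hp) hp
  have hd : DifferentiableWithinAt ℝ (fderivWithin ℝ f (I ×ˢ J)) (I ×ˢ J) (t, s) :=
    (hf.fderivWithin_right (m := 1) (hI.prod hJ) (by norm_num) hp).differentiableWithinAt (by simp)
  have e1 := (tendsto_mk_right_nhdsWithin (J := J) ht).eventually
    (eventually_derivWithin_fst_eq hI hp (hf.of_le (by norm_num)))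
  have e2 := (tendsto_mk_left_nhdsWithin (I := I) hs).eventually
    (eventually_derivWithin_snd_eq hJ hp (hf.of_le (by norm_num)))
  have h1 := (hd.hasDerivWithinAt_snd ht).clm_apply
    (hasDerivWithinAt_const s J ((1 : ℝ), (0 : ℝ)))
  have h2 := (hd.hasDerivWithinAt_fst hs).clm_apply
    (hasDerivWithinAt_const t I ((0 : ℝ), (1 : ℝ)))
  rw [Filter.EventuallyEq.derivWithin_eq e1 (e1.self_of_nhdsWithin hs),
    Filter.EventuallyEq.derivWithin_eq e2 (e2.self_of_nhdsWithin ht),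
    h1.derivWithin (hJ _ hs), h2.derivWithin (hI _ ht)]
  simpa using hsymm.eq (0, 1) (1, 0)

theorem derivWithin_iteratedDerivWithin_comm (hI : UniqueDiffOn ℝ I) (hJ : UniqueDiffOn ℝ J)
    (hR : I ×ˢ J ⊆ closure (interior (I ×ˢ J))) {f : ℝ × ℝ → E} {t s : ℝ}
    (ht : t ∈ I) (hs : s ∈ J) (hf : ContDiffWithinAt ℝ ∞ f (I ×ˢ J) (t, s)) (k : ℕ) :
    derivWithin (fun v => iteratedDerivWithin k (fun τ => f (τ, v)) I t) J s
      = iteratedDerivWithin k (fun τ => derivWithin (fun v => f (τ, v)) J s) I t := by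
  induction k generalizing f with
  | zero => simp
  | succ k ih =>
    have hf1 := hf.derivWithin_fst hI hJ ⟨ht, hs⟩
    have := ih hf1
    simp only [iteratedDerivWithin_succ'] at this ⊢
    rw [this]
    have he := (tendsto_mk_left_nhdsWithin (I := I) hs).eventually
      (hf.eventually_nat 2 ⟨ht, hs⟩)
    have he' : (fun τ => derivWithin (fun v => derivWithin (fun τ' => f (τ', v)) I τ) J s)
        =ᶠ[𝓝[I] t] derivWithin (fun τ => derivWithin (fun v => f (τ, v)) J s) I := by
      filter_upwards [he, self_mem_nhdsWithin] with τ hτ hτI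
      exact derivWithin_comm hI hJ hR hτI hs hτ
    exact he'.iteratedDerivWithin_eq (he'.self_of_nhdsWithin ht)

end ProductDerivatives

/-! ### Jets of compositions and of Taylor polynomials -/

section JetsOfCompositions

theorem iteratedDerivWithin_prodMk {E F : Type*} [NormedAddCommGroup E] [NormedSpace ℝ E]
    [NormedAddCommGroup F] [NormedSpace ℝ F] {s : Set ℝ} (hs : UniqueDiffOn ℝ s)
    {f : ℝ → E} {g : ℝ → F} {t : ℝ} (ht : t ∈ s) (hf : ContDiffWithinAt ℝ ∞ f s t)
    (hg : ContDiffWithinAt ℝ ∞ g s t) (k : ℕ) :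
    iteratedDerivWithin k (fun τ => (f τ, g τ)) s t
      = (iteratedDerivWithin k f s t, iteratedDerivWithin k g s t) := by
  induction k generalizing f g with
  | zero => simp
  | succ k ih =>
    simp only [iteratedDerivWithin_succ']
    rw [← ih (hf.derivWithin_infty hs ht) (hg.derivWithin_infty hs ht)]
    have he : derivWithin (fun τ => (f τ, g τ)) s =ᶠ[𝓝[s] t]
        fun τ => (derivWithin f s τ, derivWithin g s τ) := by
      filter_upwards [hf.eventually_nat 1 ht, hg.eventually_nat 1 ht, self_mem_nhdsWithin]
        with τ h1 h2 hτ
      exact ((h1.differentiableWithinAt (by simp)).hasDerivWithinAt.prodMk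
        (h2.differentiableWithinAt (by simp)).hasDerivWithinAt).derivWithin (hs _ hτ)
    exact he.iteratedDerivWithin_eq (he.self_of_nhdsWithin ht)

/-- The derivatives of a composition `ψ ∘ f` at a point depend only on `ψ` and on the derivatives
of `f`, irrespective of the sets along which the derivatives are taken. -/
theorem iteratedDerivWithin_comp_congr {F : Type*} [NormedAddCommGroup F] [NormedSpace ℝ F]
    {s s' : Set ℝ} (hs : UniqueDiffOn ℝ s) (hs' : UniqueDiffOn ℝ s') {t : ℝ} (ht : t ∈ s)
    (ht' : t ∈ s') (k : ℕ) {E : Type*} [NormedAddCommGroup E] [NormedSpace ℝ E]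
    {ψ : E → F} {f g : ℝ → E} (hf : ContDiffWithinAt ℝ ∞ f s t)
    (hg : ContDiffWithinAt ℝ ∞ g s' t) (hψ : ContDiffAt ℝ ∞ ψ (f t))
    (h : ∀ j ≤ k, iteratedDerivWithin j f s t = iteratedDerivWithin j g s' t) :
    iteratedDerivWithin k (fun τ => ψ (f τ)) s t
      = iteratedDerivWithin k (fun τ => ψ (g τ)) s' t := by
  induction k generalizing E with
  | zero => simpa using congrArg ψ (by simpa using h 0 le_rfl)
  | succ k ih =>
    have h0 : f t = g t := by simpa using h 0 (Nat.zero_le _)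
    -- The chain rule writes the derivative of `ψ ∘ e` as `(z₁, z₂) ↦ Dψ(z₁) z₂` composed with `(e,
    -- e')`. One order is thus traded for a larger space `E × E`, which is why the induction
    -- generalises over `E`.
    have key : ∀ {S : Set ℝ} {e : ℝ → E}, UniqueDiffOn ℝ S → t ∈ S →
        ContDiffWithinAt ℝ ∞ e S t → ContDiffAt ℝ ∞ ψ (e t) →
        iteratedDerivWithin (k + 1) (fun τ => ψ (e τ)) S t
          = iteratedDerivWithin k
            (fun τ => (fun z : E × E => fderiv ℝ ψ z.1 z.2) (e τ, derivWithin e S τ)) S t := by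
      intro S e hS htS he hψe
      rw [iteratedDerivWithin_succ']
      have h2 : ∀ᶠ y in 𝓝 (e t), ContDiffAt ℝ 1 ψ y :=
        (hψe.of_le (m := 1) (by simp)).eventually (by simp)
      have he' : derivWithin (fun τ => ψ (e τ)) S =ᶠ[𝓝[S] t]
          fun τ => fderiv ℝ ψ (e τ) (derivWithin e S τ) := by
        filter_upwards [he.eventually_nat 1 htS, self_mem_nhdsWithin,
          he.continuousWithinAt.eventually h2] with τ h1 hτ h3
        exact ((h3.differentiableAt (by simp)).hasFDerivAt.comp_hasDerivWithinAt τ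
          (h1.differentiableWithinAt (by simp)).hasDerivWithinAt).derivWithin (hS _ hτ)
      exact he'.iteratedDerivWithin_eq (he'.self_of_nhdsWithin htS)
    rw [key hs ht hf hψ, key hs' ht' hg (h0 ▸ hψ)]
    refine ih (ψ := fun z : E × E => fderiv ℝ ψ z.1 z.2) (hf.prodMk (hf.derivWithin_infty hs ht)) (hg.prodMk (hg.derivWithin_infty hs' ht'))
      ?_ ?_
    · have := (hψ.fderiv_right (m := ∞) (by simp))
      exact (this.comp (f t, derivWithin f s t) contDiffAt_fst).clm_apply contDiffAt_snd
    · intro j hj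
      rw [iteratedDerivWithin_prodMk hs ht hf (hf.derivWithin_infty hs ht),
        iteratedDerivWithin_prodMk hs' ht' hg (hg.derivWithin_infty hs' ht'),
        ← iteratedDerivWithin_succ', ← iteratedDerivWithin_succ', h j (by omega),
        h (j + 1) (by omega)]

theorem iteratedDeriv_taylor_sum {E : Type*} [NormedAddCommGroup E] [NormedSpace ℝ E] {n : ℕ}
    (t : ℝ) (x : Fin (n + 1) → E) (k : Fin (n + 1)) :
    iteratedDeriv k (fun τ => ∑ β : Fin (n + 1),
      ((τ - t) ^ (β : ℕ) / (Nat.factorial β : ℝ)) • x β) t = x k := by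
  rw [iteratedDeriv_fun_sum (fun i _ => by fun_prop)]
  have h1 : ∀ β : Fin (n + 1), iteratedDeriv k
      (fun τ => ((τ - t) ^ (β : ℕ) / (Nat.factorial β : ℝ)) • x β) t
        = if β = k then x β else 0 := by
    intro β
    rw [iteratedDeriv_smul_const (by fun_prop), iteratedDeriv_div_const,
      iteratedDeriv_comp_sub_const k (fun y : ℝ => y ^ (β : ℕ))]
    simp only [sub_self, iteratedDeriv_fun_pow_zero, Fin.ext_iff, eq_comm (a := (k : ℕ))]
    split_ifs with h
    · rw [h, div_self (by positivity), one_smul]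
    · simp
  simp [h1]

end JetsOfCompositions

/-! ### Jets in the charts of the maximal atlas -/

section Charts

variable {N : ℕ} {Q : Type*} [TopologicalSpace Q] [ChartedSpace (Euc N) Q]

theorem ContMDiffWithinAt.contDiffWithinAt_chart [IsManifold (𝓡 N) ∞ Q]
    {X : Type*} [NormedAddCommGroup X] [NormedSpace ℝ X]
    {φ : OpenPartialHomeomorph Q (Euc N)} (hφ : φ ∈ IsManifold.maximalAtlas (𝓡 N) ∞ Q)
    {f : X → Q} {S : Set X} {x : X} (hf : ContMDiffWithinAt 𝓘(ℝ, X) (𝓡 N) ∞ f S x)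
    (hx : f x ∈ φ.source) : ContDiffWithinAt ℝ ∞ (fun y => φ (f y)) S x := by
  rw [← contMDiffWithinAt_iff_contDiffWithinAt]
  exact (contMDiffAt_of_mem_maximalAtlas hφ hx).comp_contMDiffWithinAt x hf

theorem contDiffAt_chart_comp_symm [IsManifold (𝓡 N) ∞ Q]
    {φ ψ : OpenPartialHomeomorph Q (Euc N)} (hφ : φ ∈ IsManifold.maximalAtlas (𝓡 N) ∞ Q)
    (hψ : ψ ∈ IsManifold.maximalAtlas (𝓡 N) ∞ Q) {y : Q} (hy : y ∈ φ.source)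
    (hy' : y ∈ ψ.source) : ContDiffAt ℝ ∞ (fun x => ψ (φ.symm x)) (φ y) := by
  rw [← contMDiffAt_iff_contDiffAt]
  refine ContMDiffAt.comp (g := ψ) (f := φ.symm) (φ y) ?_
    (contMDiffAt_symm_of_mem_maximalAtlas hφ (φ.map_source hy))
  rw [φ.left_inv hy]
  exact contMDiffAt_of_mem_maximalAtlas hψ hy'

/-- A jet is recovered from its canonical coordinates in any chart. -/
theorem jetOfCoords_jetCoords [IsManifold (𝓡 N) ∞ Q] {n : ℕ} {I : Set ℝ}
    (hI : UniqueDiffOn ℝ I) {φ : OpenPartialHomeomorph Q (Euc N)}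
    (hφ : φ ∈ IsManifold.maximalAtlas (𝓡 N) ∞ Q) {q : ℝ → Q} {t : ℝ} (ht : t ∈ I)
    (hq : ContMDiffWithinAt 𝓘(ℝ, ℝ) (𝓡 N) ∞ q I t) (hqt : q t ∈ φ.source) :
    jetOfCoords φ t (jetCoords n I φ q t) = curveJet n I q t := by
  set x := jetCoords n I φ q t with hx
  have hx0 : (∑ β : Fin (n + 1), ((t - t) ^ (β : ℕ) / (Nat.factorial β : ℝ)) • x β)
      = φ (q t) := by
    have := iteratedDeriv_taylor_sum t x 0
    simp only [Fin.val_zero, iteratedDeriv_zero] at this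
    rw [this, hx]
    simp [jetCoords]
  have hpt : φ.symm (∑ β : Fin (n + 1), ((t - t) ^ (β : ℕ) / (Nat.factorial β : ℝ)) • x β)
      = q t := by
    rw [hx0, φ.left_inv hqt]
  simp only [jetOfCoords, curveJet, hpt, CurveJet.mk.injEq, true_and]
  funext β
  set c := chartAt (Euc N) (q t)
  have hc : c ∈ IsManifold.maximalAtlas (𝓡 N) ∞ Q := IsManifold.chart_mem_maximalAtlas _
  have hqc := hq.contDiffWithinAt_chart hφ hqt
  have he : (fun τ => c (q τ)) =ᶠ[𝓝[I] t] fun τ => (fun z => c (φ.symm z)) (φ (q τ)) := by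
    filter_upwards [hq.continuousWithinAt.eventually (φ.open_source.mem_nhds hqt)] with τ hτ
    rw [φ.left_inv hτ]
  rw [he.iteratedDerivWithin_eq (he.self_of_nhdsWithin ht)]
  -- The Taylor polynomial is differentiated along all of `ℝ` and the curve along `I`. Both have the
  -- same derivatives up to order `n` in `φ`, hence after the change of chart.
  refine iteratedDerivWithin_comp_congr (ψ := fun z => c (φ.symm z)) uniqueDiffOn_univ hI
    (mem_univ t) ht _ (ContDiff.contDiffWithinAt (by fun_prop)) hqc ?_ ?_
  · rw [hx0]
    exact contDiffAt_chart_comp_symm hφ hc hqt (mem_chart_source _ _)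
  · intro j hj
    rw [iteratedDerivWithin_univ]
    exact iteratedDeriv_taylor_sum t x ⟨j, by omega⟩

end Charts

/-! ### Momenta and higher order integration by parts -/

section IntegrationByParts

variable {V : Type*} [NormedAddCommGroup V] [InnerProductSpace ℝ V] {n : ℕ} {I : Set ℝ}

/-- The momentum of order `β` associated with the force components `g`. -/
def tailMomentum (I : Set ℝ) (g : Fin (n + 1) → ℝ → V) (β : ℕ) (t : ℝ) : V :=
  ∑ δ ∈ Finset.univ.filter (fun δ : Fin (n + 1) => β < (δ : ℕ)),
    (-1 : ℝ) ^ ((δ : ℕ) - β - 1) • iteratedDerivWithin ((δ : ℕ) - β - 1) (g δ) I t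

theorem tailMomentum_of_le (g : Fin (n + 1) → ℝ → V) {β : ℕ} (hβ : n ≤ β) :
    tailMomentum I g β = 0 := by
  funext t
  refine Finset.sum_eq_zero fun δ hδ => ?_
  have := (Finset.mem_filter.1 hδ).2
  have := δ.2
  omega

theorem ContDiffWithinAt.tailMomentum (hI : UniqueDiffOn ℝ I) {g : Fin (n + 1) → ℝ → V} {t : ℝ}
    (ht : t ∈ I) (hg : ∀ δ, ContDiffWithinAt ℝ ∞ (g δ) I t) (β : ℕ) :
    ContDiffWithinAt ℝ ∞ (tailMomentum I g β) I t :=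
  ContDiffWithinAt.sum fun δ _ => ((hg δ).iteratedDerivWithin_infty hI ht _).const_smul _

/-- The downward recursion `p_β = g_(β+1) - dp_(β+1)/dt`: the term `δ = β + 1` is split off, and
every other term is minus the derivative of its counterpart in `p_(β+1)`. Together with `p_n = 0` it
is the only property of momenta used in the integrations by parts. -/
theorem tailMomentum_eq_sub (hI : UniqueDiffOn ℝ I) {g : Fin (n + 1) → ℝ → V} {t : ℝ}
    (ht : t ∈ I) (hg : ∀ δ, ContDiffWithinAt ℝ ∞ (g δ) I t) {β : ℕ} (hβ : β < n) :
    tailMomentum I g β t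
      = g ⟨β + 1, by omega⟩ t - derivWithin (tailMomentum I g (β + 1)) I t := by
  have hfil : Finset.univ.filter (fun δ : Fin (n + 1) => β < (δ : ℕ))
      = insert ⟨β + 1, by omega⟩ (Finset.univ.filter (fun δ : Fin (n + 1) => β + 1 < (δ : ℕ))) := by
    ext δ
    simp only [Finset.mem_filter, Finset.mem_univ, true_and, Finset.mem_insert, Fin.ext_iff]
    omega
  have hd : derivWithin (tailMomentum I g (β + 1)) I t
      = ∑ δ ∈ Finset.univ.filter (fun δ : Fin (n + 1) => β + 1 < (δ : ℕ)),
        (-1 : ℝ) ^ ((δ : ℕ) - (β + 1) - 1) •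
          iteratedDerivWithin ((δ : ℕ) - β - 1) (g δ) I t := by
    refine HasDerivWithinAt.derivWithin ?_ (hI t ht)
    refine HasDerivWithinAt.fun_sum fun δ hδ => HasDerivWithinAt.const_smul _ ?_
    have h1 : (δ : ℕ) - β - 1 = (δ : ℕ) - (β + 1) - 1 + 1 := by
      have := (Finset.mem_filter.1 hδ).2
      omega
    rw [h1, iteratedDerivWithin_succ]
    exact (((hg δ).iteratedDerivWithin_infty hI ht _).differentiableWithinAt
      (by simp)).hasDerivWithinAt
  rw [hd, tailMomentum, hfil, Finset.sum_insert (by simp), sub_eq_add_neg, ← Finset.sum_neg_distrib]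
  congr 1
  · simp
  · refine Finset.sum_congr rfl fun δ hδ => ?_
    have h1 : (δ : ℕ) - β - 1 = (δ : ℕ) - (β + 1) - 1 + 1 := by
      have := (Finset.mem_filter.1 hδ).2
      omega
    rw [← neg_smul]
    congr 1
    rw [h1, pow_succ]
    ring

/-- The same recursion one step below `β = 0`: the Euler–Lagrange expression plays the role of a
momentum of order `-1`. -/
theorem sum_alternating_eq_sub (hI : UniqueDiffOn ℝ I) {g : Fin (n + 1) → ℝ → V} {t : ℝ}
    (ht : t ∈ I) (hg : ∀ δ, ContDiffWithinAt ℝ ∞ (g δ) I t) :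
    ∑ δ : Fin (n + 1), (-1 : ℝ) ^ (δ : ℕ) • iteratedDerivWithin δ (g δ) I t
      = g 0 t - derivWithin (tailMomentum I g 0) I t := by
  have hd : derivWithin (tailMomentum I g 0) I t
      = ∑ δ ∈ Finset.univ.filter (fun δ : Fin (n + 1) => 0 < (δ : ℕ)),
        (-1 : ℝ) ^ ((δ : ℕ) - 0 - 1) • iteratedDerivWithin δ (g δ) I t := by
    refine HasDerivWithinAt.derivWithin ?_ (hI t ht)
    refine HasDerivWithinAt.fun_sum fun δ hδ => HasDerivWithinAt.const_smul _ ?_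
    have h1 : (δ : ℕ) = (δ : ℕ) - 0 - 1 + 1 := by
      have := (Finset.mem_filter.1 hδ).2
      omega
    conv => enter [2]; rw [h1, iteratedDerivWithin_succ]
    exact (((hg δ).iteratedDerivWithin_infty hI ht _).differentiableWithinAt
      (by simp)).hasDerivWithinAt
  rw [hd, Finset.sum_filter, Fin.sum_univ_succ, Fin.sum_univ_succ, sub_eq_add_neg, neg_add,
    ← Finset.sum_neg_distrib]
  simp [pow_succ]

/-- Integration by parts for the higher order Euler-Lagrange operator, in differential form. -/
theorem hasDerivWithinAt_sum_tailMomentum (hI : UniqueDiffOn ℝ I) {g : Fin (n + 1) → ℝ → V}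
    {W : ℝ → V} {t : ℝ} (ht : t ∈ I) (hg : ∀ δ, ContDiffWithinAt ℝ ∞ (g δ) I t)
    (hW : ContDiffWithinAt ℝ ∞ W I t) :
    HasDerivWithinAt
      (fun τ => ∑ β ∈ Finset.range n, ⟪tailMomentum I g β τ, iteratedDerivWithin β W I τ⟫)
      (∑ δ : Fin (n + 1), ⟪g δ t, iteratedDerivWithin δ W I t⟫
        - ⟪∑ δ : Fin (n + 1), (-1 : ℝ) ^ (δ : ℕ) • iteratedDerivWithin δ (g δ) I t, W t⟫) I t := by
  have h1 : HasDerivWithinAt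
      (fun τ => ∑ β ∈ Finset.range n, ⟪tailMomentum I g β τ, iteratedDerivWithin β W I τ⟫)
      (∑ β ∈ Finset.range n, (⟪tailMomentum I g β t, iteratedDerivWithin (β + 1) W I t⟫
        + ⟪derivWithin (tailMomentum I g β) I t, iteratedDerivWithin β W I t⟫)) I t := by
    refine HasDerivWithinAt.fun_sum fun β _ => HasDerivWithinAt.inner ℝ ?_ ?_
    · exact ((ContDiffWithinAt.tailMomentum hI ht hg β).differentiableWithinAt
        (by simp)).hasDerivWithinAt
    · rw [iteratedDerivWithin_succ]
      exact ((hW.iteratedDerivWithin_infty hI ht β).differentiableWithinAt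
        (by simp)).hasDerivWithinAt
  convert h1 using 1
  rw [sum_alternating_eq_sub hI ht hg, Fin.sum_univ_succ]
  -- By the recursion each summand is a force term minus `P (β + 1) - P β`. The sum telescopes, with
  -- `P n = 0` at the top; `P 0` is absorbed by the Euler–Lagrange expression.
  set P := fun β => ⟪derivWithin (tailMomentum I g β) I t, iteratedDerivWithin β W I t⟫ with hP
  have hPn : P n = 0 := by
    have : derivWithin (0 : ℝ → V) I t = 0 := by
      simp
    simp [hP, tailMomentum_of_le g le_rfl, this]
  have h2 : ∀ β ∈ Finset.range n,
      ⟪tailMomentum I g β t, iteratedDerivWithin (β + 1) W I t⟫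
        + ⟪derivWithin (tailMomentum I g β) I t, iteratedDerivWithin β W I t⟫
      = (if h : β < n then ⟪g ⟨β + 1, by omega⟩ t, iteratedDerivWithin (β + 1) W I t⟫ else 0)
        - (P (β + 1) - P β) := by
    intro β hβ
    have hβ' := Finset.mem_range.1 hβ
    rw [tailMomentum_eq_sub hI ht hg hβ', dif_pos hβ', inner_sub_left]
    simp only [hP]
    ring
  rw [Finset.sum_congr rfl h2, Finset.sum_sub_distrib, Finset.sum_range_sub, hPn,
    Finset.sum_range (n := n)]
  simp only [hP, Fin.is_lt, dite_true, Fin.val_zero, iteratedDerivWithin_zero, inner_sub_left]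
  simp only [Fin.succ]
  ring

end IntegrationByParts

/-! ### Smooth controlled functions of the jet coordinates -/

section JetFunctions

variable {n N M : ℕ} {Q : Type*} [TopologicalSpace Q]

/-- The coordinate domain of the controlled functions on jets with base point in the chart `φ`. -/
def jetDomain (n : ℕ) (φ : OpenPartialHomeomorph Q (Euc N)) (K : Set (Euc M)) :
    Set ((ℝ × (Fin (n + 1) → Euc N)) × Euc M) :=
  {p | p.1.2 0 ∈ φ.target ∧ p.2 ∈ K}

/-- Smoothness of a controlled function of the jet coordinates of the chart `φ`. -/
def SmoothJetFun (φ : OpenPartialHomeomorph Q (Euc N)) (K : Set (Euc M))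
    (f : ℝ → (Fin (n + 1) → Euc N) → Euc M → ℝ) : Prop :=
  ContDiffOn ℝ ∞ (fun p : (ℝ × (Fin (n + 1) → Euc N)) × Euc M => f p.1.1 p.1.2 p.2)
    (jetDomain n φ K)

theorem isOpen_coordDomain (n : ℕ) (φ : OpenPartialHomeomorph Q (Euc N)) :
    IsOpen {p : ℝ × (Fin (n + 1) → Euc N) | p.2 0 ∈ φ.target} :=
  φ.open_target.preimage (by fun_prop)

theorem uniqueDiffOn_jetDomain (n : ℕ) (φ : OpenPartialHomeomorph Q (Euc N))
    {K : Set (Euc M)} (hK : UniqueDiffOn ℝ K) : UniqueDiffOn ℝ (jetDomain n φ K) :=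
  (isOpen_coordDomain n φ).uniqueDiffOn.prod hK

/-- The inclusion of the variations of the jet coordinates into all variations. -/
def jetInclusion (n N M : ℕ) :
    (Fin (n + 1) → Euc N) →L[ℝ] (ℝ × (Fin (n + 1) → Euc N)) × Euc M :=
  (ContinuousLinearMap.inl ℝ _ _).comp (ContinuousLinearMap.inr ℝ _ _)

@[simp]
theorem jetInclusion_apply (v : Fin (n + 1) → Euc N) :
    jetInclusion n N M v = ((0, v), 0) := rfl

variable {φ : OpenPartialHomeomorph Q (Euc N)} {K : Set (Euc M)}
  {f : ℝ → (Fin (n + 1) → Euc N) → Euc M → ℝ}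

/-- Derivatives in the control exist only within `K`, but the domain is open in the jet directions.
There the derivative within the domain restricts to an ordinary one. -/
theorem SmoothJetFun.hasFDerivAt_coords (hf : SmoothJetFun φ K f) {t : ℝ}
    {x : Fin (n + 1) → Euc N} {w : Euc M} (hp : ((t, x), w) ∈ jetDomain n φ K) :
    HasFDerivAt (fun y => f t y w)
      ((fderivWithin ℝ (fun p : (ℝ × (Fin (n + 1) → Euc N)) × Euc M => f p.1.1 p.1.2 p.2)
        (jetDomain n φ K) ((t, x), w)).comp (jetInclusion n N M)) x := by
  have h1 := ((hf _ hp).differentiableWithinAt (by simp)).hasFDerivWithinAt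
  have h2 : HasFDerivAt (fun y : Fin (n + 1) → Euc N => ((t, y), w)) (jetInclusion n N M) x :=
    (((hasFDerivAt_const t x).prodMk (hasFDerivAt_id x)).prodMk
      (hasFDerivAt_const w x)).congr_fderiv rfl
  refine h1.comp_hasFDerivAt x h2 ?_
  have h3 : ContinuousAt (fun y : Fin (n + 1) → Euc N => y 0) x := (continuous_apply 0).continuousAt
  filter_upwards [h3.eventually (φ.open_target.mem_nhds hp.1)] with y hy using ⟨hy, hp.2⟩

theorem inner_partialGrad {g : (Fin (n + 1) → Euc N) → ℝ} {x : Fin (n + 1) → Euc N}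
    (hg : DifferentiableAt ℝ g x) (δ : Fin (n + 1)) (v : Euc N) :
    ⟪partialGrad g δ x, v⟫ = fderiv ℝ g x (Pi.single δ v) := by
  have h1 : HasFDerivAt (fun y => g (Function.update x δ y))
      ((fderiv ℝ g x).comp (ContinuousLinearMap.single ℝ (fun _ : Fin (n + 1) => Euc N) δ))
      (x δ) := by
    have h2 := hasFDerivAt_update (𝕜 := ℝ) x (i := δ) (x δ)
    have h3 : HasFDerivAt g (fderiv ℝ g x) (Function.update x δ (x δ)) := by
      rw [Function.update_eq_self]; exact hg.hasFDerivAt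
    have h4 : ContinuousLinearMap.pi (Pi.single δ (ContinuousLinearMap.id ℝ (Euc N)))
        = ContinuousLinearMap.single ℝ (fun _ : Fin (n + 1) => Euc N) δ := by
      refine ContinuousLinearMap.ext fun v => funext fun j => ?_
      by_cases h : j = δ
      · subst h; simp
      · simp [h]
    rw [← h4]
    exact h3.comp (x δ) h2
  rw [partialGrad, gradient, InnerProductSpace.toDual_symm_apply, h1.fderiv]
  simp

theorem fderiv_eq_sum_inner_partialGrad {g : (Fin (n + 1) → Euc N) → ℝ}
    {x : Fin (n + 1) → Euc N} (hg : DifferentiableAt ℝ g x) (v : Fin (n + 1) → Euc N) :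
    fderiv ℝ g x v = ∑ δ, ⟪partialGrad g δ x, v δ⟫ := by
  simp_rw [inner_partialGrad hg, ← map_sum, Finset.univ_sum_single]

/-- The partial gradient is the Riesz representative of a restriction of the full derivative within
the domain, and that derivative is smooth. -/
theorem SmoothJetFun.partialGrad (hK : UniqueDiffOn ℝ K) (hf : SmoothJetFun φ K f)
    (δ : Fin (n + 1)) :
    ContDiffOn ℝ ∞ (fun p : (ℝ × (Fin (n + 1) → Euc N)) × Euc M =>
      partialGrad (fun x => f p.1.1 x p.2) δ p.1.2) (jetDomain n φ K) := by
  set F := fun p : (ℝ × (Fin (n + 1) → Euc N)) × Euc M => f p.1.1 p.1.2 p.2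
  have h1 : ContDiffOn ℝ ∞ (fderivWithin ℝ F (jetDomain n φ K)) (jetDomain n φ K) :=
    hf.fderivWithin (uniqueDiffOn_jetDomain n φ hK) (by simp)
  have h2 : ContDiffOn ℝ ∞ (fun p => (InnerProductSpace.toDual ℝ (Euc N)).symm
      (((fderivWithin ℝ F (jetDomain n φ K) p).comp (jetInclusion n N M)).comp
        (ContinuousLinearMap.single ℝ (fun _ : Fin (n + 1) => Euc N) δ))) (jetDomain n φ K) :=
    (InnerProductSpace.toDual ℝ (Euc N)).symm.contDiff.comp_contDiffOn
      ((h1.clm_comp contDiffOn_const).clm_comp contDiffOn_const)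
  refine h2.congr fun p hp => ?_
  refine ext_inner_right ℝ fun v => ?_
  have h3 := hf.hasFDerivAt_coords (t := p.1.1) (x := p.1.2) (w := p.2) hp
  rw [inner_partialGrad h3.differentiableAt, h3.fderiv, InnerProductSpace.toDual_symm_apply]
  rfl

theorem SmoothJetFun.add {g : ℝ → (Fin (n + 1) → Euc N) → Euc M → ℝ} (hf : SmoothJetFun φ K f)
    (hg : SmoothJetFun φ K g) : SmoothJetFun φ K (fun t x w => f t x w + g t x w) :=
  ContDiffOn.add hf hg

theorem partialGrad_add {g h : (Fin (n + 1) → Euc N) → ℝ} {x : Fin (n + 1) → Euc N}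
    (hg : DifferentiableAt ℝ g x) (hh : DifferentiableAt ℝ h x) (δ : Fin (n + 1)) :
    partialGrad (fun y => g y + h y) δ x = partialGrad g δ x + partialGrad h δ x := by
  refine ext_inner_right ℝ fun v => ?_
  rw [inner_add_left, inner_partialGrad (hg.fun_add hh), inner_partialGrad hg,
    inner_partialGrad hh, fderiv_fun_add hg hh]
  simp

/-- The partial gradient with respect to a variable on which a function does not depend. -/
theorem partialGrad_eq_zero {g : (Fin (n + 1) → Euc N) → ℝ} {x : Fin (n + 1) → Euc N}
    {δ : Fin (n + 1)} (h : ∀ᶠ y in 𝓝 (x δ), g (Function.update x δ y) = g x) :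
    partialGrad g δ x = 0 := by
  have h1 : (fun y => g (Function.update x δ y)) =ᶠ[𝓝 (x δ)] fun _ => g x := h
  rw [partialGrad, gradient, h1.fderiv_eq]
  simp

theorem momentum_eq_tailMomentum (I : Set ℝ) (φ : OpenPartialHomeomorph Q (Euc N))
    (f : ℝ → (Fin (n + 1) → Euc N) → Euc M → ℝ) (v : ℝ → Euc M)
    (c : ℝ → Q) (β : ℕ) : momentum I φ f v c β = tailMomentum I (gradAlong I φ f v c) β := rfl

end JetFunctions

/-! ### Smooth families of controlled curves -/

section Families

variable {n N M : ℕ} {Q : Type*} [TopologicalSpace Q] [ChartedSpace (Euc N) Q]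

/-- A family of controlled curves, depending smoothly on a parameter. -/
structure SmoothFamily (N : ℕ) {M : ℕ} {Q : Type*} [TopologicalSpace Q]
    [ChartedSpace (Euc N) Q] (I J : Set ℝ) (K : Set (Euc M)) (u : ℝ → ℝ → Euc M) (q : ℝ → ℝ → Q) :
    Prop where
  uniqueDiffOn_time : UniqueDiffOn ℝ I
  uniqueDiffOn_param : UniqueDiffOn ℝ J
  subset_closure : I ×ˢ J ⊆ closure (interior (I ×ˢ J))
  smooth_u : ContDiffOn ℝ ∞ (fun p : ℝ × ℝ => u p.1 p.2) (I ×ˢ J)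
  mem_K : ∀ t ∈ I, ∀ s ∈ J, u t s ∈ K
  smooth_q : ContMDiffOn 𝓘(ℝ, ℝ × ℝ) (𝓡 N) ∞ (fun p : ℝ × ℝ => q p.1 p.2) (I ×ˢ J)

variable {I J : Set ℝ} {K : Set (Euc M)} {u : ℝ → ℝ → Euc M}
  {q : ℝ → ℝ → Q} {φ : OpenPartialHomeomorph Q (Euc N)}
  {f : ℝ → (Fin (n + 1) → Euc N) → Euc M → ℝ} {p : ℝ × ℝ}

namespace SmoothFamily

theorem eventually_mem_source (hF : SmoothFamily N I J K u q) (hp : p ∈ I ×ˢ J)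
    (hq : q p.1 p.2 ∈ φ.source) : ∀ᶠ z in 𝓝[I ×ˢ J] p, q z.1 z.2 ∈ φ.source :=
  (hF.smooth_q p hp).continuousWithinAt.eventually (φ.open_source.mem_nhds hq)

theorem mem_jetDomain (hF : SmoothFamily N I J K u q) (hp : p ∈ I ×ˢ J)
    (hq : q p.1 p.2 ∈ φ.source) :
    ((p.1, _root_.jetCoords n I φ (fun τ => q τ p.2) p.1), u p.1 p.2) ∈ jetDomain n φ K := by
  refine ⟨?_, hF.mem_K _ hp.1 _ hp.2⟩
  simpa [_root_.jetCoords] using φ.map_source hq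

variable [IsManifold (𝓡 N) ∞ Q]

theorem coords (hF : SmoothFamily N I J K u q) (hφ : φ ∈ IsManifold.maximalAtlas (𝓡 N) ∞ Q)
    (hp : p ∈ I ×ˢ J) (hq : q p.1 p.2 ∈ φ.source) :
    ContDiffWithinAt ℝ ∞ (fun z : ℝ × ℝ => φ (q z.1 z.2)) (I ×ˢ J) p :=
  (hF.smooth_q p hp).contDiffWithinAt_chart hφ hq

theorem jetCoords (hF : SmoothFamily N I J K u q) (hφ : φ ∈ IsManifold.maximalAtlas (𝓡 N) ∞ Q)
    (hp : p ∈ I ×ˢ J) (hq : q p.1 p.2 ∈ φ.source) :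
    ContDiffWithinAt ℝ ∞ (fun z : ℝ × ℝ => jetCoords n I φ (fun τ => q τ z.2) z.1)
      (I ×ˢ J) p :=
  contDiffWithinAt_pi.2 fun β => ContDiffWithinAt.iteratedDerivWithin_fst hF.uniqueDiffOn_time
    hF.uniqueDiffOn_param hp (hF.coords hφ hp hq) (β : ℕ)

theorem comp_jetCoords {E : Type*} [NormedAddCommGroup E] [NormedSpace ℝ E]
    (hF : SmoothFamily N I J K u q) (hφ : φ ∈ IsManifold.maximalAtlas (𝓡 N) ∞ Q)
    (hp : p ∈ I ×ˢ J) (hq : q p.1 p.2 ∈ φ.source)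
    {H : (ℝ × (Fin (n + 1) → Euc N)) × Euc M → E} (hH : ContDiffOn ℝ ∞ H (jetDomain n φ K)) :
    ContDiffWithinAt ℝ ∞ (fun z : ℝ × ℝ =>
      H ((z.1, _root_.jetCoords n I φ (fun τ => q τ z.2) z.1), u z.1 z.2)) (I ×ˢ J) p := by
  refine ContDiffWithinAt.comp_of_preimage_mem_nhdsWithin (g := H) p
    (hH _ (hF.mem_jetDomain hp hq))
    ((contDiffWithinAt_fst.prodMk (hF.jetCoords hφ hp hq)).prodMk (hF.smooth_u p hp)) ?_
  filter_upwards [hF.eventually_mem_source hp hq, self_mem_nhdsWithin] with z hz hzR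
  exact hF.mem_jetDomain hzR hz

theorem gradAlong (hF : SmoothFamily N I J K u q) (hK : UniqueDiffOn ℝ K)
    (hφ : φ ∈ IsManifold.maximalAtlas (𝓡 N) ∞ Q) (hf : SmoothJetFun φ K f) (hp : p ∈ I ×ˢ J)
    (hq : q p.1 p.2 ∈ φ.source) (δ : Fin (n + 1)) :
    ContDiffWithinAt ℝ ∞ (fun z : ℝ × ℝ =>
      gradAlong I φ f (fun τ => u τ z.2) (fun τ => q τ z.2) δ z.1) (I ×ˢ J) p :=
  hF.comp_jetCoords hφ hp hq (hf.partialGrad hK δ)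

theorem momentum (hF : SmoothFamily N I J K u q) (hK : UniqueDiffOn ℝ K)
    (hφ : φ ∈ IsManifold.maximalAtlas (𝓡 N) ∞ Q) (hf : SmoothJetFun φ K f) (hp : p ∈ I ×ˢ J)
    (hq : q p.1 p.2 ∈ φ.source) (β : ℕ) :
    ContDiffWithinAt ℝ ∞ (fun z : ℝ × ℝ =>
      momentum I φ f (fun τ => u τ z.2) (fun τ => q τ z.2) β z.1) (I ×ˢ J) p :=
  ContDiffWithinAt.sum fun δ _ => (ContDiffWithinAt.iteratedDerivWithin_fst hF.uniqueDiffOn_time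
    hF.uniqueDiffOn_param hp (hF.gradAlong hK hφ hf hp hq δ) _).const_smul _

end SmoothFamily

end Families

/-! ### The total derivative of the cost function -/

section TotalDerivative

variable {n N M : ℕ} {Q : Type*} [TopologicalSpace Q]
  {φ : OpenPartialHomeomorph Q (Euc N)} {c : ℝ → (Fin (n + 1) → Euc N) → ℝ}

/-- `shiftJet` as a continuous linear map. -/
def shiftJetL (n N : ℕ) : (Fin (n + 1) → Euc N) →L[ℝ] (Fin (n + 1) → Euc N) :=
  ContinuousLinearMap.pi fun β : Fin (n + 1) =>
    if h : (β : ℕ) + 1 < n + 1 then ContinuousLinearMap.proj ⟨β + 1, h⟩ else 0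

theorem shiftJetL_apply (x : Fin (n + 1) → Euc N) : shiftJetL n N x = shiftJet x := by
  funext β
  by_cases h : (β : ℕ) + 1 < n + 1 <;>
    simp only [shiftJetL, shiftJet, h, ContinuousLinearMap.coe_pi', dite_true, dite_false] <;> rfl

theorem smoothJetFun_of_cost
    (hc : ContDiffOn ℝ ∞ (fun p : ℝ × (Fin (n + 1) → Euc N) => c p.1 p.2) {p | p.2 0 ∈ φ.target})
    (K : Set (Euc M)) : SmoothJetFun φ K (fun t x _ => c t x) :=
  ContDiffOn.comp (g := fun p : ℝ × (Fin (n + 1) → Euc N) => c p.1 p.2) (f := Prod.fst) hc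
    contDiff_fst.contDiffOn (fun _ hp => hp.1)

theorem contDiffOn_totalDeriv
    (hc : ContDiffOn ℝ ∞ (fun p : ℝ × (Fin (n + 1) → Euc N) => c p.1 p.2)
      {p | p.2 0 ∈ φ.target}) :
    ContDiffOn ℝ ∞ (fun p : ℝ × (Fin (n + 1) → Euc N) => totalDeriv c p.1 p.2)
      {p | p.2 0 ∈ φ.target} := by
  have h1 := hc.fderiv_of_isOpen (m := ∞) (isOpen_coordDomain n φ) (by simp)
  have h2 : ContDiff ℝ ∞ (fun p : ℝ × (Fin (n + 1) → Euc N) => ((1 : ℝ), shiftJet p.2)) := by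
    simp only [← shiftJetL_apply]
    fun_prop
  exact h1.clm_apply h2.contDiffOn

theorem fderiv_cost_eq
    (hc : ContDiffOn ℝ ∞ (fun p : ℝ × (Fin (n + 1) → Euc N) => c p.1 p.2) {p | p.2 0 ∈ φ.target})
    {t : ℝ} {x : Fin (n + 1) → Euc N} (hx : x 0 ∈ φ.target) (v : Fin (n + 1) → Euc N) :
    fderiv ℝ (c t) x v
      = fderiv ℝ (fun p : ℝ × (Fin (n + 1) → Euc N) => c p.1 p.2) (t, x) (0, v) := by
  have h1 : HasFDerivAt (fun p : ℝ × (Fin (n + 1) → Euc N) => c p.1 p.2)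
      (fderiv ℝ (fun p : ℝ × (Fin (n + 1) → Euc N) => c p.1 p.2) (t, x)) (t, x) :=
    ((hc.contDiffAt ((isOpen_coordDomain n φ).mem_nhds hx)).differentiableAt
      (by simp)).hasFDerivAt
  have h2 := h1.comp x (hasFDerivAt_prodMk_right (𝕜 := ℝ) t x)
  have h3 := h2.fderiv
  simp only [Function.comp_def] at h3
  rw [show c t = fun y => c t y from rfl, h3]
  simp

theorem differentiableAt_cost
    (hc : ContDiffOn ℝ ∞ (fun p : ℝ × (Fin (n + 1) → Euc N) => c p.1 p.2) {p | p.2 0 ∈ φ.target})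
    {t : ℝ} {x : Fin (n + 1) → Euc N} (hx : x 0 ∈ φ.target) : DifferentiableAt ℝ (c t) x :=
  ((hc.contDiffAt (x := (t, x)) ((isOpen_coordDomain n φ).mem_nhds hx)).differentiableAt
    (by simp)).comp x (hasFDerivAt_prodMk_right (𝕜 := ℝ) t x).differentiableAt

/-- Through this shift of directions, `∂/∂q_(δ+1)` of the total derivative acquires the extra term
`∂C/∂q_(δ)`. -/
theorem shiftJet_single_succ (δ : Fin n) (v : Euc N) :
    shiftJet (Pi.single δ.succ v : Fin (n + 1) → Euc N) = Pi.single δ.castSucc v := by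
  funext β
  by_cases h : (β : ℕ) + 1 < n + 1
  · simp only [shiftJet, h, dite_true, Pi.single_apply, Fin.ext_iff, Fin.val_succ,
      Fin.val_castSucc, add_left_inj]
  · have h' : β ≠ δ.castSucc := by
      intro h1
      have := δ.2
      simp [h1] at h
    simp only [shiftJet, h, dite_false, Pi.single_apply, h', if_false]

/-- The commutation of `∂/∂x_(δ+1)` with the total derivative, along a curve of jets. -/
theorem derivWithin_partialGrad_cost {I : Set ℝ} (hI : UniqueDiffOn ℝ I)
    (hc : ContDiffOn ℝ ∞ (fun p : ℝ × (Fin (n + 1) → Euc N) => c p.1 p.2) {p | p.2 0 ∈ φ.target})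
    (hlast : ∀ t, ∀ x : Fin (n + 1) → Euc N, x 0 ∈ φ.target →
      partialGrad (c t) (Fin.last n) x = 0)
    {X : ℝ → Fin (n + 1) → Euc N} {X' : Fin (n + 1) → Euc N} {t : ℝ} (ht : t ∈ I)
    (hX : HasDerivWithinAt X X' I t) (hXt : X t 0 ∈ φ.target)
    (hX' : ∀ β : Fin n, X' β.castSucc = X t β.succ) (δ : Fin n)
    (hdiff : DifferentiableWithinAt ℝ (fun τ => partialGrad (c τ) δ.succ (X τ)) I t) :
    derivWithin (fun τ => partialGrad (c τ) δ.succ (X τ)) I t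
      = partialGrad (totalDeriv c t) δ.succ (X t) - partialGrad (c t) δ.castSucc (X t) := by
  set Cf := fun p : ℝ × (Fin (n + 1) → Euc N) => c p.1 p.2 with hCf
  have hO := isOpen_coordDomain n φ
  have hat : ContDiffAt ℝ ∞ Cf (t, X t) := hc.contDiffAt (hO.mem_nhds hXt)
  have hG : HasFDerivAt (fderiv ℝ Cf) (fderiv ℝ (fderiv ℝ Cf) (t, X t)) (t, X t) :=
    ((hat.fderiv_right (m := 1) (by norm_cast)).differentiableAt (by simp)).hasFDerivAt
  set DG := fderiv ℝ (fderiv ℝ Cf) (t, X t)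
  have hsymm : ∀ a b, DG a b = DG b a := fun a b =>
    ((contDiffAt_infty.1 hat 2).isSymmSndFDerivAt (by simp)).eq a b
  -- Since `∂C/∂q_(n)` vanishes on the whole open domain, so do all its first derivatives.
  have hlast' : ∀ b y, DG b (0, Pi.single (Fin.last n) y) = 0 := by
    intro b y
    have h1 : HasFDerivAt (fun p => fderiv ℝ Cf p (0, Pi.single (Fin.last n) y))
        (DG.flip (0, Pi.single (Fin.last n) y)) (t, X t) := by
      simpa using hG.clm_apply
        (hasFDerivAt_const ((0 : ℝ), (Pi.single (Fin.last n) y : Fin (n + 1) → Euc N)) (t, X t))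
    have h2 : (fun p => fderiv ℝ Cf p (0, Pi.single (Fin.last n) y))
        =ᶠ[𝓝 (t, X t)] fun _ => 0 := by
      filter_upwards [hO.mem_nhds hXt] with p hp
      rw [← fderiv_cost_eq hc hp, ← inner_partialGrad (differentiableAt_cost hc hp),
        hlast _ _ hp, inner_zero_left]
    have h3 := h1.fderiv
    rw [h2.fderiv_eq, fderiv_fun_const] at h3
    simpa using (congrArg (fun l => l b) h3).symm
  have hXc : ContinuousWithinAt (fun τ => X τ 0) I t :=
    (continuous_apply 0).continuousAt.comp_continuousWithinAt hX.continuousWithinAt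
  refine ext_inner_right ℝ fun v => ?_
  have e1 : ⟪derivWithin (fun τ => partialGrad (c τ) δ.succ (X τ)) I t, v⟫
      = DG (1, X') (0, Pi.single δ.succ v) := by
    have h1 := hdiff.hasDerivWithinAt.inner ℝ (hasDerivWithinAt_const t I v)
    have h2 : HasDerivWithinAt (fun τ => fderiv ℝ Cf (τ, X τ) (0, Pi.single δ.succ v))
        (DG (1, X') (0, Pi.single δ.succ v)) I t := by
      have h3 := hG.comp_hasDerivWithinAt t ((hasDerivWithinAt_id t I).prodMk hX)
      simpa using h3.clm_apply (hasDerivWithinAt_const t I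
        ((0 : ℝ), (Pi.single δ.succ v : Fin (n + 1) → Euc N)))
    have h4 : (fun τ => ⟪partialGrad (c τ) δ.succ (X τ), v⟫) =ᶠ[𝓝[I] t]
        fun τ => fderiv ℝ Cf (τ, X τ) (0, Pi.single δ.succ v) := by
      filter_upwards [hXc.eventually (φ.open_target.mem_nhds hXt)] with τ hτ
      rw [inner_partialGrad (differentiableAt_cost hc hτ), fderiv_cost_eq hc hτ]
    have h5 := h2.congr_of_eventuallyEq h4 (h4.self_of_nhdsWithin ht)
    have h6 := (hI t ht).eq_deriv _ h1 h5
    simpa using h6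
  have e2 : ⟪partialGrad (totalDeriv c t) δ.succ (X t), v⟫
      = DG (0, Pi.single δ.succ v) (1, shiftJet (X t))
        + fderiv ℝ Cf (t, X t) (0, Pi.single δ.castSucc v) := by
    have h1 : HasFDerivAt (fun x : Fin (n + 1) → Euc N => (t, x))
        (ContinuousLinearMap.inr ℝ ℝ (Fin (n + 1) → Euc N)) (X t) :=
      hasFDerivAt_prodMk_right (𝕜 := ℝ) t (X t)
    have h2 : HasFDerivAt (fun x : Fin (n + 1) → Euc N => ((1 : ℝ), shiftJet x))
        ((ContinuousLinearMap.inr ℝ ℝ (Fin (n + 1) → Euc N)).comp (shiftJetL n N)) (X t) := by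
      simp only [← shiftJetL_apply]
      exact (hasFDerivAt_prodMk_right (𝕜 := ℝ) (1 : ℝ) _).comp (X t)
        (shiftJetL n N).hasFDerivAt
    have h3 : HasFDerivAt (totalDeriv c t) _ (X t) := (hG.comp (X t) h1).clm_apply h2
    rw [inner_partialGrad h3.differentiableAt, h3.fderiv]
    simp only [add_apply, ContinuousLinearMap.comp_apply,
      ContinuousLinearMap.flip_apply, ContinuousLinearMap.inr_apply, shiftJetL_apply,
      shiftJet_single_succ, Function.comp_apply]
    ring
  -- The velocity of a curve of jets differs from the shifted jet only in the top slot, where the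
  -- shift puts `0`. By `hlast'` this difference is not seen by the second derivative of the cost.
  have e3 : ((1 : ℝ), X') = (1, shiftJet (X t)) + (0, Pi.single (Fin.last n) (X' (Fin.last n))) := by
    refine Prod.ext (by simp) ?_
    funext β
    refine Fin.lastCases ?_ (fun β => ?_) β
    · simp [shiftJet]
    · simp [shiftJet, hX', Fin.ext_iff, β.2.ne, Fin.succ]
  rw [inner_sub_left, e1, e2, inner_partialGrad (differentiableAt_cost hc hXt),
    fderiv_cost_eq hc hXt, e3, hsymm _ (0, Pi.single δ.succ v), map_add, hlast']
  ring

end TotalDerivative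

/-! ### Momenta of a total derivative -/

section CostMomentum

variable {n N M : ℕ} {Q : Type*} [TopologicalSpace Q] [ChartedSpace (Euc N) Q]
  [IsManifold (𝓡 N) ∞ Q] {I J : Set ℝ} {K : Set (Euc M)} {u : ℝ → ℝ → Euc M}
  {q : ℝ → ℝ → Q} {φ : OpenPartialHomeomorph Q (Euc N)} {c : ℝ → (Fin (n + 1) → Euc N) → ℝ}

/-- The momenta of a total derivative `dC/dt` are the derivatives `∂C/∂q_(β)`. -/
theorem SmoothFamily.momentum_totalDeriv (hF : SmoothFamily N I J K u q) (hK : UniqueDiffOn ℝ K)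
    (hφ : φ ∈ IsManifold.maximalAtlas (𝓡 N) ∞ Q)
    (hc : ContDiffOn ℝ ∞ (fun p : ℝ × (Fin (n + 1) → Euc N) => c p.1 p.2) {p | p.2 0 ∈ φ.target})
    (hlast : ∀ t, ∀ x : Fin (n + 1) → Euc N, x 0 ∈ φ.target →
      partialGrad (c t) (Fin.last n) x = 0)
    {s : ℝ} (hs : s ∈ J) (β : Fin (n + 1)) {t : ℝ} (ht : t ∈ I) (hq : q t s ∈ φ.source) :
    _root_.momentum I φ (fun t x _ => totalDeriv c t x) (fun τ => u τ s) (fun τ => q τ s) β t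
      = partialGrad (c t) β (_root_.jetCoords n I φ (fun τ => q τ s) t) := by
  have hX0 : ∀ t, q t s ∈ φ.source →
      _root_.jetCoords n I φ (fun τ => q τ s) t 0 ∈ φ.target := by
    intro t ht
    simpa [_root_.jetCoords] using φ.map_source ht
  -- Downward induction along the momentum recursion. As `∂(dC/dt)/∂q_(β+1) = d/dt(∂C/∂q_(β+1)) +
  -- ∂C/∂q_(β)`, subtracting `dp_(β+1)/dt` leaves `∂C/∂q_(β)`.
  induction β using Fin.reverseInduction generalizing t with
  | last =>
    rw [hlast _ _ (hX0 t hq), momentum_eq_tailMomentum, tailMomentum_of_le _ (by simp)]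
    rfl
  | cast δ ih =>
    have hg : ∀ j, ContDiffWithinAt ℝ ∞ (_root_.gradAlong I φ (fun t x _ => totalDeriv c t x)
        (fun τ => u τ s) (fun τ => q τ s) j) I t := fun j =>
      (hF.gradAlong hK hφ (smoothJetFun_of_cost (contDiffOn_totalDeriv hc) K) (p := (t, s))
        ⟨ht, hs⟩ hq j).section_fst hs
    have he : _root_.momentum I φ (fun t x _ => totalDeriv c t x) (fun τ => u τ s)
        (fun τ => q τ s) (δ.castSucc + 1 : ℕ) =ᶠ[𝓝[I] t]
        fun τ => partialGrad (c τ) δ.succ (_root_.jetCoords n I φ (fun τ => q τ s) τ) := by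
      filter_upwards [self_mem_nhdsWithin, (tendsto_mk_left_nhdsWithin hs).eventually
        (hF.eventually_mem_source (p := (t, s)) ⟨ht, hs⟩ hq)] with τ hτ hτq
      exact ih hτ hτq
    have hX := ((hF.jetCoords (n := n) hφ (p := (t, s)) ⟨ht, hs⟩ hq).section_fst hs)
    have hXd := (hX.differentiableWithinAt (by simp)).hasDerivWithinAt
    have hXpi := hasDerivWithinAt_pi.1 hXd
    rw [momentum_eq_tailMomentum, tailMomentum_eq_sub hF.uniqueDiffOn_time ht hg (by simp),
      ← momentum_eq_tailMomentum, he.derivWithin_eq (he.self_of_nhdsWithin ht),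
      derivWithin_partialGrad_cost hF.uniqueDiffOn_time hc hlast ht hXd (hX0 t hq) ?_ δ]
    · exact sub_sub_cancel _ _
    · exact ((hF.gradAlong hK hφ (smoothJetFun_of_cost hc K) (p := (t, s))
        ⟨ht, hs⟩ hq δ.succ).section_fst hs).differentiableWithinAt (by simp)
    · intro β
      rw [← (hXpi β.castSucc).derivWithin (hF.uniqueDiffOn_time t ht)]
      simp [_root_.jetCoords, iteratedDerivWithin_succ]

theorem SmoothFamily.momentum_add (hF : SmoothFamily N I J K u q) (hK : UniqueDiffOn ℝ K)
    (hφ : φ ∈ IsManifold.maximalAtlas (𝓡 N) ∞ Q)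
    {f g : ℝ → (Fin (n + 1) → Euc N) → Euc M → ℝ} (hf : SmoothJetFun φ K f)
    (hg : SmoothJetFun φ K g) {s : ℝ} (hs : s ∈ J) (β : ℕ) {t : ℝ} (ht : t ∈ I)
    (hq : q t s ∈ φ.source) :
    _root_.momentum I φ (fun t x w => f t x w + g t x w) (fun τ => u τ s) (fun τ => q τ s) β t
      = _root_.momentum I φ f (fun τ => u τ s) (fun τ => q τ s) β t
        + _root_.momentum I φ g (fun τ => u τ s) (fun τ => q τ s) β t := by
  simp only [_root_.momentum, ← Finset.sum_add_distrib, ← smul_add]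
  refine Finset.sum_congr rfl fun δ _ => ?_
  congr 1
  rw [← iteratedDerivWithin_add ht hF.uniqueDiffOn_time
    (contDiffWithinAt_infty.1
      ((hF.gradAlong hK hφ hf (p := (t, s)) ⟨ht, hs⟩ hq δ).section_fst hs) _)
    (contDiffWithinAt_infty.1
      ((hF.gradAlong hK hφ hg (p := (t, s)) ⟨ht, hs⟩ hq δ).section_fst hs) _)]
  have he : _root_.gradAlong I φ (fun t x w => f t x w + g t x w) (fun τ => u τ s)
      (fun τ => q τ s) δ =ᶠ[𝓝[I] t]
      _root_.gradAlong I φ f (fun τ => u τ s) (fun τ => q τ s) δ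
        + _root_.gradAlong I φ g (fun τ => u τ s) (fun τ => q τ s) δ := by
    filter_upwards [self_mem_nhdsWithin, (tendsto_mk_left_nhdsWithin hs).eventually
      (hF.eventually_mem_source (p := (t, s)) ⟨ht, hs⟩ hq)] with τ hτ hτq
    have hd := hF.mem_jetDomain (n := n) (p := (τ, s)) ⟨hτ, hs⟩ hτq
    exact partialGrad_add (hf.hasFDerivAt_coords hd).differentiableAt
      (hg.hasFDerivAt_coords hd).differentiableAt δ
  exact he.iteratedDerivWithin_eq (he.self_of_nhdsWithin ht)

end CostMomentum

/-! ### The first variation of the controlled Lagrangian -/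

section FirstVariation

variable {N M : ℕ} {Q : Type*} [TopologicalSpace Q] [ChartedSpace (Euc N) Q]
  {T : ℝ} {D : DefiningTriple N M Q T} {I J : Set ℝ} {u : ℝ → ℝ → Euc M} {q : ℝ → ℝ → Q}
  {φ : OpenPartialHomeomorph Q (Euc N)}

theorem DefiningTriple.smoothJetFun_lagrangianIn
    (hφ : φ ∈ IsManifold.maximalAtlas (𝓡 N) ∞ Q) : SmoothJetFun φ D.K (D.lagrangianIn φ) :=
  D.smooth_L φ hφ

theorem SmoothFamily.eventually_param_mem_source {K : Set (Euc M)}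
    (hF : SmoothFamily N I J K u q) {t s : ℝ} (ht : t ∈ I) (hs : s ∈ J)
    (hq : q t s ∈ φ.source) : ∀ᶠ v in 𝓝[J] s, v ∈ J ∧ q t v ∈ φ.source := by
  filter_upwards [self_mem_nhdsWithin, (tendsto_mk_right_nhdsWithin ht).eventually
    (hF.eventually_mem_source (p := (t, s)) ⟨ht, hs⟩ hq)] with v hv hvq using ⟨hv, hvq⟩

/-- The family obtained by rescaling the parameter by a function of time, with frozen control. -/
theorem SmoothFamily.rescale {K : Set (Euc M)} (hF : SmoothFamily N I (Icc 0 1) K u q)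
    {χ : ℝ → ℝ} (hχ : ContDiff ℝ ∞ χ) (h01 : ∀ t, χ t ∈ Icc (0 : ℝ) 1) :
    SmoothFamily N I (Icc 0 1) K (fun t _ => u t 0) (fun t s => q t (χ t * s)) where
  uniqueDiffOn_time := hF.uniqueDiffOn_time
  uniqueDiffOn_param := hF.uniqueDiffOn_param
  subset_closure := hF.subset_closure
  smooth_u := ContDiffOn.comp (g := fun p : ℝ × ℝ => u p.1 p.2) (f := fun p : ℝ × ℝ => (p.1, 0))
    hF.smooth_u (by fun_prop) (fun p hp => ⟨hp.1, by simp⟩)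
  mem_K := fun t ht s _ => hF.mem_K t ht 0 (by simp)
  smooth_q := ContMDiffOn.comp (g := fun p : ℝ × ℝ => q p.1 p.2) (f := fun p : ℝ × ℝ => (p.1, χ p.1 * p.2))
    hF.smooth_q (ContDiff.contMDiff (by fun_prop)).contMDiffOn
    (fun p hp => ⟨hp.1, mul_nonneg (h01 _).1 hp.2.1, mul_le_one₀ (h01 _).2 hp.2.1 hp.2.2⟩)

variable [IsManifold (𝓡 N) ∞ Q]

theorem SmoothFamily.jetOfCoords_eq (hF : SmoothFamily N I J D.K u q)
    (hφ : φ ∈ IsManifold.maximalAtlas (𝓡 N) ∞ Q) {n : ℕ} {t s : ℝ} (ht : t ∈ I) (hs : s ∈ J)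
    (hq : q t s ∈ φ.source) :
    jetOfCoords φ t (_root_.jetCoords n I φ (fun τ => q τ s) t)
      = curveJet n I (fun τ => q τ s) t := by
  refine jetOfCoords_jetCoords hF.uniqueDiffOn_time hφ ht ?_ hq
  exact ContMDiffWithinAt.comp (g := fun p : ℝ × ℝ => q p.1 p.2) (f := fun τ => (τ, s)) t
    (hF.smooth_q (t, s) ⟨ht, hs⟩)
    (contDiffWithinAt_id.prodMk contDiffWithinAt_const).contMDiffWithinAt (fun _ hτ => ⟨hτ, hs⟩)

theorem SmoothFamily.L_curveJet (hF : SmoothFamily N I J D.K u q)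
    (hφ : φ ∈ IsManifold.maximalAtlas (𝓡 N) ∞ Q) {t s : ℝ} (ht : t ∈ I) (hs : s ∈ J)
    (hq : q t s ∈ φ.source) (w : Euc M) :
    D.L (curveJet D.n I (fun τ => q τ s) t) w
      = D.lagrangianIn φ t (_root_.jetCoords D.n I φ (fun τ => q τ s) t) w := by
  rw [DefiningTriple.lagrangianIn, hF.jetOfCoords_eq hφ ht hs hq]

theorem SmoothFamily.hasDerivWithinAt_jetCoords {K : Set (Euc M)}
    (hF : SmoothFamily N I J K u q) {n : ℕ}
    (hφ : φ ∈ IsManifold.maximalAtlas (𝓡 N) ∞ Q) {t s : ℝ} (ht : t ∈ I) (hs : s ∈ J)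
    (hq : q t s ∈ φ.source) :
    HasDerivWithinAt (fun v => _root_.jetCoords n I φ (fun τ => q τ v) t)
      (fun δ => iteratedDerivWithin δ (fun τ => derivWithin (fun v => φ (q τ v)) J s) I t) J s := by
  refine hasDerivWithinAt_pi.2 fun δ => ?_
  have hc := hF.coords hφ (p := (t, s)) ⟨ht, hs⟩ hq
  rw [← derivWithin_iteratedDerivWithin_comm hF.uniqueDiffOn_time hF.uniqueDiffOn_param
    hF.subset_closure ht hs hc]
  exact (((hc.iteratedDerivWithin_fst hF.uniqueDiffOn_time hF.uniqueDiffOn_param ⟨ht, hs⟩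
    δ).section_snd ht).differentiableWithinAt (by simp)).hasDerivWithinAt

/-- The first variation of a controlled Lagrangian. -/
theorem SmoothFamily.hasDerivWithinAt_L (hF : SmoothFamily N I J D.K u q)
    (hφ : φ ∈ IsManifold.maximalAtlas (𝓡 N) ∞ Q) {t s : ℝ} (ht : t ∈ I) (hs : s ∈ J)
    (hq : q t s ∈ φ.source) :
    HasDerivWithinAt (fun v => D.L (curveJet D.n I (fun τ => q τ v) t) (u t v))
      (∑ δ, ⟪_root_.gradAlong I φ (D.lagrangianIn φ) (fun τ => u τ s) (fun τ => q τ s) δ t,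
          iteratedDerivWithin δ (fun τ => derivWithin (fun v => φ (q τ v)) J s) I t⟫
        + fderivWithin ℝ (D.L (curveJet D.n I (fun τ => q τ s) t)) D.K (u t s)
          (derivWithin (u t) J s)) J s := by
  have hf : SmoothJetFun φ D.K (D.lagrangianIn φ) := D.smoothJetFun_lagrangianIn hφ
  set X := fun v => _root_.jetCoords D.n I φ (fun τ => q τ v) t with hXdef
  have hmem : ((t, X s), u t s) ∈ jetDomain D.n φ D.K :=
    hF.mem_jetDomain (p := (t, s)) ⟨ht, hs⟩ hq
  have hX := hF.hasDerivWithinAt_jetCoords (n := D.n) hφ ht hs hq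
  have hu : HasDerivWithinAt (u t) (derivWithin (u t) J s) J s :=
    (((hF.smooth_u (t, s) ⟨ht, hs⟩).section_snd ht).differentiableWithinAt
      (by simp)).hasDerivWithinAt
  set S := jetDomain D.n φ D.K with hS
  set F := fun p : (ℝ × (Fin (D.n + 1) → Euc N)) × Euc M => D.lagrangianIn φ p.1.1 p.1.2 p.2
  have hDF : HasFDerivWithinAt F (fderivWithin ℝ F S ((t, X s), u t s)) S ((t, X s), u t s) :=
    ((hf _ hmem).differentiableWithinAt (by simp)).hasFDerivWithinAt
  have hev := hF.eventually_param_mem_source ht hs hq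
  have h1 : HasDerivWithinAt (fun v => F ((t, X v), u t v))
      (fderivWithin ℝ F S ((t, X s), u t s) ((0, fun δ => iteratedDerivWithin δ
        (fun τ => derivWithin (fun v => φ (q τ v)) J s) I t), derivWithin (u t) J s)) J s := by
    have h2 := ((hasDerivWithinAt_const s J t).prodMk hX).prodMk hu
    -- `q t v` lies in the chart only for `v` near `s`, so the chain rule is applied on that part of
    -- `J` and then transferred to `J`.
    refine (hDF.comp_hasDerivWithinAt s (h2.mono fun v (hv : v ∈ J ∧ q t v ∈ φ.source) => hv.1)
      (fun v hv => ?_)).mono_of_mem_nhdsWithin hev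
    exact hF.mem_jetDomain (p := (t, v)) ⟨ht, hv.1⟩ hv.2
  have he : (fun v => D.L (curveJet D.n I (fun τ => q τ v) t) (u t v)) =ᶠ[𝓝[J] s]
      fun v => F ((t, X v), u t v) := by
    filter_upwards [hev] with v hv using hF.L_curveJet hφ ht hv.1 hv.2 _
  refine (h1.congr_of_eventuallyEq he (he.self_of_nhdsWithin hs)).congr_deriv ?_
  have hx := hf.hasFDerivAt_coords hmem
  -- The derivative in the control is the full derivative restricted to the slice over the fixed
  -- jet; unique differentiability of `K` identifies it with `fderivWithin`.
  have hw : HasFDerivWithinAt (D.L (curveJet D.n I (fun τ => q τ s) t))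
      ((fderivWithin ℝ F S ((t, X s), u t s)).comp (ContinuousLinearMap.inr ℝ _ _)) D.K
      (u t s) := by
    have h2 := hDF.comp (u t s) (hasFDerivAt_prodMk_right (𝕜 := ℝ) (t, X s)
      (u t s)).hasFDerivWithinAt (s := D.K) (fun w hw => ⟨hmem.1, hw⟩)
    refine h2.congr (fun w _ => hF.L_curveJet hφ ht hs hq w) (hF.L_curveJet hφ ht hs hq _)
  rw [hw.fderivWithin (D.uniqueDiffOn_K _ hmem.2)]
  have h3 := fderiv_eq_sum_inner_partialGrad hx.differentiableAt
    (fun δ => iteratedDerivWithin δ (fun τ => derivWithin (fun v => φ (q τ v)) J s) I t)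
  rw [hx.fderiv] at h3
  simp only [_root_.gradAlong]
  rw [← h3]
  simp only [ContinuousLinearMap.comp_apply, jetInclusion_apply, ContinuousLinearMap.inr_apply]
  rw [← map_add]
  simp only [Prod.mk_add_mk, add_zero, zero_add]
  rfl

theorem SmoothFamily.contDiffOn_L (hF : SmoothFamily N I J D.K u q) :
    ContDiffOn ℝ ∞ (fun z : ℝ × ℝ => D.L (curveJet D.n I (fun τ => q τ z.2) z.1) (u z.1 z.2))
      (I ×ˢ J) := by
  intro p hp
  have hφ : chartAt (Euc N) (q p.1 p.2) ∈ IsManifold.maximalAtlas (𝓡 N) ∞ Q :=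
    IsManifold.chart_mem_maximalAtlas _
  have hq := mem_chart_source (Euc N) (q p.1 p.2)
  have h1 := hF.comp_jetCoords hφ hp hq (D.smoothJetFun_lagrangianIn hφ)
  refine h1.congr_of_eventuallyEq ?_ (hF.L_curveJet hφ hp.1 hp.2 hq _)
  filter_upwards [self_mem_nhdsWithin, hF.eventually_mem_source hp hq] with z hz hzq
  exact hF.L_curveJet hφ hz.1 hz.2 hzq _

/-- The derivative of the Lagrangian along the variation with Jacobi field `χ Y`. -/
def DefiningTriple.work (D : DefiningTriple N M Q T) (I : Set ℝ) (u : ℝ → ℝ → Euc M)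
    (q : ℝ → ℝ → Q) (χ : ℝ → ℝ) (t : ℝ) : ℝ :=
  derivWithin (fun s => D.L (curveJet D.n I (fun τ => q τ (χ τ * s)) t) (u t 0)) (Icc 0 1) 0

/-- The coordinates of the Jacobi field of a variation. -/
def jacobiCoords (φ : OpenPartialHomeomorph Q (Euc N)) (q : ℝ → ℝ → Q) (t : ℝ) : Euc N :=
  derivWithin (fun v => φ (q t v)) (Icc 0 1) 0

theorem SmoothFamily.jacobiCoords {K : Set (Euc M)} (hF : SmoothFamily N I (Icc 0 1) K u q)
    (hφ : φ ∈ IsManifold.maximalAtlas (𝓡 N) ∞ Q) {t : ℝ} (ht : t ∈ I)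
    (hq : q t 0 ∈ φ.source) : ContDiffWithinAt ℝ ∞ (jacobiCoords φ q) I t :=
  ((hF.coords hφ (p := (t, 0)) ⟨ht, by simp⟩ hq).derivWithin_snd hF.uniqueDiffOn_time
    hF.uniqueDiffOn_param ⟨ht, by simp⟩).section_fst (by simp)

/-- The rescaled family `q(t, χ(t)s)` realises `χ Y` as an actual Jacobi field. The left side
involves no chart, so the sum on the right is the same in every chart around `q t 0`; this allows a
different chart for each piece of a partition of unity. -/
theorem SmoothFamily.work_eq_sum (hF : SmoothFamily N I (Icc 0 1) D.K u q)
    (hφ : φ ∈ IsManifold.maximalAtlas (𝓡 N) ∞ Q) {χ : ℝ → ℝ} (hχ : ContDiff ℝ ∞ χ)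
    (h01 : ∀ t, χ t ∈ Icc (0 : ℝ) 1) {t : ℝ} (ht : t ∈ I) (hq : q t 0 ∈ φ.source) :
    D.work I u q χ t = ∑ δ, ⟪_root_.gradAlong I φ (D.lagrangianIn φ) (fun τ => u τ 0)
      (fun τ => q τ 0) δ t,
        iteratedDerivWithin δ (fun τ => χ τ • _root_.jacobiCoords φ q τ) I t⟫ := by
  have h0 : (0 : ℝ) ∈ Icc (0 : ℝ) 1 := by simp
  have hR := hF.rescale hχ h01
  have h1 := hR.hasDerivWithinAt_L hφ ht h0 (by simpa using hq)
  have h2 : derivWithin (fun _ : ℝ => u t 0) (Icc 0 1) 0 = 0 := by simp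
  rw [h2, map_zero, add_zero] at h1
  rw [DefiningTriple.work, h1.derivWithin (hF.uniqueDiffOn_param 0 h0)]
  simp only [mul_zero]
  refine Finset.sum_congr rfl fun δ _ => ?_
  congr 1
  have he : (fun τ => derivWithin (fun v => φ (q τ (χ τ * v))) (Icc 0 1) 0) =ᶠ[𝓝[I] t]
      fun τ => χ τ • _root_.jacobiCoords φ q τ := by
    filter_upwards [self_mem_nhdsWithin, (tendsto_mk_left_nhdsWithin h0).eventually
      (hF.eventually_mem_source (p := (t, 0)) ⟨ht, h0⟩ hq)] with τ hτ hτq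
    -- The base point is written `χ τ * 0` to match the chain rule for `v ↦ χ τ * v`.
    have h3 : HasDerivWithinAt (fun v => φ (q τ v)) (_root_.jacobiCoords φ q τ) (Icc 0 1)
        (χ τ * 0) := by
      rw [mul_zero]
      exact (((hF.coords hφ (p := (τ, 0)) ⟨hτ, h0⟩ hτq).section_snd hτ).differentiableWithinAt
        (by simp)).hasDerivWithinAt
    have h4 : HasDerivWithinAt (fun v => χ τ * v) (χ τ) (Icc (0 : ℝ) 1) 0 := by
      simpa using (hasDerivWithinAt_id (0 : ℝ) (Icc 0 1)).const_mul (χ τ)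
    exact (h3.scomp (0 : ℝ) h4 (fun v hv => ⟨mul_nonneg (h01 _).1 hv.1,
      mul_le_one₀ (h01 _).2 hv.1 hv.2⟩)).derivWithin (hF.uniqueDiffOn_param 0 h0)
  exact he.iteratedDerivWithin_eq (he.self_of_nhdsWithin ht)

end FirstVariation

/-! ### The integral of the work as a difference of boundary terms -/

section Work

variable {N M : ℕ} {Q : Type*} [TopologicalSpace Q] [ChartedSpace (Euc N) Q]
  {T : ℝ} {D : DefiningTriple N M Q T} {I : Set ℝ} {u : ℝ → ℝ → Euc M} {q : ℝ → ℝ → Q}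
  {φ : OpenPartialHomeomorph Q (Euc N)} {χ : ℝ → ℝ} {t : ℝ}

/-- The pairing of the momenta with the Jacobi field `χ Y`. -/
def DefiningTriple.momentumPairing (D : DefiningTriple N M Q T) (I : Set ℝ)
    (φ : OpenPartialHomeomorph Q (Euc N)) (u : ℝ → ℝ → Euc M) (q : ℝ → ℝ → Q) (χ : ℝ → ℝ)
    (t : ℝ) : ℝ :=
  ∑ β ∈ Finset.range D.n, ⟪momentum I φ (D.lagrangianIn φ) (fun τ => u τ 0) (fun τ => q τ 0) β t,
    iteratedDerivWithin β (fun τ => χ τ • jacobiCoords φ q τ) I t⟫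

theorem eventually_smul_eq_zero (hχ : t ∉ tsupport χ) (Y : ℝ → Euc N) :
    (fun τ => χ τ • Y τ) =ᶠ[𝓝 t] fun _ => 0 := by
  filter_upwards [notMem_tsupport_iff_eventuallyEq.1 hχ] with τ hτ
  simp [hτ]

/-- No condition ties `φ` to the curve: away from the support of `χ` the pairing vanishes even where
the chart expression is meaningless, so charts can be exchanged freely there. -/
theorem DefiningTriple.momentumPairing_eventually_zero (hχ : t ∉ tsupport χ) :
    ∀ᶠ τ in 𝓝[I] t, τ ∈ I → D.momentumPairing I φ u q χ τ = 0 := by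
  have h1 := (isClosed_tsupport χ).isOpen_compl.mem_nhds hχ
  filter_upwards [mem_nhdsWithin_of_mem_nhds h1] with τ hτ hτI
  refine Finset.sum_eq_zero fun β _ => ?_
  have h2 : (fun τ => χ τ • jacobiCoords φ q τ) =ᶠ[𝓝[I] τ] fun _ => 0 :=
    (eventually_smul_eq_zero hτ _).filter_mono nhdsWithin_le_nhds
  rw [h2.iteratedDerivWithin_eq (h2.self_of_nhdsWithin hτI)]
  simp

theorem sum_iteratedDerivWithin_smul {ι : Type*} [Fintype ι] {χ : ι → ℝ → ℝ} {Y : ℝ → Euc N}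
    (hI : UniqueDiffOn ℝ I) (hχ : ∀ i, ContDiff ℝ ∞ (χ i)) (hsum : ∀ t ∈ I, ∑ i, χ i t = 1)
    (ht : t ∈ I) (hY : ContDiffWithinAt ℝ ∞ Y I t) (k : ℕ) :
    ∑ i, iteratedDerivWithin k (fun τ => χ i τ • Y τ) I t
      = iteratedDerivWithin k (fun τ => (1 : ℝ) • Y τ) I t := by
  rw [← iteratedDerivWithin_fun_sum (f := fun i τ => χ i τ • Y τ) ht hI (fun i _ =>
    contDiffWithinAt_infty.1 ((hχ i).contDiffWithinAt.smul hY) _)]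
  refine iteratedDerivWithin_congr (fun τ hτ => ?_) ht
  simp only [← Finset.sum_smul, hsum τ hτ]

variable [IsManifold (𝓡 N) ∞ Q]

theorem SmoothFamily.gradAlong_fst (hF : SmoothFamily N I (Icc 0 1) D.K u q)
    (hφ : φ ∈ IsManifold.maximalAtlas (𝓡 N) ∞ Q) (ht : t ∈ I) (hq : q t 0 ∈ φ.source)
    (δ : Fin (D.n + 1)) :
    ContDiffWithinAt ℝ ∞ (_root_.gradAlong I φ (D.lagrangianIn φ) (fun τ => u τ 0)
      (fun τ => q τ 0) δ) I t :=
  (hF.gradAlong D.uniqueDiffOn_K hφ (D.smoothJetFun_lagrangianIn hφ) (p := (t, 0))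
    ⟨ht, by simp⟩ hq δ).section_fst (by simp)

theorem SmoothFamily.contDiffWithinAt_momentumPairing
    (hF : SmoothFamily N I (Icc 0 1) D.K u q) (hφ : φ ∈ IsManifold.maximalAtlas (𝓡 N) ∞ Q)
    (hχ : ContDiff ℝ ∞ χ) (ht : t ∈ I) (hq : q t 0 ∈ φ.source) :
    ContDiffWithinAt ℝ ∞ (D.momentumPairing I φ u q χ) I t := by
  have hY := hχ.contDiffWithinAt.smul (hF.jacobiCoords hφ ht hq)
  refine ContDiffWithinAt.sum fun β _ => ContDiffWithinAt.inner ℝ ?_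
    (hY.iteratedDerivWithin_infty hF.uniqueDiffOn_time ht β)
  exact ContDiffWithinAt.tailMomentum hF.uniqueDiffOn_time ht (hF.gradAlong_fst hφ ht hq) β

/-- In the integration by parts formula the force terms add up to the work, and the remaining term
is the Euler–Lagrange expression, which is zero. -/
theorem SmoothFamily.hasDerivWithinAt_momentumPairing
    (hF : SmoothFamily N I (Icc 0 1) D.K u q) (hφ : φ ∈ IsManifold.maximalAtlas (𝓡 N) ∞ Q)
    (hχ : ContDiff ℝ ∞ χ) (h01 : ∀ t, χ t ∈ Icc (0 : ℝ) 1) (ht : t ∈ I) (hq : q t 0 ∈ φ.source)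
    (hEL : eulerLagrange I φ (D.lagrangianIn φ) (fun τ => u τ 0) (fun τ => q τ 0) t = 0) :
    HasDerivWithinAt (D.momentumPairing I φ u q χ) (D.work I u q χ t) I t := by
  have hY := hχ.contDiffWithinAt.smul (hF.jacobiCoords hφ ht hq)
  have h := hasDerivWithinAt_sum_tailMomentum hF.uniqueDiffOn_time ht
    (hF.gradAlong_fst hφ ht hq) hY
  rw [show ∑ δ : Fin (D.n + 1), (-1 : ℝ) ^ (δ : ℕ) • iteratedDerivWithin δ
    (_root_.gradAlong I φ (D.lagrangianIn φ) (fun τ => u τ 0) (fun τ => q τ 0) δ) I t = 0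
    from hEL, inner_zero_left, sub_zero] at h
  rw [hF.work_eq_sum hφ hχ h01 ht hq]
  exact h

theorem SmoothFamily.work_eq_zero (hF : SmoothFamily N I (Icc 0 1) D.K u q)
    (hχ : ContDiff ℝ ∞ χ) (h01 : ∀ t, χ t ∈ Icc (0 : ℝ) 1) (ht : t ∈ I) (h0 : t ∉ tsupport χ) :
    D.work I u q χ t = 0 := by
  rw [hF.work_eq_sum (IsManifold.chart_mem_maximalAtlas (q t 0)) hχ h01 ht
    (mem_chart_source (Euc N) (q t 0))]
  refine Finset.sum_eq_zero fun δ _ => ?_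
  have h2 : (fun τ => χ τ • _root_.jacobiCoords (chartAt (Euc N) (q t 0)) q τ) =ᶠ[𝓝[I] t]
      fun _ => 0 := (eventually_smul_eq_zero h0 _).filter_mono nhdsWithin_le_nhds
  rw [h2.iteratedDerivWithin_eq (h2.self_of_nhdsWithin ht)]
  simp

theorem SmoothFamily.sum_work {ι : Type*} [Fintype ι] {χ : ι → ℝ → ℝ}
    (hF : SmoothFamily N I (Icc 0 1) D.K u q)
    (hχ : ∀ i, ContDiff ℝ ∞ (χ i)) (h01 : ∀ i t, χ i t ∈ Icc (0 : ℝ) 1)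
    (hsum : ∀ t ∈ I, ∑ i, χ i t = 1) (ht : t ∈ I) :
    ∑ i, D.work I u q (χ i) t = D.work I u q (fun _ => 1) t := by
  have hφ : chartAt (Euc N) (q t 0) ∈ IsManifold.maximalAtlas (𝓡 N) ∞ Q :=
    IsManifold.chart_mem_maximalAtlas _
  have hq := mem_chart_source (Euc N) (q t 0)
  have hY := hF.jacobiCoords hφ ht hq
  rw [hF.work_eq_sum hφ contDiff_const (by simp) ht hq]
  simp_rw [fun i => hF.work_eq_sum hφ (hχ i) (h01 i) ht hq]
  rw [Finset.sum_comm]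
  refine Finset.sum_congr rfl fun δ _ => ?_
  rw [← inner_sum, sum_iteratedDerivWithin_smul hF.uniqueDiffOn_time hχ hsum ht hY]

/-- A localised form of the first variation formula. -/
theorem SmoothFamily.integral_work_localized
    (hF : SmoothFamily N (Icc 0 T) (Icc 0 1) D.K u q) (hT : 0 < T)
    (hφ : φ ∈ IsManifold.maximalAtlas (𝓡 N) ∞ Q)
    (hχ : ContDiff ℝ ∞ χ) (h01 : ∀ t, χ t ∈ Icc (0 : ℝ) 1)
    (hq : ∀ t ∈ Icc 0 T, t ∈ tsupport χ → q t 0 ∈ φ.source)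
    (hEL : ∀ t ∈ Icc 0 T, q t 0 ∈ φ.source →
      eulerLagrange (Icc 0 T) φ (D.lagrangianIn φ) (fun τ => u τ 0) (fun τ => q τ 0) t = 0) :
    ContinuousOn (D.work (Icc 0 T) u q χ) (Icc 0 T) ∧
    ∫ t in (0 : ℝ)..T, D.work (Icc 0 T) u q χ t
      = D.momentumPairing (Icc 0 T) φ u q χ T - D.momentumPairing (Icc 0 T) φ u q χ 0 := by
  -- On the support of `χ` the curve lies in the chart; elsewhere the pairing is locally zero. Both
  -- cases give smoothness and the same derivative formula on all of `[0,T]`.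
  have hz : ∀ t ∈ Icc 0 T, t ∉ tsupport χ →
      D.momentumPairing (Icc 0 T) φ u q χ =ᶠ[𝓝[Icc 0 T] t] fun _ => 0 := by
    intro t _ h
    filter_upwards [self_mem_nhdsWithin, D.momentumPairing_eventually_zero (φ := φ) (u := u)
      (q := q) (I := Icc 0 T) h] with τ hτ h1 using h1 hτ
  have h1 : ContDiffOn ℝ ∞ (D.momentumPairing (Icc 0 T) φ u q χ) (Icc 0 T) := by
    intro t ht
    by_cases h : t ∈ tsupport χ
    · exact hF.contDiffWithinAt_momentumPairing hφ hχ ht (hq t ht h)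
    · exact contDiffWithinAt_const.congr_of_eventuallyEq (hz t ht h)
        ((hz t ht h).self_of_nhdsWithin ht)
  have h2 : ∀ t ∈ Icc 0 T, derivWithin (D.momentumPairing (Icc 0 T) φ u q χ) (Icc 0 T) t
      = D.work (Icc 0 T) u q χ t := by
    intro t ht
    by_cases h : t ∈ tsupport χ
    · exact (hF.hasDerivWithinAt_momentumPairing hφ hχ h01 ht (hq t ht h)
        (hEL t ht (hq t ht h))).derivWithin (hF.uniqueDiffOn_time t ht)
    · rw [hF.work_eq_zero hχ h01 ht h,
        (hz t ht h).derivWithin_eq ((hz t ht h).self_of_nhdsWithin ht)]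
      simp
  constructor
  · exact (h1.continuousOn_derivWithin hF.uniqueDiffOn_time (by simp)).congr
      fun t ht => (h2 t ht).symm
  · rw [← intervalIntegral.integral_derivWithin_Icc_of_contDiffOn_Icc (h1.of_le (by simp)) hT.le]
    refine intervalIntegral.integral_congr fun t ht => ?_
    rw [uIcc_of_le hT.le] at ht
    exact (h2 t ht).symm

/-- A smooth partition of unity on a compact interval, subordinate to charts along a curve, with
prescribed charts at the end points. -/
theorem exists_partition_charts (hT : 0 < T) {c : ℝ → Q} (hc : ContinuousOn c (Icc 0 T))
    {φ₀ φ₁ : OpenPartialHomeomorph Q (Euc N)}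
    (hφ₀ : φ₀ ∈ IsManifold.maximalAtlas (𝓡 N) ∞ Q) (hq₀ : c 0 ∈ φ₀.source)
    (hφ₁ : φ₁ ∈ IsManifold.maximalAtlas (𝓡 N) ∞ Q) (hq₁ : c T ∈ φ₁.source) :
    ∃ (ι : Type) (_ : Fintype ι) (χ : ι → ℝ → ℝ) (ψ : ι → OpenPartialHomeomorph Q (Euc N)),
      (∀ i, ContDiff ℝ ∞ (χ i)) ∧ (∀ i t, χ i t ∈ Icc (0 : ℝ) 1) ∧
      (∀ t ∈ Icc 0 T, ∑ i, χ i t = 1) ∧ (∀ i, ψ i ∈ IsManifold.maximalAtlas (𝓡 N) ∞ Q) ∧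
      (∀ i, ∀ t ∈ Icc 0 T, t ∈ tsupport (χ i) → c t ∈ (ψ i).source) ∧
      (∀ i, 0 ∈ tsupport (χ i) → ψ i = φ₀) ∧ (∀ i, T ∈ tsupport (χ i) → ψ i = φ₁) := by
  classical
  set ψ : ℝ → OpenPartialHomeomorph Q (Euc N) := fun t =>
    if t = 0 then φ₀ else if t = T then φ₁ else chartAt (Euc N) (c t) with hψ
  have hψmem : ∀ t, ψ t ∈ IsManifold.maximalAtlas (𝓡 N) ∞ Q := by
    intro t
    simp only [hψ]
    split_ifs
    exacts [hφ₀, hφ₁, IsManifold.chart_mem_maximalAtlas _]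
  have hψsrc : ∀ t, c t ∈ (ψ t).source := by
    intro t
    simp only [hψ]
    split_ifs with h1 h2
    exacts [h1 ▸ hq₀, h2 ▸ hq₁, mem_chart_source _ _]
  have hW : ∀ t, ∃ W : Set ℝ, IsOpen W ∧ c ⁻¹' (ψ t).source ∩ Icc 0 T = W ∩ Icc 0 T := fun t =>
    continuousOn_iff'.1 hc _ (ψ t).open_source
  choose W hWo hW using hW
  -- Each end point is removed from every set except its own. A function supported in `U i` can then
  -- reach `0` or `T` only if `i` is that end point, so its chart is `φ₀` or `φ₁`.
  set U : ℝ → Set ℝ := fun t => W t ∩ (({0, T} : Set ℝ) \ {t})ᶜ with hU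
  have hUo : ∀ t, IsOpen (U t) := fun t =>
    (hWo t).inter ((((Set.finite_singleton T).insert 0).sdiff).isClosed.isOpen_compl)
  have hUt : ∀ t ∈ Icc 0 T, t ∈ U t := by
    intro t ht
    refine ⟨?_, by simp⟩
    have : t ∈ c ⁻¹' (ψ t).source ∩ Icc 0 T := ⟨hψsrc t, ht⟩
    rw [hW t] at this
    exact this.1
  obtain ⟨b, hb⟩ := isCompact_Icc.elim_finite_subcover U hUo
    (fun t ht => mem_iUnion.2 ⟨t, hUt t ht⟩ : Icc 0 T ⊆ ⋃ t, U t)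
  have hcov : Icc 0 T ⊆ ⋃ i : b, U i := by
    intro t ht
    obtain ⟨i, hi, hti⟩ := mem_iUnion₂.1 (hb ht)
    exact mem_iUnion.2 ⟨⟨i, hi⟩, hti⟩
  obtain ⟨ρ, hρ⟩ := SmoothPartitionOfUnity.exists_isSubordinate 𝓘(ℝ, ℝ) isClosed_Icc
    (fun i : b => U i) (fun i => hUo i) hcov
  have hend : ∀ (i : b) (e : ℝ), e ∈ ({0, T} : Set ℝ) → e ∈ tsupport (ρ i) → (i : ℝ) = e := by
    intro i e he hi
    by_contra hne
    exact (hρ i hi).2 ⟨he, fun h => hne (by simpa using (mem_singleton_iff.1 h).symm)⟩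
  refine ⟨b, inferInstance, fun i => ρ i, fun i => ψ i, fun i => (ρ i).contMDiff.contDiff,
    fun i t => ⟨ρ.nonneg i t, ρ.le_one i t⟩, fun t ht => ?_, fun i => hψmem i,
    fun i t ht hi => ?_, fun i hi => ?_, fun i hi => ?_⟩
  · rw [← finsum_eq_sum_of_fintype]
    exact ρ.sum_eq_one ht
  · have : t ∈ W i ∩ Icc 0 T := ⟨(hρ i hi).1, ht⟩
    rw [← hW i] at this
    exact this.1
  · simp [hψ, hend i 0 (by simp) hi]
  · simp [hψ, hend i T (by simp) hi, hT.ne']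

/-- The first variation formula: the work along a variation of a solution of the Euler-Lagrange
equations is a difference of boundary terms, computed in arbitrary charts. -/
theorem SmoothFamily.integral_work
    (hF : SmoothFamily N (Icc 0 T) (Icc 0 1) D.K u q) (hT : 0 < T)
    {φ₀ φ₁ : OpenPartialHomeomorph Q (Euc N)}
    (hφ₀ : φ₀ ∈ IsManifold.maximalAtlas (𝓡 N) ∞ Q) (hq₀ : q 0 0 ∈ φ₀.source)
    (hφ₁ : φ₁ ∈ IsManifold.maximalAtlas (𝓡 N) ∞ Q) (hq₁ : q T 0 ∈ φ₁.source)
    (hEL : ∀ t ∈ Icc 0 T, ∀ φ ∈ IsManifold.maximalAtlas (𝓡 N) ∞ Q, q t 0 ∈ φ.source →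
      eulerLagrange (Icc 0 T) φ (D.lagrangianIn φ) (fun τ => u τ 0) (fun τ => q τ 0) t = 0) :
    ContinuousOn (D.work (Icc 0 T) u q fun _ => 1) (Icc 0 T) ∧
    ∫ t in (0 : ℝ)..T, D.work (Icc 0 T) u q (fun _ => 1) t
      = D.momentumPairing (Icc 0 T) φ₁ u q (fun _ => 1) T
        - D.momentumPairing (Icc 0 T) φ₀ u q (fun _ => 1) 0 := by
  have h0T : (0 : ℝ) ∈ Icc 0 T := ⟨le_rfl, hT.le⟩
  have hTT : T ∈ Icc 0 T := ⟨hT.le, le_rfl⟩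
  have hc : ContinuousOn (fun t => q t 0) (Icc 0 T) :=
    hF.smooth_q.continuousOn.comp (f := fun t : ℝ => (t, (0 : ℝ))) (by fun_prop)
      (fun t ht => ⟨ht, by simp⟩)
  obtain ⟨ι, _, χ, ψ, hχ, h01, hsum, hψ, hsupp, h0, h1⟩ :=
    exists_partition_charts hT hc hφ₀ hq₀ hφ₁ hq₁
  have hloc := fun i => hF.integral_work_localized hT (hψ i) (hχ i) (h01 i) (hsupp i)
    (fun t ht => hEL t ht _ (hψ i))
  have hw : EqOn (fun t => ∑ i, D.work (Icc 0 T) u q (χ i) t)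
      (D.work (Icc 0 T) u q fun _ => 1) (Icc 0 T) := fun t ht => hF.sum_work hχ h01 hsum ht
  -- At an end point, a piece either uses the prescribed chart or vanishes near it; so all pieces
  -- can be computed in the prescribed chart, where they add up to the uncut pairing.
  have hpair : ∀ {φ : OpenPartialHomeomorph Q (Euc N)} {e : ℝ},
      φ ∈ IsManifold.maximalAtlas (𝓡 N) ∞ Q → e ∈ Icc 0 T → q e 0 ∈ φ.source →
      (∀ i, e ∈ tsupport (χ i) → ψ i = φ) →
      ∑ i, D.momentumPairing (Icc 0 T) (ψ i) u q (χ i) e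
        = D.momentumPairing (Icc 0 T) φ u q (fun _ => 1) e := by
    intro φ e hφ he hqe hψe
    have h2 : ∀ i, D.momentumPairing (Icc 0 T) (ψ i) u q (χ i) e
        = D.momentumPairing (Icc 0 T) φ u q (χ i) e := by
      intro i
      by_cases hi : e ∈ tsupport (χ i)
      · rw [hψe i hi]
      · rw [(D.momentumPairing_eventually_zero hi).self_of_nhdsWithin he he,
          (D.momentumPairing_eventually_zero hi).self_of_nhdsWithin he he]
    simp_rw [h2, DefiningTriple.momentumPairing]
    rw [Finset.sum_comm]
    refine Finset.sum_congr rfl fun β _ => ?_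
    rw [← inner_sum, sum_iteratedDerivWithin_smul hF.uniqueDiffOn_time hχ hsum he
      (hF.jacobiCoords hφ he hqe)]
  refine ⟨(continuousOn_finsetSum _ fun i _ => (hloc i).1).congr fun t ht => (hw ht).symm, ?_⟩
  rw [← hpair hφ₀ h0T hq₀ h0, ← hpair hφ₁ hTT hq₁ h1, ← Finset.sum_sub_distrib]
  simp_rw [← fun i => (hloc i).2]
  rw [← intervalIntegral.integral_finsetSum]
  · refine intervalIntegral.integral_congr fun t ht => ?_
    rw [uIcc_of_le hT.le] at ht
    exact (hw ht).symm
  · intro i _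
    refine ContinuousOn.intervalIntegrable ?_
    rw [uIcc_of_le hT.le]
    exact (hloc i).1

end Work

/-! ### Paths that are linear in their data -/

section Combinations

variable {V : Type*} [NormedAddCommGroup V] [InnerProductSpace ℝ V] {α β : ℝ → ℝ}

/-- The path `t ↦ α(t) c + β(t) d`. -/
def combPath (α β : ℝ → ℝ) (c d : V) (t : ℝ) : V := α t • c + β t • d

theorem hasDerivAt_combPath (hα : ContDiff ℝ ∞ α) (hβ : ContDiff ℝ ∞ β) (c d : V) (k : ℕ)
    (t : ℝ) : HasDerivAt (combPath (iteratedDeriv k α) (iteratedDeriv k β) c d)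
      (combPath (iteratedDeriv (k + 1) α) (iteratedDeriv (k + 1) β) c d t) t := by
  have h : ∀ {γ : ℝ → ℝ}, ContDiff ℝ ∞ γ →
      HasDerivAt (iteratedDeriv k γ) (iteratedDeriv (k + 1) γ t) t := by
    intro γ hγ
    rw [iteratedDeriv_succ]
    exact ((hγ.differentiable_iteratedDeriv k
      (by exact_mod_cast WithTop.coe_lt_top _)) t).hasDerivAt
  exact ((h hα).smul_const c).add ((h hβ).smul_const d)

theorem iteratedDeriv_combPath (hα : ContDiff ℝ ∞ α) (hβ : ContDiff ℝ ∞ β) (c d : V) (k : ℕ) :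
    iteratedDeriv k (combPath α β c d)
      = combPath (iteratedDeriv k α) (iteratedDeriv k β) c d := by
  induction k with
  | zero => simp
  | succ k ih =>
    funext t
    rw [iteratedDeriv_succ, ih]
    exact (hasDerivAt_combPath hα hβ c d k t).deriv

theorem hasDerivWithinAt_combPath_param {J : Set ℝ} {c d : ℝ → V} {c' d' : V} {s : ℝ}
    (hc : HasDerivWithinAt c c' J s) (hd : HasDerivWithinAt d d' J s) (α β : ℝ → ℝ) (t : ℝ) :
    HasDerivWithinAt (fun v => combPath α β (c v) (d v) t) (combPath α β c' d' t) J s :=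
  (hc.const_smul (α t)).add (hd.const_smul (β t))

theorem contDiffWithinAt_combPath_param {J : Set ℝ} {c d : ℝ → V} {s : ℝ}
    (hc : ContDiffWithinAt ℝ ∞ c J s) (hd : ContDiffWithinAt ℝ ∞ d J s) (α β : ℝ → ℝ) (t : ℝ) :
    ContDiffWithinAt ℝ ∞ (fun v => combPath α β (c v) (d v) t) J s :=
  (hc.const_smul (α t)).add (hd.const_smul (β t))

theorem contDiffWithinAt_combPath {I J : Set ℝ} {c d : ℝ → V} {p : ℝ × ℝ}
    (hα : ContDiff ℝ ∞ α) (hβ : ContDiff ℝ ∞ β)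
    (hc : ContDiffWithinAt ℝ ∞ c J p.2) (hd : ContDiffWithinAt ℝ ∞ d J p.2) (k : ℕ) :
    ContDiffWithinAt ℝ ∞ (fun z : ℝ × ℝ =>
      combPath (iteratedDeriv k α) (iteratedDeriv k β) (c z.2) (d z.2) z.1) (I ×ˢ J) p := by
  have h : ∀ {γ : ℝ → ℝ}, ContDiff ℝ ∞ γ → ContDiff ℝ ∞ (iteratedDeriv k γ) := by
    intro γ hγ
    rw [iteratedDeriv_eq_iterate]
    exact hγ.iterate_deriv k
  have h2 : ∀ {e : ℝ → V}, ContDiffWithinAt ℝ ∞ e J p.2 →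
      ContDiffWithinAt ℝ ∞ (fun z : ℝ × ℝ => e z.2) (I ×ˢ J) p := fun he =>
    ContDiffWithinAt.comp (g := _) (f := Prod.snd) p he contDiffWithinAt_snd (fun z hz => hz.2)
  exact (((h hα).comp contDiff_fst).contDiffWithinAt.smul (h2 hc)).add
    (((h hβ).comp contDiff_fst).contDiffWithinAt.smul (h2 hd))

end Combinations

/-! ### The boundary value problem for `h'` and `h''` -/

section BoundarySolutions

/-- Combinations of `e^{at}`, `e^{-at}`, `cos(at)`, `sin(at)`. -/
def expTrig (a x₀ x₁ x₂ x₃ t : ℝ) : ℝ :=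
  Real.exp (a * t) * x₀ + Real.exp (-(a * t)) * x₁ + Real.cos (a * t) * x₂ + Real.sin (a * t) * x₃

theorem contDiff_expTrig (a x₀ x₁ x₂ x₃ : ℝ) : ContDiff ℝ ∞ (expTrig a x₀ x₁ x₂ x₃) := by
  unfold expTrig
  fun_prop

theorem deriv_expTrig (a x₀ x₁ x₂ x₃ : ℝ) :
    deriv (expTrig a x₀ x₁ x₂ x₃) = expTrig a (a * x₀) (-(a * x₁)) (a * x₃) (-(a * x₂)) := by
  funext t
  have h : HasDerivAt (fun t => a * t) a t := by simpa using (hasDerivAt_id t).const_mul a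
  have h' : HasDerivAt (fun t => -(a * t)) (-a) t := h.neg
  have := (((h.exp.mul_const x₀).add (h'.exp.mul_const x₁)).add (h.cos.mul_const x₂)).add
    (h.sin.mul_const x₃)
  refine (HasDerivAt.deriv this).trans ?_
  simp only [expTrig]
  ring

theorem iteratedDeriv_one_expTrig (a x₀ x₁ x₂ x₃ : ℝ) :
    iteratedDeriv 1 (expTrig a x₀ x₁ x₂ x₃)
      = expTrig a (a * x₀) (-(a * x₁)) (a * x₃) (-(a * x₂)) := by
  rw [iteratedDeriv_one, deriv_expTrig]

theorem iteratedDeriv_two_expTrig (a x₀ x₁ x₂ x₃ : ℝ) :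
    iteratedDeriv 2 (expTrig a x₀ x₁ x₂ x₃)
      = expTrig a (a ^ 2 * x₀) (a ^ 2 * x₁) (-(a ^ 2 * x₂)) (-(a ^ 2 * x₃)) := by
  rw [iteratedDeriv_succ, iteratedDeriv_one_expTrig, deriv_expTrig]
  funext t
  simp only [expTrig]
  ring

theorem iteratedDeriv_four_expTrig (a x₀ x₁ x₂ x₃ t : ℝ) :
    iteratedDeriv 4 (expTrig a x₀ x₁ x₂ x₃) t = a ^ 4 * expTrig a x₀ x₁ x₂ x₃ t := by
  rw [iteratedDeriv_succ, iteratedDeriv_succ, iteratedDeriv_two_expTrig, deriv_expTrig,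
    deriv_expTrig]
  simp only [expTrig]
  ring

/-- The coefficients of `boundarySolution` with respect to its data. -/
def boundaryCoeff (T : ℝ) (j : Fin 4) : ℝ → ℝ :=
  expTrig (Real.pi / (2 * T)) ((boundaryMatrix T)⁻¹ 0 j) ((boundaryMatrix T)⁻¹ 1 j)
    ((boundaryMatrix T)⁻¹ 2 j) ((boundaryMatrix T)⁻¹ 3 j)

theorem contDiff_boundaryCoeff (T : ℝ) (j : Fin 4) : ContDiff ℝ ∞ (boundaryCoeff T j) :=
  contDiff_expTrig _ _ _ _ _

theorem boundarySolution_eq_combPath {N : ℕ} (T : ℝ) (c d : Euc N) :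
    boundarySolution T c d = combPath (boundaryCoeff T 2) (boundaryCoeff T 3) c d := by
  funext t
  simp only [boundarySolution, combPath, boundaryCoeff, expTrig, smul_add, add_smul, smul_smul]
  abel

/-- The rows evaluate, in order, the value at `0`, the first derivative at `0`, and the first and
second derivatives at `T`; since `aT = π/2`, the trigonometric entries are `0` or `±1` up to powers
of `a`. The explicit determinant is nonzero because `e^{-π/2} < 1`, so the boundary data determine
the solution. -/
theorem det_boundaryMatrix_ne_zero {T : ℝ} (hT : 0 < T) : (boundaryMatrix T).det ≠ 0 := by
  have ha : 0 < Real.pi / (2 * T) := by have := Real.pi_pos; positivity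
  have hE : 1 < Real.exp (Real.pi / 2) := Real.one_lt_exp_iff.2 (by have := Real.pi_pos; positivity)
  have hdet : (boundaryMatrix T).det
      = 2 * (Real.pi / (2 * T)) ^ 4 * (Real.exp (Real.pi / 2) + 1)
        * (Real.exp (-(Real.pi / 2)) - 1) := by
    simp only [boundaryMatrix, Matrix.det_succ_row_zero, Fin.sum_univ_succ, Matrix.submatrix_apply,
      Matrix.of_apply, Matrix.cons_val', Matrix.cons_val_zero, Matrix.cons_val_succ,
      Fin.succAbove, Matrix.det_unique]
    simp [Fin.lt_def]
    ring_nf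
  rw [hdet]
  have h1 : Real.exp (-(Real.pi / 2)) - 1 ≠ 0 := by
    have : Real.exp (-(Real.pi / 2)) < 1 := by
      rw [Real.exp_lt_one_iff]; have := Real.pi_pos; linarith
    linarith
  positivity

/-- Column `j` of the inverse gives the solution whose `j`-th boundary datum is `1` and whose others
are `0`. The boundary values of `boundaryCoeff` are read off from this. -/
theorem boundaryMatrix_mul_inv {T : ℝ} (hT : 0 < T) (i j : Fin 4) :
    ∑ k, boundaryMatrix T i k * (boundaryMatrix T)⁻¹ k j = if i = j then 1 else 0 := by
  rw [← Matrix.mul_apply, Matrix.mul_nonsing_inv _ (det_boundaryMatrix_ne_zero hT).isUnit,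
    Matrix.one_apply]

theorem deriv_boundaryCoeff_zero {T : ℝ} (hT : 0 < T) (j : Fin 4) :
    iteratedDeriv 1 (boundaryCoeff T j) 0 = if 1 = j then 1 else 0 := by
  rw [← boundaryMatrix_mul_inv hT 1 j, Fin.sum_univ_four, boundaryCoeff, iteratedDeriv_one_expTrig]
  simp [expTrig, boundaryMatrix]

theorem deriv_boundaryCoeff_end {T : ℝ} (hT : 0 < T) (j : Fin 4) :
    iteratedDeriv 1 (boundaryCoeff T j) T = if 2 = j then 1 else 0 := by
  have h : Real.pi / (2 * T) * T = Real.pi / 2 := by field_simp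
  rw [← boundaryMatrix_mul_inv hT 2 j, Fin.sum_univ_four, boundaryCoeff, iteratedDeriv_one_expTrig]
  simp [expTrig, boundaryMatrix, h]
  ring

theorem iteratedDeriv_two_boundaryCoeff_end {T : ℝ} (hT : 0 < T) (j : Fin 4) :
    iteratedDeriv 2 (boundaryCoeff T j) T = if 3 = j then 1 else 0 := by
  have h : Real.pi / (2 * T) * T = Real.pi / 2 := by field_simp
  rw [← boundaryMatrix_mul_inv hT 3 j, Fin.sum_univ_four, boundaryCoeff, iteratedDeriv_two_expTrig]
  simp [expTrig, boundaryMatrix, h]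
  ring

theorem iteratedDeriv_four_boundaryCoeff (T : ℝ) (j : Fin 4) (t : ℝ) :
    iteratedDeriv 4 (boundaryCoeff T j) t = (Real.pi / (2 * T)) ^ 4 * boundaryCoeff T j t :=
  iteratedDeriv_four_expTrig _ _ _ _ _ _

end BoundarySolutions

/-! ### Differentiating integrals at the parameter value `0` -/

section ParametricIntegral

/-- The derivative at `s = 0`, from the right, of an integral depending on the parameter `s`. -/
theorem hasDerivWithinAt_integral_param {T : ℝ} {f : ℝ × ℝ → ℝ}
    (hf : ∀ t ∈ Icc 0 T, ContDiffWithinAt ℝ ∞ f (Icc 0 T ×ˢ Icc (0 : ℝ) 1) (t, 0))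
    {t : ℝ} (ht : t ∈ Icc 0 T) :
    HasDerivWithinAt (fun s => ∫ τ in (0 : ℝ)..t, f (τ, s))
      (∫ τ in (0 : ℝ)..t, derivWithin (fun v => f (τ, v)) (Icc 0 1) 0) (Icc 0 1) 0 := by
  set I := Icc 0 T with hI
  set J := Icc (0 : ℝ) 1 with hJ
  have hT : 0 ≤ T := ht.1.trans ht.2
  have h0 : (0 : ℝ) ∈ J := by simp [hJ]
  have hJu : UniqueDiffOn ℝ J := uniqueDiffOn_Icc one_pos
  have hdiff : ∀ τ ∈ I, ∀ᶠ z in 𝓝[I ×ˢ J] (τ, (0 : ℝ)), ContDiffWithinAt ℝ 1 f (I ×ˢ J) z :=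
    fun τ hτ => (hf τ hτ).eventually_nat 1 ⟨hτ, h0⟩
  -- For `t = 0` the integral is identically zero; otherwise `T > 0`, which unique differentiability
  -- of `[0,T]` requires.
  rcases ht.1.eq_or_lt with rfl | htpos
  · simpa using hasDerivWithinAt_const (0 : ℝ) J (0 : ℝ)
  have hIu : UniqueDiffOn ℝ I := uniqueDiffOn_Icc (htpos.trans_le ht.2)
  have hgerm : ∀ τ ∈ I, ContDiffWithinAt ℝ ∞
      (fun z : ℝ × ℝ => derivWithin (fun v => f (z.1, v)) J z.2) (I ×ˢ J) (τ, 0) :=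
    fun τ hτ => (hf τ hτ).derivWithin_snd hIu hJu ⟨hτ, h0⟩
  obtain ⟨C, hC⟩ : ∃ C, ∀ τ ∈ I, ‖derivWithin (fun v => f (τ, v)) J 0‖ ≤ C :=
    isCompact_Icc.exists_bound_of_continuousOn
      (fun τ hτ => ((hgerm τ hτ).section_fst h0).continuousWithinAt)
  -- Regularity is known only near the points `(τ, 0)`. Compactness of `[0,T]` gives one interval of
  -- parameters on which `f` is `C^1` and its `s`-derivative is bounded by `C + 1`, uniformly in
  -- `τ`.
  have htube : ∀ᶠ s in 𝓝 (0 : ℝ), ∀ τ ∈ I, (τ, s) ∈ I ×ˢ J →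
      ContDiffWithinAt ℝ 1 f (I ×ˢ J) (τ, s) ∧ ‖derivWithin (fun v => f (τ, v)) J s‖ ≤ C + 1 := by
    refine isCompact_Icc.eventually_forall_of_forall_eventually (fun τ hτ => ?_)
    have h1 : ∀ᶠ z in 𝓝[I ×ˢ J] (τ, (0 : ℝ)),
        ‖derivWithin (fun v => f (z.1, v)) J z.2‖ < C + 1 :=
      (hgerm τ hτ).continuousWithinAt.norm.eventually_lt continuousWithinAt_const
        ((hC τ hτ).trans_lt (lt_add_one C))
    have h2 := eventually_nhdsWithin_iff.1 ((hdiff τ hτ).and h1)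
    have h3 : Tendsto (fun z : ℝ × ℝ => (z.2, z.1)) (𝓝 (0, τ)) (𝓝 (τ, 0)) :=
      (continuous_swap.tendsto ((0 : ℝ), τ))
    filter_upwards [h3.eventually h2] with z hz hzR
    exact ⟨(hz hzR).1, (hz hzR).2.le⟩
  obtain ⟨ε, hε, hball⟩ := Metric.eventually_nhds_iff.1 htube
  have hgood : ∀ τ ∈ I, ∀ s ∈ J, s < ε → ContDiffWithinAt ℝ 1 f (I ×ˢ J) (τ, s) ∧
      ‖derivWithin (fun v => f (τ, v)) J s‖ ≤ C + 1 := by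
    intro τ hτ s hs hsε
    exact hball (by rwa [Real.dist_0_eq_abs, abs_of_nonneg hs.1]) τ hτ ⟨hτ, hs⟩
  have hderiv : ∀ τ ∈ I, ∀ s ∈ J, s < ε →
      HasDerivWithinAt (fun v => f (τ, v)) (derivWithin (fun v => f (τ, v)) J s) J s := by
    intro τ hτ s hs hsε
    exact (((hgood τ hτ s hs hsε).1.differentiableWithinAt (by simp)).hasDerivWithinAt_snd
      hτ).differentiableWithinAt.hasDerivWithinAt
  have hcont : ∀ s ∈ J, s < ε → ContinuousOn (fun τ => f (τ, s)) I := by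
    intro s hs hsε τ hτ
    exact ((hgood τ hτ s hs hsε).1.continuousWithinAt).comp
      (f := fun τ => (τ, s)) (by fun_prop) (fun x hx => ⟨hx, hs⟩)
  have hsub : uIcc 0 t ⊆ I := by
    rw [uIcc_of_le ht.1]
    exact Icc_subset_Icc_right ht.2
  have hint : ∀ s ∈ J, s < ε → IntervalIntegrable (fun τ => f (τ, s)) MeasureTheory.volume 0 t :=
    fun s hs hsε => ((hcont s hs hsε).mono hsub).intervalIntegrable
  have hsmall : ∀ᶠ s in 𝓝[J \ {0}] (0 : ℝ), s ∈ J ∧ s < ε := by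
    filter_upwards [self_mem_nhdsWithin, mem_nhdsWithin_of_mem_nhds (Iio_mem_nhds hε)]
      with s hs hsε using ⟨hs.1, hsε⟩
  rw [hasDerivWithinAt_iff_tendsto_slope]
  have hslope : (slope (fun s => ∫ τ in (0 : ℝ)..t, f (τ, s)) 0) =ᶠ[𝓝[J \ {0}] 0]
      fun s => ∫ τ in (0 : ℝ)..t, slope (fun v => f (τ, v)) 0 s := by
    filter_upwards [hsmall] with s hs
    simp only [slope_def_module]
    rw [intervalIntegral.integral_smul, intervalIntegral.integral_sub (hint s hs.1 hs.2)
      (hint 0 h0 hε)]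
  rw [tendsto_congr' hslope]
  have hmem : ∀ τ, τ ∈ uIoc 0 t → τ ∈ I := fun τ hτ => hsub (uIoc_subset_uIcc hτ)
  -- The mean value inequality bounds the difference quotients by the constant `C + 1`, so dominated
  -- convergence applies.
  refine intervalIntegral.tendsto_integral_filter_of_dominated_convergence (fun _ => C + 1)
    ?_ ?_ (by simp) ?_
  · filter_upwards [hsmall] with s hs
    simp only [slope_def_module]
    exact ((((hint s hs.1 hs.2).sub (hint 0 h0 hε)).smul (s - 0)⁻¹).def').aestronglyMeasurable
  · filter_upwards [hsmall, self_mem_nhdsWithin] with s hs hs0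
    refine MeasureTheory.ae_of_all _ fun τ hτ => ?_
    have hspos : 0 < s := lt_of_le_of_ne hs.1.1 (fun h => hs0.2 h.symm)
    have hsubJ : Icc 0 s ⊆ J := Icc_subset_Icc_right hs.1.2
    have h1 := (convex_Icc 0 s).norm_image_sub_le_of_norm_hasDerivWithin_le
      (f := fun v => f (τ, v)) (C := C + 1)
      (fun x hx => (hderiv τ (hmem τ hτ) x (hsubJ hx) (hx.2.trans_lt hs.2)).mono hsubJ)
      (fun x hx => (hgood τ (hmem τ hτ) x (hsubJ hx) (hx.2.trans_lt hs.2)).2)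
      (left_mem_Icc.2 hspos.le) (right_mem_Icc.2 hspos.le)
    rw [slope_def_module, norm_smul, norm_inv, sub_zero, inv_mul_le_iff₀ (norm_pos_iff.2 hspos.ne'),
      mul_comm]
    simpa using h1
  · refine MeasureTheory.ae_of_all _ fun τ hτ => ?_
    exact hasDerivWithinAt_iff_tendsto_slope.1 (hderiv τ (hmem τ hτ) 0 h0 hε)

/-- The derivative at `0`, from the right, of the primitive of the germ of a smooth function. -/
theorem hasDerivWithinAt_primitive {g : ℝ → ℝ}
    (hg : ContDiffWithinAt ℝ ∞ g (Icc 0 1) 0) :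
    HasDerivWithinAt (fun s => ∫ v in (0 : ℝ)..s, g v) (g 0) (Icc 0 1) 0 := by
  have h0 : (0 : ℝ) ∈ Icc (0 : ℝ) 1 := by simp
  -- This fact enables the fundamental theorem of calculus along `[0,1]` at its end point.
  have : Fact ((0 : ℝ) ∈ Icc (0 : ℝ) 1) := ⟨h0⟩
  refine intervalIntegral.integral_hasDerivWithinAt_right (by simp) ?_ hg.continuousWithinAt
  have h1 : ∀ᶠ y in 𝓝[Icc 0 1] (0 : ℝ), ContDiffWithinAt ℝ 0 g (Icc 0 1) y := by
    simpa using hg.eventually_nat 0 h0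
  obtain ⟨w, hw, hwo⟩ := mem_nhdsWithin.1 h1
  refine ⟨w ∩ Icc 0 1, inter_mem (mem_nhdsWithin_of_mem_nhds (hw.mem_nhds hwo.1))
    self_mem_nhdsWithin, ?_⟩
  refine ContinuousOn.aestronglyMeasurable (fun y hy => ?_)
    (hw.measurableSet.inter measurableSet_Icc)
  have h2 : ContDiffWithinAt ℝ 0 g (Icc 0 1) y := hwo.2 hy
  exact h2.continuousWithinAt.mono inter_subset_right

end ParametricIntegral

/-! ### Variations of the auxiliary paths -/

section PathFamilies

variable {V : Type*} [NormedAddCommGroup V] [InnerProductSpace ℝ V] {I J : Set ℝ}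

/-- The derivative at `s = 0` of the `k`-th time derivative of the paths `h s`. -/
def pathVariation (J : Set ℝ) (h : ℝ → ℝ → V) (k : ℕ) (t : ℝ) : V :=
  derivWithin (fun s => iteratedDeriv k (h s) t) J 0

/-- A family of smooth paths `h s`, depending smoothly on the parameter `s` near `s = 0`. -/
structure SmoothPathFamily (I J : Set ℝ) (h : ℝ → ℝ → V) : Prop where
  germ : ∀ k t, ContDiffWithinAt ℝ ∞ (fun z : ℝ × ℝ => iteratedDeriv k (h z.2) z.1) (I ×ˢ J) (t, 0)
  germ_param : ∀ k t, ContDiffWithinAt ℝ ∞ (fun s => iteratedDeriv k (h s) t) J 0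
  hasDerivAt : ∀ k t, HasDerivAt (iteratedDeriv k (h 0)) (iteratedDeriv (k + 1) (h 0) t) t
  hasDerivAt_variation :
    ∀ k t, HasDerivAt (pathVariation J h k) (pathVariation J h (k + 1) t) t

theorem pathVariation_combPath {α β : ℝ → ℝ} (hα : ContDiff ℝ ∞ α) (hβ : ContDiff ℝ ∞ β)
    (hJ : UniqueDiffWithinAt ℝ J 0) {c d : ℝ → V} {c' d' : V} (hc : HasDerivWithinAt c c' J 0)
    (hd : HasDerivWithinAt d d' J 0) (k : ℕ) :
    pathVariation J (fun s => combPath α β (c s) (d s)) k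
      = combPath (iteratedDeriv k α) (iteratedDeriv k β) c' d' := by
  funext t
  simp only [pathVariation, iteratedDeriv_combPath hα hβ]
  exact (hasDerivWithinAt_combPath_param hc hd _ _ t).derivWithin hJ

/-- Time enters only through the fixed functions `α`, `β` and the parameter only through the
coefficients, so the two kinds of derivative commute without any appeal to Schwarz's theorem. -/
theorem smoothPathFamily_combPath {α β : ℝ → ℝ} (hα : ContDiff ℝ ∞ α) (hβ : ContDiff ℝ ∞ β)
    (hJ : UniqueDiffWithinAt ℝ J 0) {c d : ℝ → V} (hc : ContDiffWithinAt ℝ ∞ c J 0)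
    (hd : ContDiffWithinAt ℝ ∞ d J 0) :
    SmoothPathFamily I J (fun s => combPath α β (c s) (d s)) where
  germ k t := by
    simp only [iteratedDeriv_combPath hα hβ]
    exact contDiffWithinAt_combPath hα hβ hc hd k
  germ_param k t := by
    simp only [iteratedDeriv_combPath hα hβ]
    exact contDiffWithinAt_combPath_param hc hd _ _ t
  hasDerivAt k t := by
    simp only [iteratedDeriv_combPath hα hβ]
    exact hasDerivAt_combPath hα hβ _ _ k t
  hasDerivAt_variation k t := by
    simp only [pathVariation_combPath hα hβ hJ
      (hc.differentiableWithinAt (by simp)).hasDerivWithinAt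
      (hd.differentiableWithinAt (by simp)).hasDerivWithinAt]
    exact hasDerivAt_combPath hα hβ _ _ k t

namespace SmoothPathFamily

variable {h : ℝ → ℝ → V}

theorem hasDerivWithinAt_param (H : SmoothPathFamily I J h) (k : ℕ) (t : ℝ) :
    HasDerivWithinAt (fun s => iteratedDeriv k (h s) t) (pathVariation J h k t) J 0 :=
  ((H.germ_param k t).differentiableWithinAt (by simp)).hasDerivWithinAt

theorem hasDerivWithinAt_norm_sq (H : SmoothPathFamily I J h) (k : ℕ) (t : ℝ) :
    HasDerivWithinAt (fun s => ‖iteratedDeriv k (h s) t‖ ^ 2)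
      (2 * ⟪iteratedDeriv k (h 0) t, pathVariation J h k t⟫) J 0 :=
  (H.hasDerivWithinAt_param k t).norm_sq

theorem contDiffWithinAt_norm_sq (H : SmoothPathFamily I J h) (k : ℕ) (t : ℝ) :
    ContDiffWithinAt ℝ ∞ (fun z : ℝ × ℝ => ‖iteratedDeriv k (h z.2) z.1‖ ^ 2) (I ×ˢ J) (t, 0) :=
  (H.germ k t).norm_sq ℝ

theorem hasDerivAt_inner (H : SmoothPathFamily I J h) (k l : ℕ) (t : ℝ) :
    HasDerivAt (fun t => ⟪iteratedDeriv k (h 0) t, pathVariation J h l t⟫)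
      (⟪iteratedDeriv k (h 0) t, pathVariation J h (l + 1) t⟫
        + ⟪iteratedDeriv (k + 1) (h 0) t, pathVariation J h l t⟫) t :=
  (H.hasDerivAt k t).inner ℝ (H.hasDerivAt_variation l t)

theorem continuous_inner (H : SmoothPathFamily I J h) (k l : ℕ) :
    Continuous (fun t => ⟪iteratedDeriv k (h 0) t, pathVariation J h l t⟫) :=
  continuous_iff_continuousAt.2 fun t => (H.hasDerivAt_inner k l t).continuousAt

theorem contDiffWithinAt_inner_param (H : SmoothPathFamily I J h) (hJ : UniqueDiffOn ℝ J)
    (h0 : (0 : ℝ) ∈ J) (k : ℕ) (t : ℝ) :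
    ContDiffWithinAt ℝ ∞
      (fun v => ⟪iteratedDeriv k (h v) t, derivWithin (fun v' => h v' t) J v⟫) J 0 := by
  have h1 := (H.germ_param 0 t).derivWithin_infty hJ h0
  simp only [iteratedDeriv_zero] at h1
  exact (H.germ_param k t).inner ℝ h1

end SmoothPathFamily

end PathFamilies

/-! ### The mixed second derivative of functions such as `μ'` -/

section DoubleDerivative

/-- The mixed second derivative at `s = 0` of functions of the type of `μ'`. -/
theorem derivWithin_derivWithin_integral_add_sum {T : ℝ} (hT : 0 < T) {f : ℝ × ℝ → ℝ}
    (hf : ∀ t ∈ Icc 0 T, ContDiffWithinAt ℝ ∞ f (Icc 0 T ×ˢ Icc (0 : ℝ) 1) (t, 0))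
    {ι : Type*} (S : Finset ι) {b : ι → ℝ → ℝ → ℝ} {b' : ι → ℝ → ℝ}
    (hb : ∀ i ∈ S, ∀ t, ContDiffWithinAt ℝ ∞ (b i t) (Icc 0 1) 0)
    (hb' : ∀ i ∈ S, ∀ t, HasDerivAt (fun τ => b i τ 0) (b' i t) t) {t : ℝ} (ht : t ∈ Icc 0 T) :
    derivWithin (fun τ => derivWithin (fun s => (-∫ x in (0 : ℝ)..τ, f (x, s))
        + ∑ i ∈ S, ∫ v in (0 : ℝ)..s, b i τ v) (Icc 0 1) 0) (Icc 0 T) t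
      = -derivWithin (fun v => f (t, v)) (Icc 0 1) 0 + ∑ i ∈ S, b' i t := by
  have h0 : (0 : ℝ) ∈ Icc (0 : ℝ) 1 := by simp
  have hJ : UniqueDiffOn ℝ (Icc (0 : ℝ) 1) := uniqueDiffOn_Icc one_pos
  have hI : UniqueDiffOn ℝ (Icc 0 T) := uniqueDiffOn_Icc hT
  have h1 : ∀ τ ∈ Icc 0 T, derivWithin (fun s => (-∫ x in (0 : ℝ)..τ, f (x, s))
        + ∑ i ∈ S, ∫ v in (0 : ℝ)..s, b i τ v) (Icc 0 1) 0
      = (-∫ x in (0 : ℝ)..τ, derivWithin (fun v => f (x, v)) (Icc 0 1) 0)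
        + ∑ i ∈ S, b i τ 0 := fun τ hτ =>
    ((hasDerivWithinAt_integral_param hf hτ).neg.add (HasDerivWithinAt.fun_sum fun i hi =>
      hasDerivWithinAt_primitive (hb i hi τ))).derivWithin (hJ 0 h0)
  rw [derivWithin_congr h1 (h1 t ht)]
  have hcont : ContinuousOn (fun x => derivWithin (fun v => f (x, v)) (Icc 0 1) 0) (Icc 0 T) :=
    fun x hx => (((hf x hx).derivWithin_snd hI hJ ⟨hx, h0⟩).section_fst h0).continuousWithinAt
  have : Fact (t ∈ Icc 0 T) := ⟨ht⟩
  have h2 : HasDerivWithinAt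
      (fun τ => ∫ x in (0 : ℝ)..τ, derivWithin (fun v => f (x, v)) (Icc 0 1) 0)
      (derivWithin (fun v => f (t, v)) (Icc 0 1) 0) (Icc 0 T) t := by
    refine intervalIntegral.integral_hasDerivWithinAt_right ?_
      (hcont.stronglyMeasurableAtFilter_nhdsWithin measurableSet_Icc t) (hcont t ht)
    refine (hcont.mono ?_).intervalIntegrable
    rw [uIcc_of_le ht.1]
    exact Icc_subset_Icc_right ht.2
  exact (h2.neg.add (HasDerivWithinAt.fun_sum fun i hi =>
    (hb' i hi t).hasDerivWithinAt)).derivWithin (hI t ht)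

end DoubleDerivative

/-! ### Orders of the momenta and variation of the terminal cost -/

section Variations

variable {N M : ℕ} {Q : Type*} [TopologicalSpace Q] [ChartedSpace (Euc N) Q]
  {T : ℝ} {D : DefiningTriple N M Q T} {u₀ : ℝ → Euc M} {q₀ : ℝ → Q} {u : ℝ → ℝ → Euc M}
  {q : ℝ → ℝ → Q} {φ φ₀ φ₁ : OpenPartialHomeomorph Q (Euc N)}

theorem DefiningTriple.IsControlledVariation.smoothFamily (hT : 0 < T)
    (hF : D.IsControlledVariation u₀ q₀ u q) :
    SmoothFamily N (Icc 0 T) (Icc 0 1) D.K u q where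
  uniqueDiffOn_time := uniqueDiffOn_Icc hT
  uniqueDiffOn_param := uniqueDiffOn_Icc one_pos
  subset_closure := by
    rw [interior_prod_eq, interior_Icc, interior_Icc, closure_prod_eq, closure_Ioo hT.ne,
      closure_Ioo zero_ne_one]
  smooth_u := hF.smooth_u
  mem_K t ht s hs := (hF.controlled s hs).mem_K t ht
  smooth_q := hF.smooth_q

theorem DefiningTriple.smoothJetFun_modifiedLagrangianIn
    (hφ : φ ∈ IsManifold.maximalAtlas (𝓡 N) ∞ Q) :
    SmoothJetFun φ D.K (D.modifiedLagrangianIn φ) :=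
  (D.smoothJetFun_lagrangianIn hφ).add
    (smoothJetFun_of_cost (contDiffOn_totalDeriv (c := D.costIn φ) (D.smooth_C φ hφ)) D.K)

theorem DefiningTriple.partialGrad_costIn_eq_zero (hφ : φ ∈ IsManifold.maximalAtlas (𝓡 N) ∞ Q)
    {δ : Fin (D.n + 1)} (hδ : D.rC < δ) (t : ℝ) {x : Fin (D.n + 1) → Euc N}
    (hx : x 0 ∈ φ.target) : partialGrad (D.costIn φ t) δ x = 0 := by
  refine partialGrad_eq_zero (Eventually.of_forall fun y => ?_)
  refine (D.order_C φ hφ t x _ hx fun β hβ => ?_).symm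
  rw [Function.update_of_ne]
  rintro rfl
  omega

theorem SmoothFamily.momentum_lagrangianIn_eq_zero {I J : Set ℝ}
    (hF : SmoothFamily N I J D.K u q)
    (hφ : φ ∈ IsManifold.maximalAtlas (𝓡 N) ∞ Q) {t s : ℝ} (ht : t ∈ I) (hs : s ∈ J)
    (hq : q t s ∈ φ.source) {β : ℕ} (hβ : D.r ≤ β) :
    _root_.momentum I φ (D.lagrangianIn φ) (fun τ => u τ s) (fun τ => q τ s) β t = 0 := by
  refine Finset.sum_eq_zero fun δ hδ => ?_
  have hδ' : D.r < δ := hβ.trans_lt (Finset.mem_filter.1 hδ).2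
  have he : _root_.gradAlong I φ (D.lagrangianIn φ) (fun τ => u τ s) (fun τ => q τ s) δ
      =ᶠ[𝓝[I] t] fun _ => 0 := by
    filter_upwards [self_mem_nhdsWithin, (tendsto_mk_left_nhdsWithin hs).eventually
      (hF.eventually_mem_source (p := (t, s)) ⟨ht, hs⟩ hq)] with τ hτ hτq
    have hd := hF.mem_jetDomain (n := D.n) (p := (τ, s)) ⟨hτ, hs⟩ hτq
    refine partialGrad_eq_zero (Eventually.of_forall fun y => ?_)
    refine (D.order_L φ hφ τ _ _ hd.1 (fun β hβ => ?_) _ hd.2).symm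
    rw [Function.update_of_ne]
    rintro rfl
    omega
  rw [he.iteratedDerivWithin_eq (he.self_of_nhdsWithin ht)]
  simp

theorem SmoothFamily.momentumPairing_one (hF : SmoothFamily N (Icc 0 T) (Icc 0 1) D.K u q)
    (hφ : φ ∈ IsManifold.maximalAtlas (𝓡 N) ∞ Q) {t : ℝ} (ht : t ∈ Icc 0 T)
    (hq : q t 0 ∈ φ.source) :
    D.momentumPairing (Icc 0 T) φ u q (fun _ => 1) t
      = ∑ β ∈ Finset.range D.order,
        ⟪_root_.momentum (Icc 0 T) φ (D.lagrangianIn φ) (fun τ => u τ 0) (fun τ => q τ 0) β t,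
          iteratedDerivWithin β (_root_.jacobiCoords φ q) (Icc 0 T) t⟫ := by
  simp only [DefiningTriple.momentumPairing, one_smul]
  symm
  refine Finset.sum_subset (fun β hβ => ?_) (fun β _ hβ => ?_)
  · have h1 := Finset.mem_range.1 hβ
    have h2 := D.r_le
    have h3 := D.rC_le
    simp only [DefiningTriple.order, lt_max_iff] at h1
    exact Finset.mem_range.2 (by omega)
  · rw [hF.momentum_lagrangianIn_eq_zero hφ ht (by simp) hq, inner_zero_left]
    have h1 : ¬ β < D.order := fun h => hβ (Finset.mem_range.2 h)
    simp only [DefiningTriple.order, lt_max_iff] at h1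
    omega

variable [IsManifold (𝓡 N) ∞ Q]

/-- The pairing of the momenta of `L + dC/dt` with the Jacobi field. -/
theorem SmoothFamily.sum_inner_momentum_modified
    (hF : SmoothFamily N (Icc 0 T) (Icc 0 1) D.K u q)
    (hφ : φ ∈ IsManifold.maximalAtlas (𝓡 N) ∞ Q) {t : ℝ} (ht : t ∈ Icc 0 T)
    (hq : q t 0 ∈ φ.source) :
    ∑ β ∈ Finset.range D.order,
        ⟪_root_.momentum (Icc 0 T) φ (D.modifiedLagrangianIn φ) (fun τ => u τ 0)
          (fun τ => q τ 0) β t, iteratedDerivWithin β (_root_.jacobiCoords φ q) (Icc 0 T) t⟫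
      = D.momentumPairing (Icc 0 T) φ u q (fun _ => 1) t + D.costDifferential φ q t := by
  have h0 : (0 : ℝ) ∈ Icc (0 : ℝ) 1 := by simp
  have hC := D.smooth_C φ hφ
  have hx : _root_.jetCoords D.n (Icc 0 T) φ (fun τ => q τ 0) t 0 ∈ φ.target :=
    (hF.mem_jetDomain (n := D.n) (p := (t, 0)) ⟨ht, h0⟩ hq).1
  have hcost : D.costDifferential φ q t = ∑ δ : Fin (D.n + 1),
      ⟪_root_.momentum (Icc 0 T) φ (fun t x _ => totalDeriv (D.costIn φ) t x) (fun τ => u τ 0)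
        (fun τ => q τ 0) δ t, iteratedDerivWithin δ (_root_.jacobiCoords φ q) (Icc 0 T) t⟫ := by
    rw [DefiningTriple.costDifferential, fderiv_eq_sum_inner_partialGrad
      (differentiableAt_cost (c := D.costIn φ) hC hx)]
    refine Finset.sum_congr rfl fun δ _ => ?_
    rw [hF.momentum_totalDeriv D.uniqueDiffOn_K hφ hC (fun t x hx =>
      D.partialGrad_costIn_eq_zero hφ (by have := D.rC_le; simp; omega) t hx) h0 δ ht hq,
      DefiningTriple.jacobiField,
      (hF.hasDerivWithinAt_jetCoords hφ ht h0 hq).derivWithin (hF.uniqueDiffOn_param 0 h0)]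
    rfl
  have hsum : D.costDifferential φ q t = ∑ β ∈ Finset.range D.order,
      ⟪_root_.momentum (Icc 0 T) φ (fun t x _ => totalDeriv (D.costIn φ) t x) (fun τ => u τ 0)
        (fun τ => q τ 0) β t, iteratedDerivWithin β (_root_.jacobiCoords φ q) (Icc 0 T) t⟫ := by
    -- The sum over all jet orders is cut down to orders below `D.order`, which exceeds `D.rC`;
    -- beyond it `∂C/∂q_(β)` vanishes.
    rw [hcost, Fin.sum_univ_eq_sum_range (fun β : ℕ =>
      ⟪_root_.momentum (Icc 0 T) φ (fun t x _ => totalDeriv (D.costIn φ) t x) (fun τ => u τ 0)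
        (fun τ => q τ 0) β t, iteratedDerivWithin β (_root_.jacobiCoords φ q) (Icc 0 T) t⟫)]
    symm
    refine Finset.sum_subset (fun β hβ => ?_) (fun β hβn hβ => ?_)
    · have h1 := Finset.mem_range.1 hβ
      have h2 := D.r_le
      have h3 := D.rC_le
      simp only [DefiningTriple.order, lt_max_iff] at h1
      exact Finset.mem_range.2 (by omega)
    · have h1 : ¬ β < D.order := fun h => hβ (Finset.mem_range.2 h)
      simp only [DefiningTriple.order, lt_max_iff] at h1
      have h2 := hF.momentum_totalDeriv D.uniqueDiffOn_K hφ hC (fun t x hx =>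
        D.partialGrad_costIn_eq_zero hφ (by have := D.rC_le; simp; omega) t hx) h0
        ⟨β, Finset.mem_range.1 hβn⟩ ht hq
      rw [h2, D.partialGrad_costIn_eq_zero hφ (by simp; omega) t hx, inner_zero_left]
  rw [hsum, hF.momentumPairing_one hφ ht hq, ← Finset.sum_add_distrib]
  refine Finset.sum_congr rfl fun β _ => ?_
  rw [← inner_add_left]
  congr 1
  exact hF.momentum_add D.uniqueDiffOn_K hφ (D.smoothJetFun_lagrangianIn hφ)
    (smoothJetFun_of_cost (contDiffOn_totalDeriv (c := D.costIn φ) hC) D.K) h0 β ht hq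

theorem SmoothFamily.hasDerivWithinAt_terminalCost
    (hF : SmoothFamily N (Icc 0 T) (Icc 0 1) D.K u q) (hT : 0 < T)
    (hφ : φ ∈ IsManifold.maximalAtlas (𝓡 N) ∞ Q) (hq : q T 0 ∈ φ.source) :
    HasDerivWithinAt (fun s => D.terminalCost (fun τ => q τ s)) (D.costDifferential φ q T)
      (Icc 0 1) 0 := by
  have h0 : (0 : ℝ) ∈ Icc (0 : ℝ) 1 := by simp
  have hTT : T ∈ Icc 0 T := ⟨hT.le, le_rfl⟩
  have hx : _root_.jetCoords D.n (Icc 0 T) φ (fun τ => q τ 0) T 0 ∈ φ.target :=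
    (hF.mem_jetDomain (n := D.n) (p := (T, 0)) ⟨hTT, h0⟩ hq).1
  have h1 := (differentiableAt_cost (c := D.costIn φ) (D.smooth_C φ hφ)
    (t := T) hx).hasFDerivAt.comp_hasDerivWithinAt (0 : ℝ)
    (hF.hasDerivWithinAt_jetCoords (n := D.n) hφ hTT h0 hq)
  have he : (fun s => D.terminalCost (fun τ => q τ s)) =ᶠ[𝓝[Icc 0 1] 0]
      fun s => D.costIn φ T (_root_.jetCoords D.n (Icc 0 T) φ (fun τ => q τ s) T) := by
    filter_upwards [hF.eventually_param_mem_source hTT h0 hq] with s hs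
    rw [DefiningTriple.costIn, hF.jetOfCoords_eq hφ hTT hs.1 hs.2]
    rfl
  rw [DefiningTriple.costDifferential, DefiningTriple.jacobiField,
    (hF.hasDerivWithinAt_jetCoords hφ hTT h0 hq).derivWithin (hF.uniqueDiffOn_param 0 h0)]
  exact h1.congr_of_eventuallyEq he (he.self_of_nhdsWithin h0)

/-- All difference quotients from the right at the minimum `0` are nonnegative, hence so is their
limit. -/
theorem HasDerivWithinAt.nonneg_of_le {f : ℝ → ℝ} {f' : ℝ}
    (hf : HasDerivWithinAt f f' (Icc 0 1) 0) (hmin : ∀ s ∈ Icc (0 : ℝ) 1, f 0 ≤ f s) : 0 ≤ f' := by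
  have h1 : HasDerivWithinAt f f' (Ioc 0 1) 0 := hf.mono Ioc_subset_Icc_self
  rw [hasDerivWithinAt_iff_tendsto_slope' (by simp), nhdsWithin_Ioc_eq_nhdsGT one_pos] at h1
  refine ge_of_tendsto h1 ?_
  filter_upwards [Ioc_mem_nhdsGT one_pos] with s hs
  rw [slope_def_field]
  exact div_nonneg (sub_nonneg.2 (hmin s ⟨hs.1.le, hs.2⟩)) (by simpa using hs.1.le)

theorem DefiningTriple.IsOptimal.costDifferential_nonneg (hT : 0 < T)
    (hopt : D.IsOptimal u₀ q₀) (hF : D.IsControlledVariation u₀ q₀ u q)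
    (hφ : φ ∈ IsManifold.maximalAtlas (𝓡 N) ∞ Q) (hq : q₀ T ∈ φ.source) :
    0 ≤ D.costDifferential φ q T := by
  have hTT : T ∈ Icc 0 T := ⟨hT.le, le_rfl⟩
  have hq' : q T 0 ∈ φ.source := by rwa [hF.initial_q T hTT]
  refine ((hF.smoothFamily hT).hasDerivWithinAt_terminalCost hT hφ hq').nonneg_of_le
    fun s hs => ?_
  -- The two curves are known to agree only on `[0,T]`; this suffices because jets are taken along
  -- that interval.
  have h1 : D.terminalCost (fun τ => q τ 0) = D.terminalCost q₀ := by
    simp only [DefiningTriple.terminalCost, curveJet, hF.initial_q T hTT]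
    congr 2
    funext β
    exact iteratedDerivWithin_congr (fun τ hτ => by simp only [hF.initial_q τ hτ]) hTT
  rw [h1]
  exact hopt.2 _ _ (hF.controlled s hs)

end Variations

/-! ### Differential equations and boundary values of the auxiliary functions -/

section AuxiliaryFamilies

variable {N : ℕ} {I J : Set ℝ}

theorem contDiff_exp_neg : ContDiff ℝ ∞ (fun t : ℝ => Real.exp (-t)) := by fun_prop

theorem iteratedDeriv_exp_neg (k : ℕ) (t : ℝ) :
    iteratedDeriv k (fun t : ℝ => Real.exp (-t)) t = (-1) ^ k * Real.exp (-t) := by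
  rw [iteratedDeriv_comp_neg k Real.exp t]
  simp [iteratedDeriv_eq_iterate]

theorem iteratedDeriv_real_exp (k : ℕ) (t : ℝ) : iteratedDeriv k Real.exp t = Real.exp t := by
  simp [iteratedDeriv_eq_iterate]

/-- The paths `h = A e^t + B e^{-t}` in terms of `a = A + B` and `b = A - B`. -/
def expPath (a b : Euc N) : ℝ → Euc N :=
  combPath Real.exp (fun t => Real.exp (-t)) ((1 / 2 : ℝ) • (a + b)) ((1 / 2 : ℝ) • (a - b))

theorem iteratedDeriv_expPath (a b : Euc N) (k : ℕ) (t : ℝ) :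
    iteratedDeriv k (expPath a b) t = Real.exp t • ((1 / 2 : ℝ) • (a + b))
      + ((-1) ^ k * Real.exp (-t)) • ((1 / 2 : ℝ) • (a - b)) := by
  rw [expPath, iteratedDeriv_combPath Real.contDiff_exp contDiff_exp_neg, combPath,
    iteratedDeriv_real_exp, iteratedDeriv_exp_neg]

theorem expPath_zero (a b : Euc N) : expPath a b 0 = a := by
  simp only [expPath, combPath, Real.exp_zero, neg_zero]
  module

theorem iteratedDeriv_one_expPath_zero (a b : Euc N) : iteratedDeriv 1 (expPath a b) 0 = b := by
  rw [iteratedDeriv_expPath]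
  simp only [Real.exp_zero, neg_zero]
  module

/-- The Euler–Lagrange equation of `½‖ḣ‖² + ½‖h‖²`. -/
theorem iteratedDeriv_two_expPath (a b : Euc N) : iteratedDeriv 2 (expPath a b) = expPath a b := by
  funext t
  rw [iteratedDeriv_expPath, expPath, combPath]
  simp

theorem smoothPathFamily_expPath (hJ : UniqueDiffWithinAt ℝ J 0) {a b : ℝ → Euc N}
    (ha : ContDiffWithinAt ℝ ∞ a J 0) (hb : ContDiffWithinAt ℝ ∞ b J 0) :
    SmoothPathFamily I J (fun s => expPath (a s) (b s)) :=
  smoothPathFamily_combPath Real.contDiff_exp contDiff_exp_neg hJ ((ha.add hb).const_smul _)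
    ((ha.sub hb).const_smul _)

theorem pathVariation_expPath_zero (a b : ℝ → Euc N) :
    pathVariation J (fun s => expPath (a s) (b s)) 0 0 = derivWithin a J 0 := by
  simp only [pathVariation, iteratedDeriv_zero, expPath_zero]

variable {T : ℝ} {c d : ℝ → Euc N}

theorem smoothPathFamily_boundarySolution (hJ : UniqueDiffWithinAt ℝ J 0)
    (hc : ContDiffWithinAt ℝ ∞ c J 0) (hd : ContDiffWithinAt ℝ ∞ d J 0) :
    SmoothPathFamily I J (fun s => boundarySolution T (c s) (d s)) := by
  simp only [boundarySolution_eq_combPath]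
  exact smoothPathFamily_combPath (contDiff_boundaryCoeff T 2) (contDiff_boundaryCoeff T 3) hJ hc hd

theorem iteratedDeriv_boundarySolution (c d : Euc N) (k : ℕ) (t : ℝ) :
    iteratedDeriv k (boundarySolution T c d) t
      = iteratedDeriv k (boundaryCoeff T 2) t • c + iteratedDeriv k (boundaryCoeff T 3) t • d := by
  rw [boundarySolution_eq_combPath, iteratedDeriv_combPath (contDiff_boundaryCoeff T 2)
    (contDiff_boundaryCoeff T 3)]
  rfl

/-- The Euler–Lagrange equation of `-½‖ḧ‖² + ½ a^4 ‖h‖²` with `a = π/(2T)`. -/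
theorem iteratedDeriv_four_boundarySolution (c d : Euc N) (t : ℝ) :
    iteratedDeriv 4 (boundarySolution T c d) t
      = (Real.pi / (2 * T)) ^ 4 • boundarySolution T c d t := by
  rw [iteratedDeriv_boundarySolution, iteratedDeriv_four_boundaryCoeff,
    iteratedDeriv_four_boundaryCoeff, boundarySolution_eq_combPath, combPath, smul_add, smul_smul,
    smul_smul]

theorem iteratedDeriv_one_boundarySolution_zero (hT : 0 < T) (c d : Euc N) :
    iteratedDeriv 1 (boundarySolution T c d) 0 = 0 := by
  simp [iteratedDeriv_boundarySolution, deriv_boundaryCoeff_zero hT]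

theorem iteratedDeriv_one_boundarySolution_end (hT : 0 < T) (c d : Euc N) :
    iteratedDeriv 1 (boundarySolution T c d) T = c := by
  simp [iteratedDeriv_boundarySolution, deriv_boundaryCoeff_end hT]

theorem iteratedDeriv_two_boundarySolution_end (hT : 0 < T) (c d : Euc N) :
    iteratedDeriv 2 (boundarySolution T c d) T = d := by
  simp [iteratedDeriv_boundarySolution, iteratedDeriv_two_boundaryCoeff_end hT]

/-- The first derivative at `0` is zero for every parameter value, so its variation is zero too;
this removes the contributions of `h'` and `h''` at `t = 0`. -/
theorem pathVariation_boundarySolution_zero (hT : 0 < T) (c d : ℝ → Euc N) :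
    pathVariation J (fun s => boundarySolution T (c s) (d s)) 1 0 = 0 := by
  simp [pathVariation, iteratedDeriv_one_boundarySolution_zero hT]

theorem pathVariation_boundarySolution_end (hT : 0 < T) (c d : ℝ → Euc N) :
    pathVariation J (fun s => boundarySolution T (c s) (d s)) 1 T = derivWithin c J 0 := by
  simp only [pathVariation, iteratedDeriv_one_boundarySolution_end hT]

end AuxiliaryFamilies

/-! ### The integral identity and the theorem -/

section Labour

variable {N M : ℕ} {Q : Type*} [TopologicalSpace Q] [ChartedSpace (Euc N) Q]
  [IsManifold (𝓡 N) ∞ Q] {T : ℝ} {D : DefiningTriple N M Q T} {u : ℝ → ℝ → Euc M}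
  {q : ℝ → ℝ → Q} {φ φ₀ φ₁ : OpenPartialHomeomorph Q (Euc N)}

theorem SmoothFamily.contDiffWithinAt_iteratedDerivWithin_param
    (hF : SmoothFamily N (Icc 0 T) (Icc 0 1) D.K u q)
    (hφ : φ ∈ IsManifold.maximalAtlas (𝓡 N) ∞ Q) {t : ℝ} (ht : t ∈ Icc 0 T)
    (hq : q t 0 ∈ φ.source) (β : ℕ) :
    ContDiffWithinAt ℝ ∞ (fun s => iteratedDerivWithin β (fun τ => φ (q τ s)) (Icc 0 T) t)
      (Icc 0 1) 0 :=
  ((hF.coords hφ (p := (t, 0)) ⟨ht, by simp⟩ hq).iteratedDerivWithin_fst hF.uniqueDiffOn_time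
    hF.uniqueDiffOn_param ⟨ht, by simp⟩ β).section_snd ht

theorem SmoothFamily.derivWithin_iteratedDerivWithin_param
    (hF : SmoothFamily N (Icc 0 T) (Icc 0 1) D.K u q)
    (hφ : φ ∈ IsManifold.maximalAtlas (𝓡 N) ∞ Q) {t : ℝ} (ht : t ∈ Icc 0 T)
    (hq : q t 0 ∈ φ.source) (β : ℕ) :
    derivWithin (fun s => iteratedDerivWithin β (fun τ => φ (q τ s)) (Icc 0 T) t) (Icc 0 1) 0
      = iteratedDerivWithin β (_root_.jacobiCoords φ q) (Icc 0 T) t :=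
  derivWithin_iteratedDerivWithin_comm hF.uniqueDiffOn_time hF.uniqueDiffOn_param
    hF.subset_closure ht (by simp) (hF.coords hφ (p := (t, 0)) ⟨ht, by simp⟩ hq) β

theorem SmoothFamily.contDiffWithinAt_momentum_param
    (hF : SmoothFamily N (Icc 0 T) (Icc 0 1) D.K u q)
    (hφ : φ ∈ IsManifold.maximalAtlas (𝓡 N) ∞ Q)
    {f : ℝ → (Fin (D.n + 1) → Euc N) → Euc M → ℝ} (hf : SmoothJetFun φ D.K f)
    {t : ℝ} (ht : t ∈ Icc 0 T) (hq : q t 0 ∈ φ.source) (β : ℕ) :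
    ContDiffWithinAt ℝ ∞ (fun s => _root_.momentum (Icc 0 T) φ f (fun τ => u τ s)
      (fun τ => q τ s) β t) (Icc 0 1) 0 :=
  (hF.momentum D.uniqueDiffOn_K hφ hf (p := (t, 0)) ⟨ht, by simp⟩ hq β).section_snd ht

/-- The derivative of the Lagrangian along a variation, split into the parts due to the curve and to
the control. -/
theorem SmoothFamily.derivWithin_L_sub (hF : SmoothFamily N (Icc 0 T) (Icc 0 1) D.K u q)
    {t : ℝ} (ht : t ∈ Icc 0 T) :
    derivWithin (fun v => D.L (curveJet D.n (Icc 0 T) (fun τ => q τ v) t) (u t v)) (Icc 0 1) 0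
      = D.work (Icc 0 T) u q (fun _ => 1) t
        + fderivWithin ℝ (D.L (curveJet D.n (Icc 0 T) (fun τ => q τ 0) t)) D.K (u t 0)
          (derivWithin (u t) (Icc 0 1) 0) := by
  have h0 : (0 : ℝ) ∈ Icc (0 : ℝ) 1 := by simp
  have hφ := IsManifold.chart_mem_maximalAtlas (I := 𝓡 N) (n := ∞) (q t 0)
  have hq := mem_chart_source (Euc N) (q t 0)
  rw [(hF.hasDerivWithinAt_L hφ ht h0 hq).derivWithin (hF.uniqueDiffOn_param 0 h0),
    hF.work_eq_sum hφ contDiff_const (by simp) ht hq]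
  simp only [one_smul]
  rfl

/-- The central identity. The integrand is the work plus the time derivative of `⟪ḣ, δh⟫ - ⟪ḧ', δḣ'⟫
- ⟪ḧ'', δḣ''⟫`, summed over `β`. The boundary values of the latter cancel those of the work except
for `-dC(V)`. -/
theorem SmoothFamily.integral_labourDensity (hF : SmoothFamily N (Icc 0 T) (Icc 0 1) D.K u q)
    (hT : 0 < T)
    (hφ₀ : φ₀ ∈ IsManifold.maximalAtlas (𝓡 N) ∞ Q) (hq₀ : q 0 0 ∈ φ₀.source)
    (hφ₁ : φ₁ ∈ IsManifold.maximalAtlas (𝓡 N) ∞ Q) (hq₁ : q T 0 ∈ φ₁.source)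
    (hEL : ∀ t ∈ Icc 0 T, ∀ φ ∈ IsManifold.maximalAtlas (𝓡 N) ∞ Q, q t 0 ∈ φ.source →
      eulerLagrange (Icc 0 T) φ (D.lagrangianIn φ) (fun τ => u τ 0) (fun τ => q τ 0) t = 0) :
    IntervalIntegrable (D.labourDensity φ₀ φ₁ u q) MeasureTheory.volume 0 T ∧
      ∫ t in (0 : ℝ)..T, D.labourDensity φ₀ φ₁ u q t = -D.costDifferential φ₁ q T := by
  have h0 : (0 : ℝ) ∈ Icc (0 : ℝ) 1 := by simp
  have h0T : (0 : ℝ) ∈ Icc 0 T := ⟨le_rfl, hT.le⟩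
  have hTT : T ∈ Icc 0 T := ⟨hT.le, le_rfl⟩
  have hJ := hF.uniqueDiffOn_param
  set J := Icc (0 : ℝ) 1 with hJdef
  set I := Icc 0 T with hIdef
  set a : ℕ → ℝ → Euc N := fun β s => iteratedDerivWithin β (fun τ => φ₀ (q τ s)) I 0 with ha
  set b : ℕ → ℝ → Euc N := fun β s =>
    -_root_.momentum I φ₀ (D.lagrangianIn φ₀) (fun τ => u τ s) (fun τ => q τ s) β 0 with hb
  set c : ℕ → ℝ → Euc N := fun β s => iteratedDerivWithin β (fun τ => φ₁ (q τ s)) I T with hc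
  set d : ℕ → ℝ → Euc N := fun β s =>
    _root_.momentum I φ₁ (D.modifiedLagrangianIn φ₁) (fun τ => u τ s) (fun τ => q τ s) β T with hd
  set f : ℕ → ℝ → ℝ → Euc N := fun β s => expPath (a β s) (b β s) with hf
  set g : ℕ → ℝ → ℝ → Euc N := fun β s => boundarySolution T (c β s) (d β s) with hg
  set k : ℕ → ℝ → ℝ → Euc N := fun β s =>
    boundarySolution T (iteratedDeriv 0 (f β s) T) (iteratedDeriv 1 (f β s) T) with hk
  have hfeq : ∀ β s, D.auxH φ₀ (fun x => u x s) (fun x => q x s) β = f β s := fun β s => rfl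
  have hgeq : ∀ β s, D.auxH' φ₁ (fun x => u x s) (fun x => q x s) β = g β s := fun β s => rfl
  have hkeq : ∀ β s, D.auxH'' φ₀ (fun x => u x s) (fun x => q x s) β = k β s := by
    intro β s
    simp only [hk, iteratedDeriv_zero, iteratedDeriv_one, ← hfeq]
    rfl
  have fam_f : ∀ β, SmoothPathFamily I J (f β) := fun β =>
    smoothPathFamily_expPath (hJ 0 h0)
      (hF.contDiffWithinAt_iteratedDerivWithin_param hφ₀ h0T hq₀ β)
      (hF.contDiffWithinAt_momentum_param hφ₀ (D.smoothJetFun_lagrangianIn hφ₀) h0T hq₀ β).neg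
  have fam_g : ∀ β, SmoothPathFamily I J (g β) := fun β =>
    smoothPathFamily_boundarySolution (hJ 0 h0)
      (hF.contDiffWithinAt_iteratedDerivWithin_param hφ₁ hTT hq₁ β)
      (hF.contDiffWithinAt_momentum_param hφ₁ (D.smoothJetFun_modifiedLagrangianIn hφ₁) hTT hq₁ β)
  have fam_k : ∀ β, SmoothPathFamily I J (k β) := fun β =>
    smoothPathFamily_boundarySolution (hJ 0 h0) ((fam_f β).germ_param 0 T)
      ((fam_f β).germ_param 1 T)
  -- `κ` is the eigenvalue of the fourth derivative on `h'` and `h''`; the constant in `μ` is half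
  -- of it because it multiplies a squared norm.
  set κ := (Real.pi / (2 * T)) ^ 4 with hκ
  have hκ' : Real.pi ^ 4 / (32 * T ^ 4) = κ / 2 := by
    rw [hκ]; field_simp; norm_num
  set Lval : ℝ × ℝ → ℝ := fun z => D.L (curveJet D.n I (fun τ => q τ z.2) z.1) (u z.1 z.2) with hL
  set ρ : ℝ × ℝ → ℝ := fun z => Lval z
      + (1 / 2) * ∑ β ∈ Finset.range D.order, (‖iteratedDeriv 1 (f β z.2) z.1‖ ^ 2
        - ‖iteratedDeriv 2 (g β z.2) z.1‖ ^ 2 - ‖iteratedDeriv 2 (k β z.2) z.1‖ ^ 2)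
      + ∑ β ∈ Finset.range D.order, ((1 / 2) * ‖iteratedDeriv 0 (f β z.2) z.1‖ ^ 2
        + κ / 2 * ‖iteratedDeriv 0 (g β z.2) z.1‖ ^ 2
        + κ / 2 * ‖iteratedDeriv 0 (k β z.2) z.1‖ ^ 2) with hρ
  have hdens : ∀ t s, D.muDensity φ₀ φ₁ (fun x => u x s) (fun x => q x s) t = ρ (t, s) := by
    intro t s
    simp only [DefiningTriple.muDensity, hfeq, hgeq, hkeq, hρ, hκ', ← iteratedDeriv_one,
      iteratedDeriv_zero, hL]
    rfl
  have hρgerm : ∀ t ∈ I, ContDiffWithinAt ℝ ∞ ρ (I ×ˢ J) (t, 0) := by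
    intro t ht
    refine ((hF.contDiffOn_L (t, 0) ⟨ht, h0⟩).add (contDiffWithinAt_const.mul
      (ContDiffWithinAt.sum fun β _ => ?_))).add (ContDiffWithinAt.sum fun β _ => ?_)
    · exact (((fam_f β).contDiffWithinAt_norm_sq 1 t).sub
        ((fam_g β).contDiffWithinAt_norm_sq 2 t)).sub ((fam_k β).contDiffWithinAt_norm_sq 2 t)
    · exact ((contDiffWithinAt_const.mul ((fam_f β).contDiffWithinAt_norm_sq 0 t)).add
        (contDiffWithinAt_const.mul ((fam_g β).contDiffWithinAt_norm_sq 0 t))).add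
        (contDiffWithinAt_const.mul ((fam_k β).contDiffWithinAt_norm_sq 0 t))
  set pf : ℕ → ℕ → ℕ → ℝ → ℝ := fun β i j t =>
    ⟪iteratedDeriv i (f β 0) t, pathVariation J (f β) j t⟫ with hpf
  set pg : ℕ → ℕ → ℕ → ℝ → ℝ := fun β i j t =>
    ⟪iteratedDeriv i (g β 0) t, pathVariation J (g β) j t⟫ with hpg
  set pk : ℕ → ℕ → ℕ → ℝ → ℝ := fun β i j t =>
    ⟪iteratedDeriv i (k β 0) t, pathVariation J (k β) j t⟫ with hpk
  have hρ' : ∀ t ∈ I, derivWithin (fun v => ρ (t, v)) J 0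
      = derivWithin (fun v => Lval (t, v)) J 0
        + ∑ β ∈ Finset.range D.order, (pf β 1 1 t - pg β 2 2 t - pk β 2 2 t
          + pf β 0 0 t + κ * pg β 0 0 t + κ * pk β 0 0 t) := by
    intro t ht
    have h1 : HasDerivWithinAt (fun v => Lval (t, v)) (derivWithin (fun v => Lval (t, v)) J 0)
        J 0 :=
      (((hF.contDiffOn_L (t, 0) ⟨ht, h0⟩).section_snd ht).differentiableWithinAt
        (by simp)).hasDerivWithinAt
    have h2 := HasDerivWithinAt.fun_sum (u := Finset.range D.order) fun β _ =>
      (((fam_f β).hasDerivWithinAt_norm_sq 1 t).sub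
        ((fam_g β).hasDerivWithinAt_norm_sq 2 t)).sub ((fam_k β).hasDerivWithinAt_norm_sq 2 t)
    have h3 := HasDerivWithinAt.fun_sum (u := Finset.range D.order) fun β _ =>
      ((((fam_f β).hasDerivWithinAt_norm_sq 0 t).const_mul (1 / 2)).add
        (((fam_g β).hasDerivWithinAt_norm_sq 0 t).const_mul (κ / 2))).add
        (((fam_k β).hasDerivWithinAt_norm_sq 0 t).const_mul (κ / 2))
    refine (((h1.add (h2.const_mul (1 / 2))).add h3).derivWithin (hJ 0 h0)).trans ?_
    rw [Finset.mul_sum, add_assoc, ← Finset.sum_add_distrib]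
    congr 1
    refine Finset.sum_congr rfl fun β _ => ?_
    simp only [hpf, hpg, hpk]
    ring
  set bd : ℕ → ℝ → ℝ → ℝ := fun β t v =>
    ⟪iteratedDeriv 3 (g β v) t, derivWithin (fun v' => g β v' t) J v⟫
      + ⟪iteratedDeriv 3 (k β v) t, derivWithin (fun v' => k β v' t) J v⟫ with hbd
  have hbd0 : ∀ β, (fun τ => bd β τ 0) = fun τ => pg β 3 0 τ + pk β 3 0 τ := by
    intro β
    funext τ
    simp only [hbd, hpg, hpk, pathVariation, iteratedDeriv_zero]
  -- Differentiating `⟪h''', δh⟫` in time brings in the fourth derivative, hence the `κ` terms that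
  -- cancel the variation of the squared norms of `h'` and `h''`.
  have hbd' : ∀ β t, HasDerivAt (fun τ => bd β τ 0)
      (pg β 3 1 t + κ * pg β 0 0 t + (pk β 3 1 t + κ * pk β 0 0 t)) t := by
    intro β t
    rw [hbd0]
    have h1 := (fam_g β).hasDerivAt_inner 3 0 t
    have h2 := (fam_k β).hasDerivAt_inner 3 0 t
    have e1 : iteratedDeriv (3 + 1) (g β 0) t = κ • iteratedDeriv 0 (g β 0) t := by
      rw [iteratedDeriv_zero]
      exact iteratedDeriv_four_boundarySolution _ _ t
    have e2 : iteratedDeriv (3 + 1) (k β 0) t = κ • iteratedDeriv 0 (k β 0) t := by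
      rw [iteratedDeriv_zero]
      exact iteratedDeriv_four_boundarySolution _ _ t
    rw [e1, real_inner_smul_left] at h1
    rw [e2, real_inner_smul_left] at h2
    exact h1.add h2
  -- The boundary expression that survives integration by parts. Its derivative `E'` uses `ḧ = h`
  -- for the first path only; the fourth order equation has been used up in `hbd'`.
  set E : ℕ → ℝ → ℝ := fun β t => pf β 1 0 t - pg β 2 1 t - pk β 2 1 t with hE
  set E' : ℕ → ℝ → ℝ := fun β t => pf β 1 1 t + pf β 0 0 t - (pg β 2 2 t + pg β 3 1 t)
    - (pk β 2 2 t + pk β 3 1 t) with hE'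
  have hEE' : ∀ β t, HasDerivAt (E β) (E' β t) t := by
    intro β t
    have h1 := (fam_f β).hasDerivAt_inner 1 0 t
    have e1 : iteratedDeriv (1 + 1) (f β 0) = iteratedDeriv 0 (f β 0) := by
      rw [iteratedDeriv_zero]
      exact iteratedDeriv_two_expPath _ _
    rw [e1] at h1
    exact (h1.sub ((fam_g β).hasDerivAt_inner 2 1 t)).sub ((fam_k β).hasDerivAt_inner 2 1 t)
  have hE'cont : ∀ β, Continuous (E' β) := fun β =>
    ((((fam_f β).continuous_inner 1 1).add ((fam_f β).continuous_inner 0 0)).sub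
      (((fam_g β).continuous_inner 2 2).add ((fam_g β).continuous_inner 3 1))).sub
      (((fam_k β).continuous_inner 2 2).add ((fam_k β).continuous_inner 3 1))
  have hmu : ∀ t s, D.mu' φ₀ φ₁ u q t s = (-∫ x in (0 : ℝ)..t, ρ (x, s))
      + ∑ β ∈ Finset.range D.order, ∫ v in (0 : ℝ)..s, bd β t v := by
    intro t s
    simp only [DefiningTriple.mu', DefiningTriple.mu, hdens, hgeq, hkeq]
    rfl
  have hlabour : ∀ t ∈ I, D.labourDensity φ₀ φ₁ u q t
      = D.work I u q (fun _ => 1) t + ∑ β ∈ Finset.range D.order, E' β t := by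
    intro t ht
    have h1 := derivWithin_derivWithin_integral_add_sum hT hρgerm (Finset.range D.order)
      (b := bd) (fun β _ t => ((fam_g β).contDiffWithinAt_inner_param hJ h0 3 t).add
        ((fam_k β).contDiffWithinAt_inner_param hJ h0 3 t)) (fun β _ t => hbd' β t) ht
    have h2 : fderivWithin ℝ (D.pontryagin (curveJet D.n I (fun τ => q τ 0) t)) D.K (u t 0)
        = -fderivWithin ℝ (D.L (curveJet D.n I (fun τ => q τ 0) t)) D.K (u t 0) :=
      fderivWithin_fun_neg (D.uniqueDiffOn_K _ (hF.mem_K t ht 0 h0))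
    simp only [DefiningTriple.labourDensity, hmu]
    -- The control part of the derivative of `L` cancels the derivative of `𝒫` in the direction of
    -- the variation of the control.
    rw [h1, h2, hρ' t ht, hF.derivWithin_L_sub ht, neg_apply]
    have h3 : ∑ β ∈ Finset.range D.order, E' β t
        = ∑ β ∈ Finset.range D.order, (pf β 1 1 t - pg β 2 2 t - pk β 2 2 t
          + pf β 0 0 t + κ * pg β 0 0 t + κ * pk β 0 0 t)
        - ∑ β ∈ Finset.range D.order,
          (pg β 3 1 t + κ * pg β 0 0 t + (pk β 3 1 t + κ * pk β 0 0 t)) := by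
      rw [← Finset.sum_sub_distrib]
      refine Finset.sum_congr rfl fun β _ => ?_
      simp only [hE']
      ring
    rw [h3]
    ring
  have hwork := hF.integral_work hT hφ₀ hq₀ hφ₁ hq₁ hEL
  have huIcc : uIcc 0 T = I := uIcc_of_le hT.le
  have hint1 : IntervalIntegrable (D.work I u q fun _ => 1) MeasureTheory.volume 0 T := by
    refine ContinuousOn.intervalIntegrable ?_
    rw [huIcc]
    exact hwork.1
  have hint2 : IntervalIntegrable (fun t => ∑ β ∈ Finset.range D.order, E' β t)
      MeasureTheory.volume 0 T :=
    (continuous_finsetSum _ fun β _ => hE'cont β).intervalIntegrable _ _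
  have hcongr : EqOn (fun t => D.work I u q (fun _ => 1) t + ∑ β ∈ Finset.range D.order, E' β t)
      (D.labourDensity φ₀ φ₁ u q) (uIcc 0 T) := by
    rw [huIcc]
    exact fun t ht => (hlabour t ht).symm
  refine ⟨(hint1.add hint2).congr (hcongr.mono uIoc_subset_uIcc), ?_⟩
  rw [← intervalIntegral.integral_congr hcongr, intervalIntegral.integral_add hint1 hint2,
    hwork.2, intervalIntegral.integral_finsetSum fun β _ => (hE'cont β).intervalIntegrable _ _]
  have hEint : ∀ β, ∫ t in (0 : ℝ)..T, E' β t = E β T - E β 0 := fun β =>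
    intervalIntegral.integral_eq_sub_of_hasDerivAt (fun t _ => hEE' β t)
      ((hE'cont β).intervalIntegrable _ _)
  -- At `T`, `h''` was built so that its first and second derivatives are `h` and `ḣ`; its term
  -- cancels that of `h` and only `h'` contributes.
  have hET : ∀ β, E β T = -⟪d β 0, iteratedDerivWithin β (_root_.jacobiCoords φ₁ q) I T⟫ := by
    intro β
    have e1 : iteratedDeriv 2 (g β 0) T = d β 0 := iteratedDeriv_two_boundarySolution_end hT _ _
    have e2 : pathVariation J (g β) 1 T
        = iteratedDerivWithin β (_root_.jacobiCoords φ₁ q) I T :=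
      (pathVariation_boundarySolution_end hT _ _).trans
        (hF.derivWithin_iteratedDerivWithin_param hφ₁ hTT hq₁ β)
    have e3 : iteratedDeriv 2 (k β 0) T = iteratedDeriv 1 (f β 0) T :=
      iteratedDeriv_two_boundarySolution_end hT _ _
    have e4 : pathVariation J (k β) 1 T = pathVariation J (f β) 0 T :=
      pathVariation_boundarySolution_end hT _ _
    simp only [hE, hpf, hpg, hpk, e1, e2, e3, e4]
    ring
  have hE0 : ∀ β, E β 0 = ⟪b β 0, iteratedDerivWithin β (_root_.jacobiCoords φ₀ q) I 0⟫ := by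
    intro β
    have e1 : iteratedDeriv 1 (f β 0) 0 = b β 0 := iteratedDeriv_one_expPath_zero _ _
    have e2 : pathVariation J (f β) 0 0
        = iteratedDerivWithin β (_root_.jacobiCoords φ₀ q) I 0 :=
      (pathVariation_expPath_zero _ _).trans
        (hF.derivWithin_iteratedDerivWithin_param hφ₀ h0T hq₀ β)
    have e3 : pathVariation J (g β) 1 0 = 0 := pathVariation_boundarySolution_zero hT _ _
    have e4 : pathVariation J (k β) 1 0 = 0 := pathVariation_boundarySolution_zero hT _ _
    simp only [hE, hpf, hpg, hpk, e1, e2, e3, e4, inner_zero_right, sub_zero]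
  simp_rw [hEint, hET, hE0]
  rw [Finset.sum_sub_distrib, Finset.sum_neg_distrib]
  have hs1 := hF.sum_inner_momentum_modified hφ₁ hTT hq₁
  have hs0 := hF.momentumPairing_one hφ₀ h0T hq₀
  -- The sign in `ḣ(0) = -p_β[L]` makes the boundary terms at `0` cancel. At `T` the pairings with
  -- the momenta of `L` cancel and `-dC(V)` is left.
  simp only [hd, hb, inner_neg_left, Finset.sum_neg_distrib]
  rw [hs1, ← hs0]
  ring

end Labour

end

theorem theorem6p5 {N M : ℕ} {Q : Type*} [TopologicalSpace Q] [ChartedSpace (Euc N) Q]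
    [IsManifold (𝓡 N) ∞ Q] {T : ℝ} (hT : 0 < T) (D : DefiningTriple N M Q T)
    (u₀ : ℝ → Euc M) (q₀ : ℝ → Q) (hopt : D.IsOptimal u₀ q₀)
    (u : ℝ → ℝ → Euc M) (q : ℝ → ℝ → Q) (hF : D.IsControlledVariation u₀ q₀ u q)
    (φ₀ φ₁ : OpenPartialHomeomorph Q (Euc N))
    (hφ₀ : φ₀ ∈ IsManifold.maximalAtlas (𝓡 N) ∞ Q) (hq₀ : q₀ 0 ∈ φ₀.source)
    (hφ₁ : φ₁ ∈ IsManifold.maximalAtlas (𝓡 N) ∞ Q) (hq₁ : q₀ T ∈ φ₁.source) :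
    0 ≤ D.costDifferential φ₁ q T ∧
      IntervalIntegrable (D.labourDensity φ₀ φ₁ u q) MeasureTheory.volume 0 T ∧
      ∫ t in (0 : ℝ)..T, D.labourDensity φ₀ φ₁ u q t ≤ 0 := by
  have h1 := hopt.costDifferential_nonneg hT hF hφ₁ hq₁
  have hq₀' : q 0 0 ∈ φ₀.source := by rwa [hF.initial_q 0 ⟨le_rfl, hT.le⟩]
  have hq₁' : q T 0 ∈ φ₁.source := by rwa [hF.initial_q T ⟨hT.le, le_rfl⟩]
  have h2 := (hF.smoothFamily hT).integral_labourDensity hT hφ₀ hq₀' hφ₁ hq₁'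
    (hF.controlled 0 (by simp)).eulerLagrange_eq
  exact ⟨h1, h2.1, by rw [h2.2]; linarith⟩
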